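/- Let $(M,g)$ be a complete $n$-dimensional Riemannian manifold, possibly with boundary, and let $K$ be a symmetric $2$-tensor on $M$. Let $\mathbb H^n$ be the unit ball of $\mathbb R^n$ with the hyperbolic metric $b=4(1-|x|^2)^{-2}\delta$, and put $\rho(x)=\frac{1-|x|^2}{2}$ on it; $B_r$ and $B_r(x)$ denote geodesic balls of $\mathbb H^n$ about the origin and about $x$. Let $\alpha\in(0,1)$ and $\tau>0$. Assume that $(M,g,K)$ is a $C^{2,\alpha}_\tau$ asymptotically anti-de Sitter initial data set: $g\in C^{2,\alpha}_{\rm loc}$, $K\in C^{1,\alpha}_{\rm loc}$, and there are a compact set $K_0\subset M$, a number $R_0>0$ and a diffeomorphism $\Psi:M\setminus K_0\to\mathbb H^n\setminus\overline{B_{R_0}}$ such that $$\sup_{x\in\mathbb H^n\setminus\overline{B_{R_0+1}}}\rho(x)^{-\tau}\|\Psi_*g-b\|_{C^{2,\alpha}(B_1(x))}<\infty,\qquad \sup_{x\in\mathbb H^n\setminus\overline{B_{R_0+1}}}\rho(x)^{-\tau}\|\Psi_*K\|_{C^{1,\alpha}(B_1(x))}<\infty .$$ The norms over $B_1(x)$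 are Hölder norms on $B_1(0)$ after transport by the hyperbolic translation which takes the origin to $x$. Fix a positive $C^2$ function $\rho:M\to\mathbb R$ which equals $\rho\circ\Psi$ outside a compact set, and a finite cover of $K_0$ by coordinate balls $U_i$ whose closures are contained in smooth charts. For $v\in C^2_{\rm loc}(M)$ put $$\|v\|_{C^{2,0}_0(M)}=\sup_{x\in\mathbb H^n\setminus\overline{B_{R_0+1}}}\|v\circ\Psi^{-1}\|_{C^2(B_1(x))}+\sum_i\|v\|_{C^2(U_i)} .$$ For a positive function $u\in C^2_{\rm loc}(M)$ let $$\mathcal J(f)=\Big(g^{ij}-\frac{u^2f^if^j}{1+u^2|df|_g^2}\Big)\Big(\frac{u\,\mathrm{Hess}_{ij}f+u_if_j+f_iu_j}{\sqrt{1+u^2|df|_g^2}}-K_{ij}\Big).$$ Then for all $\Lambda\ge0$, $m>0$, $R>0$ and $T>0$ there is a constant $C>0$, depending only on these numbers and on $(M,g,K)$ (together with $\alpha,\tau$ and the fixed $\Psi$, $\rho$ and cover), with the following property. Let $u\in C^2_{\rm loc}(M)$ satisfy $\|u-\rho^{-1}\|_{C^{2,0}_0(M)}\le\Lambda$ and $\inf_Mu\ge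 m$. Let $x_0\in M$ be such that the geodesic ball $B_R(x_0)$ lies in the interior of $M$, let $\epsilon\in[0,1)$, and let $f\in C^3_{\rm loc}(B_R(x_0))$ satisfy $\mathcal J(f)=\epsilon f$ on $B_R(x_0)$ and $\sup_{B_R(x_0)}|uf|\le T$. Then $$|(u\,df)(x_0)|_g\le C .$$ -/

import Mathlib

open Set Bundle
open scoped Manifold ContDiff NNReal

noncomputable section

/-- The model vector space `ℝⁿ` with its Euclidean norm. -/
abbrev Eucl (n : ℕ) : Type := EuclideanSpace ℝ (Fin n)

/-- The `i`-th coordinate vector of `ℝⁿ`. -/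
def coordVec {n : ℕ} (i : Fin n) : Eucl n := EuclideanSpace.single i (1 : ℝ)

section LocalNorms

variable {E V : Type*} [NormedAddCommGroup E] [NormedSpace ℝ E]
  [NormedAddCommGroup V] [NormedSpace ℝ V]

/-- The `C^k` norm on `s`: the sum over `j ≤ k` of the suprema over `s` of the norms of the
`j`-th derivatives. It is used for `C^k` functions and sets `s` with unique derivatives. -/
def eCkNorm (k : ℕ) (s : Set E) (h : E → V) : ENNReal :=
  ∑ j ∈ Finset.range (k + 1), ⨆ y ∈ s, ‖iteratedFDerivWithin ℝ j h s y‖ₑ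

/-- The `C^{k,α}` norm on `s`: the `C^k` norm plus the `α`-Hölder seminorm of the `k`-th
derivative. -/
def eCkHolderNorm (k : ℕ) (α : ℝ≥0) (s : Set E) (h : E → V) : ENNReal :=
  eCkNorm k s h + eHolderNorm α (s.domRestrict (iteratedFDerivWithin ℝ k h s))

/-- `h` is of class `C^{k,α}_loc` on `s`: it is `C^k` and its `k`-th derivative is locally
`α`-Hölder continuous. -/
def IsCkHolderLocOn (k : ℕ) (α : ℝ≥0) (s : Set E) (h : E → V) : Prop :=
  ContDiffOn ℝ k h s ∧
    ∀ y ∈ s, ∃ t ∈ nhdsWithin y s, ∃ c : ℝ≥0, HolderOnWith c α (iteratedFDerivWithin ℝ k h s) t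

end LocalNorms

section Tensors

variable {n : ℕ} {H : Type*} [TopologicalSpace H] (I : ModelWithCorners ℝ (Eucl n) H)
  {M : Type*} [TopologicalSpace M] [ChartedSpace H M]

/-- A field of bilinear forms, that is a (not necessarily continuous) `2`-tensor field. -/
abbrev TwoTensor (M : Type*) [TopologicalSpace M] [ChartedSpace H M] : Type _ :=
  ∀ x : M, LinearMap.BilinForm ℝ (TangentSpace I x)

/-- The components `h(∂_i, ∂_j)` of a `2`-tensor field `h` in a local parametrization `φ` of the
manifold, defined on `s ⊆ ℝⁿ`. -/
def tensorComponents (φ : Eucl n → M) (s : Set (Eucl n)) (h : TwoTensor I M)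
    (y : Eucl n) : Fin n → Fin n → ℝ := fun i j =>
  h (φ y) (mfderivWithin 𝓘(ℝ, Eucl n) I φ s y (coordVec i))
    (mfderivWithin 𝓘(ℝ, Eucl n) I φ s y (coordVec j))

/-- The components of a `2`-tensor field in the preferred chart at `p`. -/
def chartComponents (p : M) (h : TwoTensor I M) : Eucl n → Fin n → Fin n → ℝ :=
  tensorComponents I (extChartAt I p).symm (range I) h

/-- The `2`-tensor field `h` is of class `C^{k,α}_loc`: so are its components in all charts. -/
def IsCkHolderLocTensor (k : ℕ) (α : ℝ≥0) (h : TwoTensor I M) : Prop :=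
  ∀ p : M, IsCkHolderLocOn k α (extChartAt I p).target (chartComponents I p h)

/-- The Riemannian metric, as a `2`-tensor field. -/
def metricTensor (M : Type*) [TopologicalSpace M] [ChartedSpace H M]
    [RiemannianBundle (fun x : M => TangentSpace I x)] : TwoTensor I M :=
  fun x => innerₗ (TangentSpace I x)

end Tensors

section Hyperbolic

variable {n : ℕ}

/-- The function `ρ(x) = (1 - |x|²) / 2` on the unit ball. -/
def hypRho (x : Eucl n) : ℝ := (1 - ‖x‖ ^ 2) / 2

/-- The hyperbolic metric `b = 4 (1 - |x|²)⁻² δ` of the Poincaré ball. -/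
def hypMetric (n : ℕ) : TwoTensor 𝓘(ℝ, Eucl n) (Eucl n) :=
  fun x => (4 / (1 - ‖x‖ ^ 2) ^ 2) • (innerₗ (Eucl n) : LinearMap.BilinForm ℝ (Eucl n))

/-- The complement in the Poincaré ball of the closed geodesic ball of radius `R` about the
origin (the hyperbolic distance `r` to the origin is given by `|x| = tanh (r / 2)`). -/
def hypExterior (n : ℕ) (R : ℝ) : Set (Eucl n) := {x | Real.tanh (R / 2) < ‖x‖ ∧ ‖x‖ < 1}

/-- The open geodesic ball of radius `1` about the origin of the Poincaré ball. -/
def hypUnitBall (n : ℕ) : Set (Eucl n) := Metric.ball 0 (Real.tanh (1 / 2))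

/-- The hyperbolic translation taking the origin to `x` (Möbius addition `x ⊕ y`), an isometry of
the Poincaré ball. It maps `hypUnitBall n` onto the open geodesic unit ball about `x` and
serves as a coordinate system there. -/
def hypTranslation (x y : Eucl n) : Eucl n :=
  (1 + 2 * inner ℝ x y + ‖x‖ ^ 2 * ‖y‖ ^ 2)⁻¹ •
    ((1 + 2 * inner ℝ x y + ‖y‖ ^ 2) • x + (1 - ‖x‖ ^ 2) • y)

end Hyperbolic

section Infinity

variable {n : ℕ} {H : Type*} [TopologicalSpace H] (I : ModelWithCorners ℝ (Eucl n) H)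
  (M : Type*) [TopologicalSpace M] [ChartedSpace H M]

/-- A chart at infinity: a diffeomorphism from the complement of a compact set `core` onto the
complement of a closed geodesic ball of radius `R₀` in hyperbolic space. -/
structure ChartAtInfinity where
  core : Set M
  isCompact_core : IsCompact core
  R₀ : ℝ
  R₀_pos : 0 < R₀
  Ψ : OpenPartialHomeomorph M (Eucl n)
  source_eq : Ψ.source = coreᶜ
  target_eq : Ψ.target = hypExterior n R₀
  contMDiffOn_Ψ : ContMDiffOn I 𝓘(ℝ, Eucl n) ∞ Ψ Ψ.source
  contMDiffOn_Ψ_symm : ContMDiffOn 𝓘(ℝ, Eucl n) I ∞ Ψ.symm Ψ.target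

variable {I M}

/-- The parametrization of the part of `M` which corresponds to the geodesic unit ball about `x`
in hyperbolic space. -/
def ChartAtInfinity.param (c : ChartAtInfinity I M) (x : Eucl n) : Eucl n → M :=
  fun y => c.Ψ.symm (hypTranslation x y)

/-- The weighted norm `‖Ψ_* h‖_{C^{k,α}_τ} = sup_x ρ(x)^{-τ} ‖Ψ_* h‖_{C^{k,α}(B_1(x))}`
of a `2`-tensor field `h`. -/
def ChartAtInfinity.tensorNorm (c : ChartAtInfinity I M) (k : ℕ) (α : ℝ≥0) (τ : ℝ)
    (h : TwoTensor I M) : ENNReal :=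
  ⨆ x ∈ hypExterior n (c.R₀ + 1), ENNReal.ofReal (hypRho x ^ (-τ)) *
    eCkHolderNorm k α (hypUnitBall n) (tensorComponents I (c.param x) (hypUnitBall n) h)

/-- The weighted norm `‖Ψ_* g - b‖_{C^{k,α}_τ} = sup_x ρ(x)^{-τ} ‖Ψ_* g - b‖_{C^{k,α}(B_1(x))}`
of the deviation of a metric `g` from the hyperbolic metric. -/
def ChartAtInfinity.metricDeviation (c : ChartAtInfinity I M) (k : ℕ) (α : ℝ≥0) (τ : ℝ)
    (g : TwoTensor I M) : ENNReal :=
  ⨆ x ∈ hypExterior n (c.R₀ + 1), ENNReal.ofReal (hypRho x ^ (-τ)) *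
    eCkHolderNorm k α (hypUnitBall n) (fun y =>
      tensorComponents I (c.param x) (hypUnitBall n) g y -
        tensorComponents 𝓘(ℝ, Eucl n) (hypTranslation x) (hypUnitBall n) (hypMetric n) y)

/-- `(M, g, K)`, where `g` is the Riemannian metric of `M`, is a `C^{k,α}_τ` asymptotically
anti-de Sitter initial data set (`k ≥ 1`) with the chart at infinity `c`. -/
structure IsAsympAntiDeSitter [RiemannianBundle (fun x : M => TangentSpace I x)]
    (k : ℕ) (α : ℝ≥0) (τ : ℝ) (K : TwoTensor I M) (c : ChartAtInfinity I M) : Prop where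
  metric_loc : IsCkHolderLocTensor I k α (metricTensor I M)
  K_symm : ∀ x v w, K x v w = K x w v
  K_loc : IsCkHolderLocTensor I (k - 1) α K
  metric_decay : c.metricDeviation k α τ (metricTensor I M) < ⊤
  K_decay : c.tensorNorm (k - 1) α τ K < ⊤

/-- `ρ : M → ℝ` is a positive `C²` function which outside a compact set is the function
`(1 - |x|²) / 2` of the chart at infinity. -/
structure ChartAtInfinity.IsRho (c : ChartAtInfinity I M) (ρ : M → ℝ) : Prop where
  pos : ∀ x, 0 < ρ x
  contMDiff : ContMDiff I 𝓘(ℝ, ℝ) 2 ρ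
  eq_hypRho : ∃ S : Set M, IsCompact S ∧ c.core ⊆ S ∧ ∀ x ∉ S, ρ x = hypRho (c.Ψ x)

/-- A finite cover of the core of a chart at infinity by coordinate balls. -/
structure ChartAtInfinity.CoreCover (c : ChartAtInfinity I M) where
  centers : Finset M
  radius : M → ℝ
  closedBall_subset : ∀ p ∈ centers,
    Metric.closedBall (extChartAt I p p) (radius p) ∩ range I ⊆ (extChartAt I p).target
  core_subset : c.core ⊆ ⋃ p ∈ centers,
    (extChartAt I p).source ∩ extChartAt I p ⁻¹' Metric.ball (extChartAt I p p) (radius p)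

/-- The norm of `C^{k,0}_0(M)`: the supremum of the `C^k` norms over the geodesic unit balls in the
hyperbolic end, plus the `C^k` norms over the coordinate balls which cover the core. -/
def ChartAtInfinity.CoreCover.eNorm {c : ChartAtInfinity I M} (B : c.CoreCover) (k : ℕ)
    (v : M → ℝ) : ENNReal :=
  (⨆ x ∈ hypExterior n (c.R₀ + 1), eCkNorm k (hypUnitBall n) (v ∘ c.param x)) +
    ∑ p ∈ B.centers, eCkNorm k (Metric.ball (extChartAt I p p) (B.radius p) ∩ range I)
      (v ∘ (extChartAt I p).symm)

end Infinity

/-! ### The Jang operator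

In this section `g` and `K` are the components of a metric and of a symmetric `2`-tensor in local
coordinates, `u` and `f` are functions of these coordinates, and everything is evaluated
at `y`. -/

namespace LocalCoords

variable {n : ℕ} (g K : Eucl n → Fin n → Fin n → ℝ) (u f : Eucl n → ℝ) (y : Eucl n)

/-- `f_i = ∂_i f`. -/
def partialDeriv (i : Fin n) : ℝ := fderiv ℝ f y (coordVec i)

/-- The inverse metric `g^{ij}`. -/
def invMetric : Matrix (Fin n) (Fin n) ℝ := (Matrix.of (g y))⁻¹

/-- `f^i = g^{ij} f_j`. -/
def grad (i : Fin n) : ℝ := ∑ j, invMetric g y i j * partialDeriv f y j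

/-- `|df|_g² = g^{ij} f_i f_j`. -/
def normSqD : ℝ := ∑ i, grad g f y i * partialDeriv f y i

/-- The Christoffel symbol `Γ_{ij}^k` of the Levi-Civita connection. -/
def christoffel (k i j : Fin n) : ℝ :=
  (1 / 2) * ∑ l, invMetric g y k l * (partialDeriv (fun z => g z j l) y i +
    partialDeriv (fun z => g z i l) y j - partialDeriv (fun z => g z i j) y l)

/-- `Hess_{ij} f = ∂_i ∂_j f - Γ_{ij}^k ∂_k f`. -/
def hess (i j : Fin n) : ℝ :=
  partialDeriv (fun z => partialDeriv f z j) y i - ∑ k, christoffel g y k i j * partialDeriv f y k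

/-- `𝒥(f) = (g^{ij} - u² f^i f^j / (1 + u² |df|²)) *
  ((u Hess_{ij} f + u_i f_j + f_i u_j) / √(1 + u² |df|²) - K_{ij})`. -/
def jang : ℝ :=
  ∑ i, ∑ j, (invMetric g y i j -
      u y ^ 2 * grad g f y i * grad g f y j / (1 + u y ^ 2 * normSqD g f y)) *
    ((u y * hess g f y i j + partialDeriv u y i * partialDeriv f y j +
        partialDeriv f y i * partialDeriv u y j) / Real.sqrt (1 + u y ^ 2 * normSqD g f y) -
      K y i j)

end LocalCoords

/-- The operator `𝒥(f)` of the generalized Jang equation with warping factor `u` on `(M, g, K)`,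
at an interior point `x` of `M`, computed in the preferred chart at `x`. -/
def jangOperator {n : ℕ} {H : Type*} [TopologicalSpace H] (I : ModelWithCorners ℝ (Eucl n) H)
    {M : Type*} [TopologicalSpace M] [ChartedSpace H M]
    [RiemannianBundle (fun x : M => TangentSpace I x)] (K : TwoTensor I M) (u f : M → ℝ)
    (x : M) : ℝ :=
  LocalCoords.jang (chartComponents I x (metricTensor I M)) (chartComponents I x K)
    (u ∘ (extChartAt I x).symm) (f ∘ (extChartAt I x).symm) (extChartAt I x x)

/-- The differential `df` at the point `x`, as a linear form on the tangent space. -/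
def covector {n : ℕ} {H : Type*} [TopologicalSpace H] (I : ModelWithCorners ℝ (Eucl n) H)
    {M : Type*} [TopologicalSpace M] [ChartedSpace H M] (f : M → ℝ) (x : M) :
    TangentSpace I x →L[ℝ] ℝ := mfderiv I 𝓘(ℝ, ℝ) f x

/-- The norm `|u df|_g` at the point `x`: the norm of a linear form on the tangent space with the
inner product `g`. -/
def warpedGradNorm {n : ℕ} {H : Type*} [TopologicalSpace H] (I : ModelWithCorners ℝ (Eucl n) H)
    {M : Type*} [TopologicalSpace M] [ChartedSpace H M]
    [RiemannianBundle (fun x : M => TangentSpace I x)] (u f : M → ℝ) (x : M) : ℝ :=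
  ‖u x • covector I f x‖

end

open scoped Topology

/-! ### Bilinear forms in coordinates and frames -/

/-! The estimate is a maximum principle of Korevaar type for the slope of the graph, carried out in
a coordinate ball with constants that depend only on bounds of the geometry there; those bounds are
then made uniform over `M`.

Local part. Put `a = u⁻²`, `w = a + |df|²` and `v = √w`. Multiplied by `w v`, the Jang equation
becomes `PolynomialJang`, with principal part `w g^{ij} - f^i f^j`. Consider `Q = (exp (k φ) - 1)²
w` with `φ = ψ + b f`, where `ψ` is a quadratic cut-off and `b` is so small that `φ` is negative on
the boundary of a smaller ball. Maximise `Q` over the region `φ ≥ 0` and pass to coordinates that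
are normal at the maximum point (`exists_normalCoordinates`). Write `p = df`, `d = dφ`, `F = Hess f
(p, ·)` and `κ = k exp (k φ) / (exp (k φ) - 1)`. The first derivative test gives `F = -w κ d - da /
2`. The second derivative test is traced with `δ - p ⊗ p / w`; the equation differentiated along `p`
then removes the third derivatives of `f`, and the squared norm of `Hess f` in the same inverse
metric is nonnegative. In the resulting inequality all terms quadratic in `κ` cancel, and division
by `2 w κ` leaves `k (|d|² - ⟨d, p⟩² / w)` bounded by terms that do not grow with `k` or `v`
(`jang_maximum_inequality`). If `v` is large, the bracket is at least `b² λ / 2`, where `λ` bounds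
`a` from below, so a large `k` gives a contradiction (`jang_gradient_bound_of_inequality`). Hence
`v` is bounded at the maximum point, and comparing `Q` there with `Q` at the centre bounds the slope
at the centre (`exists_local_gradient_bound`).

Uniformity. The Jang operator is invariant under changes of coordinates (`jang_pullback`), so the
local estimate applies in every smooth parametrization. Near a given interior point the geometry is
bounded by continuity. A boundary point needs no estimate, since the geodesic balls in question
avoid it. Near infinity the hyperbolic translations parametrize unit balls in which `g` is uniformly
close to one fixed metric, but `u` grows like `ρ⁻¹`. The triple `(u, f, ε)` is therefore replaced by
`(s u, s⁻¹ f, s ε)` with `s = ρ(x)`: this changes neither the operator (`jang_scale`) nor `u df` nor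
`u f`, and `s u` has a `C²` bound and a positive lower bound because the quotient of the values of
`ρ` at `x` and at a translated point is explicit (`hypRho_hypTranslation`). The rest of `M` is
relatively compact by completeness (`isCompact_closure_annulus`), so finitely many local constants
suffice there. -/

/-- The bilinear form with the given components. -/
noncomputable def bilin {n : ℕ} (A : Fin n → Fin n → ℝ) (v w : Eucl n) : ℝ := ∑ i, ∑ j, A i j * v i * w j

section Bilin

variable {n : ℕ} (A : Fin n → Fin n → ℝ)

@[simp] lemma coordVec_apply (i j : Fin n) : (coordVec i : Eucl n) j = if j = i then 1 else 0 := by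
  simp [coordVec]

lemma sum_coordVec (v : Eucl n) : ∑ i, v i • (coordVec i : Eucl n) = v := by
  ext j
  simp

lemma bilin_coordVec (i j : Fin n) : bilin A (coordVec i) (coordVec j) = A i j := by
  simp [bilin]

lemma bilin_add_left (u v w : Eucl n) : bilin A (u + v) w = bilin A u w + bilin A v w := by
  simp only [bilin, ← Finset.sum_add_distrib]
  exact Finset.sum_congr rfl fun i _ => Finset.sum_congr rfl fun j _ => by simp; ring

lemma bilin_add_right (u v w : Eucl n) : bilin A u (v + w) = bilin A u v + bilin A u w := by
  simp only [bilin, ← Finset.sum_add_distrib]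
  exact Finset.sum_congr rfl fun i _ => Finset.sum_congr rfl fun j _ => by simp; ring

lemma bilin_smul_left (c : ℝ) (v w : Eucl n) : bilin A (c • v) w = c * bilin A v w := by
  simp only [bilin, Finset.mul_sum]
  exact Finset.sum_congr rfl fun i _ => Finset.sum_congr rfl fun j _ => by simp; ring

lemma bilin_smul_right (c : ℝ) (v w : Eucl n) : bilin A v (c • w) = c * bilin A v w := by
  simp only [bilin, Finset.mul_sum]
  exact Finset.sum_congr rfl fun i _ => Finset.sum_congr rfl fun j _ => by simp; ring

lemma bilin_sum_left {ι : Type*} (s : Finset ι) (v : ι → Eucl n) (w : Eucl n) :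
    bilin A (∑ k ∈ s, v k) w = ∑ k ∈ s, bilin A (v k) w := by
  classical
  induction s using Finset.induction_on with
  | empty => simp [bilin]
  | insert a s ha ih => rw [Finset.sum_insert ha, Finset.sum_insert ha, bilin_add_left, ih]

lemma bilin_sum_right {ι : Type*} (s : Finset ι) (v : Eucl n) (w : ι → Eucl n) :
    bilin A v (∑ k ∈ s, w k) = ∑ k ∈ s, bilin A v (w k) := by
  classical
  induction s using Finset.induction_on with
  | empty => simp [bilin]
  | insert a s ha ih => rw [Finset.sum_insert ha, Finset.sum_insert ha, bilin_add_right, ih]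

lemma bilin_symm (h : ∀ i j, A i j = A j i) (v w : Eucl n) : bilin A v w = bilin A w v := by
  unfold bilin
  rw [Finset.sum_comm]
  exact Finset.sum_congr rfl fun i _ => Finset.sum_congr rfl fun j _ => by rw [h]; ring

lemma bilin_sub (B : Fin n → Fin n → ℝ) (v w : Eucl n) :
    bilin (A - B) v w = bilin A v w - bilin B v w := by
  simp only [bilin, ← Finset.sum_sub_distrib, Pi.sub_apply]
  exact Finset.sum_congr rfl fun i _ => Finset.sum_congr rfl fun j _ => by ring

lemma abs_coord_le_norm (v : Eucl n) (i : Fin n) : |v i| ≤ ‖v‖ := by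
  simpa using PiLp.norm_apply_le v i

lemma norm_coordVec (i : Fin n) : ‖(coordVec i : Eucl n)‖ = 1 := by
  simp [coordVec]

lemma abs_entry_le_norm (i j : Fin n) : |A i j| ≤ ‖A‖ :=
  (norm_le_pi_norm (A i) j).trans (norm_le_pi_norm A i)

lemma abs_bilin_le (v w : Eucl n) : |bilin A v w| ≤ n ^ 2 * ‖A‖ * ‖v‖ * ‖w‖ := by
  calc |bilin A v w| ≤ ∑ i : Fin n, ∑ j : Fin n, ‖A‖ * ‖v‖ * ‖w‖ := by
        refine (Finset.abs_sum_le_sum_abs _ _).trans (Finset.sum_le_sum fun i _ => ?_)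
        refine (Finset.abs_sum_le_sum_abs _ _).trans (Finset.sum_le_sum fun j _ => ?_)
        rw [abs_mul, abs_mul]
        gcongr
        · exact abs_entry_le_norm A i j
        · exact abs_coord_le_norm v i
        · exact abs_coord_le_norm w j
    _ = n ^ 2 * ‖A‖ * ‖v‖ * ‖w‖ := by simp; ring

lemma bilin_eq_dotProduct (v w : Eucl n) :
    bilin A v w = v.ofLp ⬝ᵥ (Matrix.of A).mulVec w.ofLp := by
  simp only [bilin, dotProduct, Matrix.mulVec, Finset.mul_sum, Matrix.of_apply]
  exact Finset.sum_congr rfl fun i _ => Finset.sum_congr rfl fun j _ => by ring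

/-- A symmetric positive definite bilinear form has an orthonormal frame. -/
lemma exists_bilin_orthonormal (hs : ∀ i j, A i j = A j i)
    (hpos : ∀ v : Eucl n, v ≠ 0 → 0 < bilin A v v) :
    ∃ b : Fin n → Eucl n, ∀ i j, bilin A (b i) (b j) = if i = j then 1 else 0 := by
  have hA : (Matrix.of A).PosDef := by
    rw [Matrix.posDef_iff_dotProduct_mulVec]
    refine ⟨by ext i j; simp [hs], fun x hx => ?_⟩
    have := hpos (WithLp.toLp 2 x) (by simpa using hx)
    simpa [bilin_eq_dotProduct] using this
  refine ⟨fun k => (Real.sqrt (hA.1.eigenvalues k))⁻¹ • hA.1.eigenvectorBasis k, fun i j => ?_⟩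
  have hl := hA.eigenvalues_pos
  have ho := hA.1.eigenvectorBasis.orthonormal
  rw [orthonormal_iff_ite] at ho
  have hin : (hA.1.eigenvectorBasis i).ofLp ⬝ᵥ (hA.1.eigenvectorBasis j).ofLp
      = if i = j then 1 else 0 := by
    rw [← ho i j, PiLp.inner_apply]
    simp [dotProduct, mul_comm]
  rw [bilin_smul_left, bilin_smul_right, bilin_eq_dotProduct, hA.1.mulVec_eigenvectorBasis,
    dotProduct_smul, hin]
  split_ifs with h
  · subst h
    have h1 := Real.mul_self_sqrt (hl i).le
    have h2 : Real.sqrt (hA.1.eigenvalues i) ≠ 0 := (Real.sqrt_pos.2 (hl i)).ne'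
    simp only [smul_eq_mul, mul_one]
    nth_rewrite 3 [← h1]
    field_simp
  · simp

/-- With the frame vectors as the columns of `Bm`, orthonormality reads `Bmᵀ A Bm = 1`; for square
matrices this makes `Bm Bmᵀ` a left inverse of `A`. Traces with the inverse metric thereby become
sums over a frame. -/
lemma inv_eq_sum_frame {b : Fin n → Eucl n}
    (hb : ∀ i j, bilin A (b i) (b j) = if i = j then 1 else 0) (i j : Fin n) :
    (Matrix.of A)⁻¹ i j = ∑ k, b k i * b k j := by
  let Bm : Matrix (Fin n) (Fin n) ℝ := Matrix.of fun i k => b k i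
  have h1 : Bm.transpose * Matrix.of A * Bm = 1 := by
    ext i j
    rw [Matrix.one_apply, ← hb, bilin_eq_dotProduct, Matrix.mul_assoc, Matrix.mul_apply]
    simp [Bm, dotProduct, Matrix.mulVec, Matrix.mul_apply]
  have h2 : Bm * Bm.transpose * Matrix.of A = 1 := by
    rw [Matrix.mul_assoc]
    exact mul_eq_one_comm.1 h1
  rw [Matrix.inv_eq_left_inv h2]
  simp [Bm, Matrix.mul_apply]

lemma sum_mul_frame {b : Fin n → Eucl n} (Y : Fin n → Fin n → ℝ) :
    ∑ i, ∑ j, (∑ k, b k i * b k j) * Y i j = ∑ k, bilin Y (b k) (b k) := by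
  simp only [bilin, Finset.sum_mul]
  calc _ = ∑ i, ∑ k, ∑ j, b k i * b k j * Y i j :=
        Finset.sum_congr rfl fun i _ => Finset.sum_comm
    _ = ∑ k, ∑ i, ∑ j, b k i * b k j * Y i j := Finset.sum_comm
    _ = _ := Finset.sum_congr rfl fun k _ => Finset.sum_congr rfl fun i _ =>
        Finset.sum_congr rfl fun j _ => by ring

lemma isUnit_det_of_pos (hs : ∀ i j, A i j = A j i)
    (hpos : ∀ v : Eucl n, v ≠ 0 → 0 < bilin A v v) : IsUnit (Matrix.of A).det := by
  have hA : (Matrix.of A).PosDef := by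
    rw [Matrix.posDef_iff_dotProduct_mulVec]
    refine ⟨by ext i j; simp [hs], fun x hx => ?_⟩
    have := hpos (WithLp.toLp 2 x) (by simpa using hx)
    simpa [bilin_eq_dotProduct] using this
  exact hA.det_pos.ne'.isUnit

end Bilin

/-! ### Invariant form of the Jang operator -/

namespace LocalCoords

variable {n : ℕ} (g K : Eucl n → Fin n → Fin n → ℝ) (u f : Eucl n → ℝ) (y : Eucl n)

/-- The gradient as a vector. -/
noncomputable def gradVec : Eucl n := WithLp.toLp 2 (grad g f y)

/-- The Hessian as a bilinear form, expressed without Christoffel symbols. -/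
noncomputable def hessForm (N v w : Eucl n) : ℝ :=
  fderiv ℝ (fderiv ℝ f) y v w - (1 / 2) * (bilin (fderiv ℝ g y v) w N +
    bilin (fderiv ℝ g y w) v N - bilin (fderiv ℝ g y N) v w)

/-- The `2`-tensor which is traced in the Jang operator. -/
noncomputable def jangForm (N v w : Eucl n) (D : ℝ) : ℝ :=
  (u y * hessForm g f y N v w + fderiv ℝ u y v * fderiv ℝ f y w +
    fderiv ℝ f y v * fderiv ℝ u y w) / Real.sqrt D - bilin (K y) v w

variable {g K u f y}

lemma fderiv_eq_sum (v : Eucl n) (f : Eucl n → ℝ) (y : Eucl n) :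
    fderiv ℝ f y v = ∑ i, partialDeriv f y i * v i := by
  conv_lhs => rw [← sum_coordVec v]
  simp [partialDeriv, mul_comm]

lemma fderiv_entry (hg : DifferentiableAt ℝ g y) (v : Eucl n) (i j : Fin n) :
    fderiv ℝ g y v i j = fderiv ℝ (fun z => g z i j) y v := by
  have h := hg.hasFDerivAt
  rw [hasFDerivAt_pi'] at h
  have h2 := (hasFDerivAt_pi'.1 (h i)) j
  have h3 : HasFDerivAt (fun z => g z i j) _ y := h2
  rw [h3.fderiv]
  rfl

lemma bilin_grad_left (hs : ∀ i j, g y i j = g y j i) (hdet : IsUnit (Matrix.of (g y)).det)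
    (v : Eucl n) : bilin (g y) (gradVec g f y) v = fderiv ℝ f y v := by
  rw [bilin_symm _ hs, bilin_eq_dotProduct, fderiv_eq_sum]
  have : (gradVec g f y).ofLp = ((Matrix.of (g y))⁻¹).mulVec (partialDeriv f y) := by
    ext i
    simp [gradVec, grad, Matrix.mulVec, dotProduct, invMetric]
  rw [this, Matrix.mulVec_mulVec, Matrix.mul_nonsing_inv _ hdet, Matrix.one_mulVec]
  simp [dotProduct, mul_comm]

lemma normSqD_eq : normSqD g f y = fderiv ℝ f y (gradVec g f y) := by
  rw [fderiv_eq_sum]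
  simp [normSqD, gradVec, mul_comm]

/-- The Christoffel symbols enter only contracted with `df`. Moving the inverse metric onto `df`
turns this contraction into first derivatives of `g` evaluated on the gradient, which is easier to
transform and to differentiate. -/
lemma hess_eq (hg : DifferentiableAt ℝ g y) (hs : ∀ i j, g y i j = g y j i)
    (hf : DifferentiableAt ℝ (fderiv ℝ f) y) (i j : Fin n) :
    hess g f y i j = hessForm g f y (gradVec g f y) (coordVec i) (coordVec j) := by
  have h1 : partialDeriv (fun z => partialDeriv f z j) y i
      = fderiv ℝ (fderiv ℝ f) y (coordVec i) (coordVec j) := by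
    unfold partialDeriv
    rw [fderiv_clm_apply hf (by fun_prop)]
    simp
  have hsym : ∀ k l, invMetric g y k l = invMetric g y l k := by
    intro k l
    have : (Matrix.of (g y)).transpose = Matrix.of (g y) := by
      ext a b
      simp [hs a b]
    have h2 : ((Matrix.of (g y))⁻¹).transpose = (Matrix.of (g y))⁻¹ := by
      rw [Matrix.transpose_nonsing_inv, this]
    exact congrFun (congrFun h2 l) k
  unfold hess hessForm
  rw [h1]
  congr 1
  have h3 : ∀ v : Eucl n, ∀ a : Fin n, bilin (fderiv ℝ g y v) (coordVec a) (gradVec g f y)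
      = ∑ l, fderiv ℝ (fun z => g z a l) y v * grad g f y l := by
    intro v a
    simp [bilin, gradVec, fderiv_entry hg]
  have h4 : bilin (fderiv ℝ g y (gradVec g f y)) (coordVec i) (coordVec j)
      = ∑ l, partialDeriv (fun z => g z i j) y l * grad g f y l := by
    rw [bilin_coordVec, fderiv_entry hg, fderiv_eq_sum]
    simp [gradVec]
  rw [h3, h3, h4, ← Finset.sum_add_distrib, ← Finset.sum_sub_distrib, Finset.mul_sum]
  simp only [christoffel, Finset.sum_mul, Finset.mul_sum]
  rw [Finset.sum_comm]
  refine Finset.sum_congr rfl fun l _ => ?_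
  simp only [grad, Finset.mul_sum, ← Finset.sum_add_distrib, ← Finset.sum_sub_distrib]
  refine Finset.sum_congr rfl fun k _ => ?_
  rw [hsym l k]
  unfold partialDeriv
  ring

lemma hessForm_eq_sum (N v w : Eucl n) : hessForm g f y N v w =
    bilin (fun i j => hessForm g f y N (coordVec i) (coordVec j)) v w := by
  have hl : ∀ (s : Finset (Fin n)) (c : Fin n → ℝ) (w : Eucl n),
      hessForm g f y N (∑ i ∈ s, c i • coordVec i) w
        = ∑ i ∈ s, c i * hessForm g f y N (coordVec i) w := by
    intro s c w
    simp only [hessForm, map_sum, bilin_sum_left, map_smul, bilin_smul_left, Finset.mul_sum,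
      mul_sub, mul_add]
    simp only [sum_apply, smul_apply, smul_eq_mul]
    have : ∀ w : Eucl n, bilin (∑ i ∈ s, c i • fderiv ℝ g y (coordVec i)) w N
        = ∑ i ∈ s, c i * bilin (fderiv ℝ g y (coordVec i)) w N := by
      intro w
      simp only [bilin, Finset.sum_apply, Pi.smul_apply, smul_eq_mul, Finset.sum_mul,
        Finset.mul_sum]
      calc _ = ∑ a, ∑ k ∈ s, ∑ b, c k * fderiv ℝ g y (coordVec k) a b * w a * N b :=
            Finset.sum_congr rfl fun i _ => Finset.sum_comm
        _ = ∑ k ∈ s, ∑ a, ∑ b, c k * fderiv ℝ g y (coordVec k) a b * w a * N b := Finset.sum_comm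
        _ = _ := Finset.sum_congr rfl fun k _ => Finset.sum_congr rfl fun i _ =>
            Finset.sum_congr rfl fun j _ => by ring
    rw [this]
    simp only [Finset.mul_sum, ← Finset.sum_add_distrib, ← Finset.sum_sub_distrib]
    exact Finset.sum_congr rfl fun i _ => by ring
  have hr : ∀ (s : Finset (Fin n)) (c : Fin n → ℝ) (v : Eucl n),
      hessForm g f y N v (∑ i ∈ s, c i • coordVec i)
        = ∑ i ∈ s, c i * hessForm g f y N v (coordVec i) := by
    intro s c v
    simp only [hessForm, map_sum, bilin_sum_left, bilin_sum_right, map_smul, bilin_smul_left,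
      bilin_smul_right, smul_eq_mul, Finset.mul_sum, mul_sub, mul_add]
    have : bilin (∑ i ∈ s, c i • fderiv ℝ g y (coordVec i)) v N
        = ∑ i ∈ s, c i * bilin (fderiv ℝ g y (coordVec i)) v N := by
      simp only [bilin, Finset.sum_apply, Pi.smul_apply, smul_eq_mul, Finset.sum_mul,
        Finset.mul_sum]
      calc _ = ∑ a, ∑ k ∈ s, ∑ b, c k * fderiv ℝ g y (coordVec k) a b * v a * N b :=
            Finset.sum_congr rfl fun i _ => Finset.sum_comm
        _ = ∑ k ∈ s, ∑ a, ∑ b, c k * fderiv ℝ g y (coordVec k) a b * v a * N b := Finset.sum_comm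
        _ = _ := Finset.sum_congr rfl fun k _ => Finset.sum_congr rfl fun i _ =>
            Finset.sum_congr rfl fun j _ => by ring
    rw [this]
    simp only [Finset.mul_sum, ← Finset.sum_add_distrib, ← Finset.sum_sub_distrib]
    exact Finset.sum_congr rfl fun i _ => by ring
  conv_lhs => rw [← sum_coordVec v, ← sum_coordVec w]
  rw [hl]
  simp only [hr, bilin, Finset.mul_sum]
  exact Finset.sum_congr rfl fun i _ => Finset.sum_congr rfl fun j _ => by ring

/-- The Jang operator as a trace with respect to an orthonormal frame. -/
lemma jang_eq_frame (hg : DifferentiableAt ℝ g y) (hs : ∀ i j, g y i j = g y j i)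
    (hf : DifferentiableAt ℝ (fderiv ℝ f) y) {b : Fin n → Eucl n}
    (hb : ∀ i j, bilin (g y) (b i) (b j) = if i = j then 1 else 0) :
    jang g K u f y = (∑ k, jangForm g K u f y (gradVec g f y) (b k) (b k)
        (1 + u y ^ 2 * normSqD g f y)) -
      u y ^ 2 * jangForm g K u f y (gradVec g f y) (gradVec g f y) (gradVec g f y)
        (1 + u y ^ 2 * normSqD g f y) / (1 + u y ^ 2 * normSqD g f y) := by
  set D := 1 + u y ^ 2 * normSqD g f y with hD
  set N := gradVec g f y with hN
  set Y : Fin n → Fin n → ℝ := fun i j => (u y * hess g f y i j +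
    partialDeriv u y i * partialDeriv f y j + partialDeriv f y i * partialDeriv u y j) /
      Real.sqrt D - K y i j with hY
  have hYf : ∀ v w, jangForm g K u f y N v w D = bilin Y v w := by
    intro v w
    unfold jangForm
    rw [hessForm_eq_sum, fderiv_eq_sum v u, fderiv_eq_sum w u, fderiv_eq_sum v f,
      fderiv_eq_sum w f, Finset.sum_mul_sum, Finset.sum_mul_sum]
    simp only [bilin, hY, hess_eq hg hs hf, ← hN, add_div, Finset.sum_div, Finset.mul_sum,
      ← Finset.sum_add_distrib, ← Finset.sum_sub_distrib]
    exact Finset.sum_congr rfl fun i _ => Finset.sum_congr rfl fun j _ => by ring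
  simp only [hYf]
  rw [← sum_mul_frame, jang]
  have h1 : ∀ i j, invMetric g y i j = ∑ k, b k i * b k j := inv_eq_sum_frame _ hb
  simp only [h1]
  have h2 : u y ^ 2 * bilin Y N N / D = ∑ i, ∑ j,
      u y ^ 2 * grad g f y i * grad g f y j / D * Y i j := by
    simp only [bilin, Finset.mul_sum, Finset.sum_div]
    exact Finset.sum_congr rfl fun i _ => Finset.sum_congr rfl fun j _ => by
      simp [hN, gradVec]; ring
  rw [h2, ← Finset.sum_sub_distrib]
  refine Finset.sum_congr rfl fun i _ => ?_
  rw [← Finset.sum_sub_distrib]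
  refine Finset.sum_congr rfl fun j _ => ?_
  rw [← hD]
  ring

end LocalCoords

/-! ### Coordinate invariance of the Jang operator -/

lemma HasDerivAt.bilin {n : ℕ} {G : ℝ → Fin n → Fin n → ℝ} {G' : Fin n → Fin n → ℝ}
    {A B : ℝ → Eucl n} {A' B' : Eucl n} {t : ℝ} (hG : HasDerivAt G G' t) (hA : HasDerivAt A A' t)
    (hB : HasDerivAt B B' t) :
    HasDerivAt (fun s => bilin (G s) (A s) (B s))
      (_root_.bilin G' (A t) (B t) + _root_.bilin (G t) A' (B t) +
        _root_.bilin (G t) (A t) B') t := by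
  have hGe : ∀ i j, HasDerivAt (fun s => G s i j) (G' i j) t := fun i j =>
    (hasDerivAt_pi.1 (hasDerivAt_pi.1 hG i)) j
  have hc : ∀ {A : ℝ → Eucl n} {A' : Eucl n}, HasDerivAt A A' t →
      ∀ i, HasDerivAt (fun s => A s i) (A' i) t := by
    intro A A' h i
    exact ((EuclideanSpace.proj (𝕜 := ℝ) i).hasFDerivAt.comp_hasDerivAt t h)
  have := HasDerivAt.fun_sum (u := Finset.univ) fun i (_ : i ∈ Finset.univ) =>
    HasDerivAt.fun_sum (u := Finset.univ) fun j (_ : j ∈ Finset.univ) =>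
      ((hGe i j).fun_mul (hc hA i)).fun_mul (hc hB j)
  convert! this using 1
  simp only [_root_.bilin, ← Finset.sum_add_distrib]
  exact Finset.sum_congr rfl fun i _ => Finset.sum_congr rfl fun j _ => by ring

lemma hasDerivAt_line {E F : Type*} [NormedAddCommGroup E] [NormedSpace ℝ E]
    [NormedAddCommGroup F] [NormedSpace ℝ F] {h : E → F} {y : E} (hh : DifferentiableAt ℝ h y)
    (v : E) : HasDerivAt (fun t : ℝ => h (y + t • v)) (fderiv ℝ h y v) 0 := by
  have h1 : HasDerivAt (fun t : ℝ => y + t • v) v 0 := by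
    simpa using ((hasDerivAt_id (0 : ℝ)).smul_const v).const_add y
  have h2 : HasFDerivAt h (fderiv ℝ h y) (y + (0 : ℝ) • v) := by simpa using hh.hasFDerivAt
  exact h2.comp_hasDerivAt 0 h1

namespace LocalCoords

variable {n : ℕ}

/-- The pull-back of a `2`-tensor in coordinates by a map `σ`. -/
noncomputable def pullback (σ : Eucl n → Eucl n) (g : Eucl n → Fin n → Fin n → ℝ) (y : Eucl n) :
    Fin n → Fin n → ℝ :=
  fun i j => bilin (g (σ y)) (fderiv ℝ σ y (coordVec i)) (fderiv ℝ σ y (coordVec j))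

variable {g K : Eucl n → Fin n → Fin n → ℝ} {u f : Eucl n → ℝ} {σ : Eucl n → Eucl n} {y : Eucl n}

lemma bilin_pullback (v w : Eucl n) :
    bilin (pullback σ g y) v w = bilin (g (σ y)) (fderiv ℝ σ y v) (fderiv ℝ σ y w) := by
  conv_rhs => rw [← sum_coordVec v, ← sum_coordVec w]
  simp only [map_sum, map_smul, bilin_sum_left, bilin_sum_right, bilin_smul_left,
    bilin_smul_right]
  simp only [bilin, pullback, Finset.mul_sum]
  rw [Finset.sum_comm]
  exact Finset.sum_congr rfl fun i _ => Finset.sum_congr rfl fun j _ => by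
    simp only [Finset.sum_mul]
    exact Finset.sum_congr rfl fun i _ => Finset.sum_congr rfl fun j _ => by ring

lemma differentiableAt_pullback (hσ : ContDiffAt ℝ 2 σ y) (hg : DifferentiableAt ℝ g (σ y)) :
    DifferentiableAt ℝ (pullback σ g) y := by
  have h1 : DifferentiableAt ℝ (fderiv ℝ σ) y :=
    (hσ.fderiv_right (m := 1) (by norm_num)).differentiableAt (by norm_num)
  have h2 : DifferentiableAt ℝ (fun z => g (σ z)) y :=
    hg.comp y (hσ.differentiableAt (by norm_num))
  rw [differentiableAt_pi]
  intro i
  rw [differentiableAt_pi]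
  intro j
  unfold pullback bilin
  have h3 : ∀ a b, DifferentiableAt ℝ (fun z => g (σ z) a b) y := fun a b =>
    differentiableAt_pi.1 (differentiableAt_pi.1 h2 a) b
  have h4 : ∀ a (k : Fin n), DifferentiableAt ℝ (fun z => fderiv ℝ σ z (coordVec k) a) y := by
    intro a k
    exact ((EuclideanSpace.proj (𝕜 := ℝ) a).differentiableAt).comp y
      (h1.clm_apply (differentiableAt_const _))
  refine DifferentiableAt.fun_sum fun a _ => DifferentiableAt.fun_sum fun b _ => ?_
  exact ((h3 a b).mul (h4 a i)).mul (h4 b j)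

/-- The derivative of the pulled-back form along a line is computed twice, from its components and
by the product rule for `g ∘ σ` and the two image vectors. -/
lemma bilin_fderiv_pullback (hσ : ContDiffAt ℝ 2 σ y) (hg : DifferentiableAt ℝ g (σ y))
    (v a b : Eucl n) :
    bilin (fderiv ℝ (pullback σ g) y v) a b =
      bilin (fderiv ℝ g (σ y) (fderiv ℝ σ y v)) (fderiv ℝ σ y a) (fderiv ℝ σ y b) +
      bilin (g (σ y)) (fderiv ℝ (fderiv ℝ σ) y v a) (fderiv ℝ σ y b) +
      bilin (g (σ y)) (fderiv ℝ σ y a) (fderiv ℝ (fderiv ℝ σ) y v b) := by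
  have h1 : DifferentiableAt ℝ (fderiv ℝ σ) y :=
    (hσ.fderiv_right (m := 1) (by norm_num)).differentiableAt (by norm_num)
  have hσ1 := hσ.differentiableAt (by norm_num : (2 : WithTop ℕ∞) ≠ 0)
  have h2 : DifferentiableAt ℝ (fun z => g (σ z)) y := hg.comp y hσ1
  have e1 := hasDerivAt_line (differentiableAt_pullback hσ hg) v
  have e2 := e1.bilin (hasDerivAt_const 0 a) (hasDerivAt_const 0 b)
  have hc : ∀ c, fderiv ℝ (fun z => fderiv ℝ σ z c) y v = fderiv ℝ (fderiv ℝ σ) y v c := by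
    intro c
    rw [fderiv_clm_apply h1 (by fun_prop)]
    simp
  have e3 := (hasDerivAt_line h2 v).bilin
    (hasDerivAt_line (h1.clm_apply (differentiableAt_const a)) v)
    (hasDerivAt_line (h1.clm_apply (differentiableAt_const b)) v)
  simp only [bilin_pullback] at e2
  have := e2.unique e3
  rw [hc, hc] at this
  have h5 : fderiv ℝ (fun z => g (σ z)) y v = fderiv ℝ g (σ y) (fderiv ℝ σ y v) := by
    have : fderiv ℝ (g ∘ σ) y = _ := fderiv_comp y hg hσ1
    rw [show (fun z => g (σ z)) = g ∘ σ from rfl, this]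
    rfl
  rw [h5] at this
  simpa [_root_.bilin] using this

lemma fderiv_fderiv_comp (hσ : ContDiffAt ℝ 2 σ y) (hf : ContDiffAt ℝ 2 f (σ y)) (v w : Eucl n) :
    fderiv ℝ (fderiv ℝ (f ∘ σ)) y v w =
      fderiv ℝ (fderiv ℝ f) (σ y) (fderiv ℝ σ y v) (fderiv ℝ σ y w) +
      fderiv ℝ f (σ y) (fderiv ℝ (fderiv ℝ σ) y v w) := by
  have h1 : DifferentiableAt ℝ (fderiv ℝ σ) y :=
    (hσ.fderiv_right (m := 1) (by norm_num)).differentiableAt (by norm_num)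
  have hσ1 := hσ.differentiableAt (by norm_num : (2 : WithTop ℕ∞) ≠ 0)
  have h2 : DifferentiableAt ℝ (fderiv ℝ f) (σ y) :=
    (hf.fderiv_right (m := 1) (by norm_num)).differentiableAt (by norm_num)
  have h3 : fderiv ℝ (f ∘ σ) =ᶠ[𝓝 y] fun z => (fderiv ℝ f (σ z)).comp (fderiv ℝ σ z) := by
    have e1 := hσ.eventually (by simp)
    have e2 := hσ.continuousAt.eventually (hf.eventually (by simp))
    filter_upwards [e1, e2] with z hz hz'
    exact fderiv_comp z (hz'.differentiableAt (by norm_num)) (hz.differentiableAt (by norm_num))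
  rw [h3.fderiv_eq]
  have h4 : HasFDerivAt (fun z => fderiv ℝ f (σ z))
      ((fderiv ℝ (fderiv ℝ f) (σ y)).comp (fderiv ℝ σ y)) y :=
    h2.hasFDerivAt.comp y hσ1.hasFDerivAt
  rw [(h4.clm_comp h1.hasFDerivAt).fderiv]
  simp [add_comm]

/-- The second derivatives of `σ` cancel: differentiating `f ∘ σ` twice produces `g(N, D²σ(v, w))`,
and so does the Christoffel combination of the pulled-back metric, whose other four terms cancel in
pairs by the symmetry of `D²σ` and `g`. -/
lemma hessForm_pullback (hσ : ContDiffAt ℝ 2 σ y) (hg : DifferentiableAt ℝ g (σ y))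
    (hs : ∀ i j, g (σ y) i j = g (σ y) j i) (hf : ContDiffAt ℝ 2 f (σ y)) (N v w : Eucl n)
    (hN : ∀ v, bilin (g (σ y)) (fderiv ℝ σ y N) v = fderiv ℝ f (σ y) v) :
    hessForm (pullback σ g) (f ∘ σ) y N v w =
      hessForm g f (σ y) (fderiv ℝ σ y N) (fderiv ℝ σ y v) (fderiv ℝ σ y w) := by
  unfold hessForm
  rw [fderiv_fderiv_comp hσ hf, bilin_fderiv_pullback hσ hg, bilin_fderiv_pullback hσ hg,
    bilin_fderiv_pullback hσ hg, ← hN]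
  have hsym : ∀ a b, fderiv ℝ (fderiv ℝ σ) y a b = fderiv ℝ (fderiv ℝ σ) y b a :=
    hσ.isSymmSndFDerivAt (by simp)
  rw [hsym N v, hsym N w, hsym w v, bilin_symm _ hs (fderiv ℝ σ y N),
    bilin_symm _ hs (fderiv ℝ (fderiv ℝ σ) y v N)]
  ring

/-- The difference of the two vectors is `g`-orthogonal to the image of the differential. An
injective endomorphism is surjective, so the difference is orthogonal to itself and vanishes. -/
lemma gradVec_pullback (hσ : DifferentiableAt ℝ σ y) (hinj : Function.Injective (fderiv ℝ σ y))
    (hs : ∀ i j, g (σ y) i j = g (σ y) j i)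
    (hpos : ∀ v : Eucl n, v ≠ 0 → 0 < bilin (g (σ y)) v v) (hf : DifferentiableAt ℝ f (σ y)) :
    fderiv ℝ σ y (gradVec (pullback σ g) (f ∘ σ) y) = gradVec g f (σ y) := by
  have hdet := isUnit_det_of_pos _ hs hpos
  have hs' : ∀ i j, pullback σ g y i j = pullback σ g y j i := fun i j => bilin_symm _ hs _ _
  have hpos' : ∀ v : Eucl n, v ≠ 0 → 0 < bilin (pullback σ g y) v v := by
    intro v hv
    rw [bilin_pullback]
    exact hpos _ fun h => hv (hinj (by simpa using h))
  have hdet' := isUnit_det_of_pos _ hs' hpos'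
  have hsurj : Function.Surjective (fderiv ℝ σ y) :=
    (LinearMap.injective_iff_surjective (f := (fderiv ℝ σ y : Eucl n →ₗ[ℝ] Eucl n))).1 hinj
  by_contra hne
  have h0 := hpos _ (sub_ne_zero.2 hne)
  obtain ⟨v, hv⟩ := hsurj (fderiv ℝ σ y (gradVec (pullback σ g) (f ∘ σ) y) - gradVec g f (σ y))
  have h1 := bilin_grad_left (f := f ∘ σ) hs' hdet' v
  have h2 := bilin_grad_left (f := f) hs hdet (fderiv ℝ σ y v)
  rw [bilin_pullback, fderiv_comp y hf hσ] at h1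
  rw [hv] at h1 h2
  rw [sub_eq_add_neg, bilin_add_left, ← sub_eq_add_neg, ← neg_one_smul ℝ (gradVec g f (σ y)),
    bilin_smul_left, h1, h2] at h0
  simp [hv] at h0

lemma normSqD_pullback (hσ : DifferentiableAt ℝ σ y) (hinj : Function.Injective (fderiv ℝ σ y))
    (hs : ∀ i j, g (σ y) i j = g (σ y) j i)
    (hpos : ∀ v : Eucl n, v ≠ 0 → 0 < bilin (g (σ y)) v v) (hf : DifferentiableAt ℝ f (σ y)) :
    normSqD (pullback σ g) (f ∘ σ) y = normSqD g f (σ y) := by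
  rw [normSqD_eq, normSqD_eq, fderiv_comp y hf hσ, ContinuousLinearMap.comp_apply,
    gradVec_pullback hσ hinj hs hpos hf]

/-- The Jang operator does not depend on the coordinates. -/
theorem jang_pullback (hσ : ContDiffAt ℝ 2 σ y) (hinj : Function.Injective (fderiv ℝ σ y))
    (hg : DifferentiableAt ℝ g (σ y)) (hs : ∀ i j, g (σ y) i j = g (σ y) j i)
    (hpos : ∀ v : Eucl n, v ≠ 0 → 0 < bilin (g (σ y)) v v) (hf : ContDiffAt ℝ 2 f (σ y))
    (hu : DifferentiableAt ℝ u (σ y)) :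
    jang (pullback σ g) (pullback σ K) (u ∘ σ) (f ∘ σ) y = jang g K u f (σ y) := by
  have hσ1 := hσ.differentiableAt (by norm_num : (2 : WithTop ℕ∞) ≠ 0)
  have hf1 := hf.differentiableAt (by norm_num : (2 : WithTop ℕ∞) ≠ 0)
  have hs' : ∀ i j, pullback σ g y i j = pullback σ g y j i := fun i j => bilin_symm _ hs _ _
  have hpos' : ∀ v : Eucl n, v ≠ 0 → 0 < bilin (pullback σ g y) v v := by
    intro v hv
    rw [bilin_pullback]
    exact hpos _ fun h => hv (hinj (by simpa using h))
  obtain ⟨b, hb⟩ := exists_bilin_orthonormal _ hs' hpos'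
  have hb2 : ∀ i j, bilin (g (σ y)) (fderiv ℝ σ y (b i)) (fderiv ℝ σ y (b j))
      = if i = j then 1 else 0 := fun i j => by rw [← bilin_pullback, hb]
  have hd : ∀ {f : Eucl n → ℝ} {y}, ContDiffAt ℝ 2 f y → DifferentiableAt ℝ (fderiv ℝ f) y :=
    fun h => (h.fderiv_right (m := 1) (by norm_num)).differentiableAt (by norm_num)
  have hN := gradVec_pullback hσ1 hinj hs hpos hf1
  rw [jang_eq_frame (differentiableAt_pullback hσ hg) hs' (hd (hf.comp y hσ)) hb,
    jang_eq_frame hg hs (hd hf) hb2, normSqD_pullback hσ1 hinj hs hpos hf1]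
  have hY : ∀ v w D, jangForm (pullback σ g) (pullback σ K) (u ∘ σ) (f ∘ σ) y
      (gradVec (pullback σ g) (f ∘ σ) y) v w D =
      jangForm g K u f (σ y) (gradVec g f (σ y)) (fderiv ℝ σ y v) (fderiv ℝ σ y w) D := by
    intro v w D
    unfold jangForm
    rw [hessForm_pullback hσ hg hs hf _ _ _ (fun v => by
      rw [hN, bilin_grad_left hs (isUnit_det_of_pos _ hs hpos)]), hN, bilin_pullback,
      fderiv_comp y hu hσ1, fderiv_comp y hf1 hσ1]
    rfl
  simp only [hY, hN, Function.comp_apply]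

lemma partialDeriv_congr {f f' : Eucl n → ℝ} (h : f =ᶠ[𝓝 y] f') (i : Fin n) :
    partialDeriv f y i = partialDeriv f' y i := by
  unfold partialDeriv
  rw [h.fderiv_eq]

lemma normSqD_congr {f f' : Eucl n → ℝ} {g g' : Eucl n → Fin n → Fin n → ℝ} (hg : g y = g' y)
    (h : f =ᶠ[𝓝 y] f') : normSqD g f y = normSqD g' f' y := by
  simp only [normSqD, grad, invMetric, hg, partialDeriv_congr h]

lemma jang_congr {u u' f f' : Eucl n → ℝ} {g g' K K' : Eucl n → Fin n → Fin n → ℝ}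
    (hg : g =ᶠ[𝓝 y] g') (hK : K y = K' y) (hu : u =ᶠ[𝓝 y] u') (hf : f =ᶠ[𝓝 y] f') :
    jang g K u f y = jang g' K' u' f' y := by
  have h1 : ∀ j, (fun z => partialDeriv f z j) =ᶠ[𝓝 y] fun z => partialDeriv f' z j := by
    intro j
    filter_upwards [hf.eventuallyEq_nhds] with z hz using partialDeriv_congr hz j
  have h2 : ∀ i j, (fun z => g z i j) =ᶠ[𝓝 y] fun z => g' z i j := by
    intro i j
    filter_upwards [hg] with z hz
    rw [hz]
  simp only [jang, normSqD_congr hg.self_of_nhds hf, grad, invMetric, hg.self_of_nhds,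
    hu.self_of_nhds, partialDeriv_congr hf, partialDeriv_congr hu, hK, hess, christoffel,
    partialDeriv_congr (h1 _), partialDeriv_congr (h2 _ _)]

lemma partialDeriv_const_mul (s : ℝ) (f : Eucl n → ℝ) (y : Eucl n) (i : Fin n) :
    partialDeriv (fun z => s * f z) y i = s * partialDeriv f y i := by
  unfold partialDeriv
  rw [show (fun z => s * f z) = s • f from rfl, fderiv_const_smul_field]
  rfl

/-- The Jang operator is invariant under rescaling of the vertical direction. -/
lemma jang_scale {s : ℝ} (hs : s ≠ 0) :
    jang g K (fun z => s * u z) (fun z => s⁻¹ * f z) y = jang g K u f y := by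
  have h1 : ∀ i, grad g (fun z => s⁻¹ * f z) y i = s⁻¹ * grad g f y i := by
    intro i
    simp only [grad, partialDeriv_const_mul, Finset.mul_sum]
    exact Finset.sum_congr rfl fun j _ => by ring
  have h2 : normSqD g (fun z => s⁻¹ * f z) y = s⁻¹ ^ 2 * normSqD g f y := by
    simp only [normSqD, h1, partialDeriv_const_mul, Finset.mul_sum]
    exact Finset.sum_congr rfl fun j _ => by ring
  have h3 : ∀ i j, hess g (fun z => s⁻¹ * f z) y i j = s⁻¹ * hess g f y i j := by
    intro i j
    simp only [hess, partialDeriv_const_mul, mul_sub, Finset.mul_sum]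
    congr 1
    exact Finset.sum_congr rfl fun j _ => by ring
  have h4 : (s * u y) ^ 2 * (s⁻¹ ^ 2 * normSqD g f y) = u y ^ 2 * normSqD g f y := by
    field_simp
  simp only [jang, h1, h2, h3, partialDeriv_const_mul, h4]
  refine Finset.sum_congr rfl fun i _ => Finset.sum_congr rfl fun j _ => ?_
  congr 2
  · field_simp
  · field_simp

end LocalCoords

/-! ### The pointwise inequality at a maximum point: algebra -/

/-- The inequality which results from the differentiated equation and the second derivative test.
The letters `X_yz` stand for the contraction of a tensor `X` with vectors `y`, `z`. -/
lemma jang_maximum_inequality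
    {v a b k κ e ε trF trK trT trFF R K' a'' Y ψ'' Tpp Fpp dd dp dα αα αp Kdp Kαp Kpp a''pp
      trX Xpp H : ℝ}
    (hv : 0 < v) (hκ : 0 < κ)
    (hFpp : Fpp = -(v ^ 2 * κ * dp) - αp / 2)
    (hH : H = e + (trK - Kpp / v ^ 2))
    (hE0 : v ^ 2 * (trF - v * trK) - (Fpp - v * Kpp) = v ^ 2 * v * e + αp)
    (hX : trX - Xpp / v ^ 2 = (trT - Tpp / v ^ 2) - R -
      (-(v * κ * dp)) * (trK - Kpp / v ^ 2) - v * K')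
    (hE1 : -(2 * v ^ 2 * κ * dp) * (trF - v * trK) -
      2 * ((v ^ 4 * κ ^ 2 * dd + v ^ 2 * κ * dα + αα / 4) - v * (-(v ^ 2 * κ * Kdp) - Kαp / 2)) +
      (v ^ 2 * trX - Xpp) = -(3 * v ^ 3 * κ * dp) * e + v ^ 2 * v * ε * (v ^ 2 - a) +
        (a''pp + (-(v ^ 2 * κ * dα) - αα / 2)))
    (hS : 0 ≤ trFF - 2 * (v ^ 4 * κ ^ 2 * dd + v ^ 2 * κ * dα + αα / 4) / v ^ 2 +
      Fpp ^ 2 / v ^ 4)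
    (hmax : (a'' + Y) + 2 * (trFF - (v ^ 4 * κ ^ 2 * dd + v ^ 2 * κ * dα + αα / 4) / v ^ 2) +
        2 * (trT - Tpp / v ^ 2) ≤
      v ^ 2 * ((6 * κ ^ 2 - 2 * κ * k) * (dd - dp ^ 2 / v ^ 2) -
        2 * κ * (ψ'' + b * (trF - Fpp / v ^ 2)))) :
    k * (dd - dp ^ 2 / v ^ 2) + ψ'' + b * v * H + b * αp / v ^ 2 - dp * H / v +
      2 * (Kdp - dp * Kpp / v ^ 2) / v + 2 * (dα - dp * αp / v ^ 2) / v ^ 2 +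
      2 * dp * αp / v ^ 4 + (2 * R + 2 * v * K' + 2 * a''pp / v ^ 2 + 2 * Kαp / v + a'' + Y +
        2 * ε * v * (v ^ 2 - a) + (αα - αp ^ 2 / v ^ 2) / (2 * v ^ 2)) / (2 * v ^ 2 * κ) ≤ 0 := by
  have hv0 := hv.ne'
  have hκ0 := hκ.ne'
  -- The equation itself, solved for the full trace of the Hessian.
  have h1 : trF = Fpp / v ^ 2 + v * H + αp / v ^ 2 := by
    rw [hH]
    field_simp
    linear_combination hE0
  have h2 : trX - Xpp / v ^ 2 = (-(3 * v ^ 3 * κ * dp) * e + v ^ 2 * v * ε * (v ^ 2 - a) +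
        (a''pp + (-(v ^ 2 * κ * dα) - αα / 2)) + (2 * v ^ 2 * κ * dp) * (trF - v * trK) +
      2 * ((v ^ 4 * κ ^ 2 * dd + v ^ 2 * κ * dα + αα / 4) -
        v * (-(v ^ 2 * κ * Kdp) - Kαp / 2))) / v ^ 2 := by
    rw [eq_div_iff (by positivity)]
    have : (trX - Xpp / v ^ 2) * v ^ 2 = v ^ 2 * trX - Xpp := by field_simp
    rw [this]
    linear_combination hE1
  -- The differentiated equation expresses the trace of the third derivatives by lower-order
  -- quantities.
  have h3 : trT - Tpp / v ^ 2 = (-(3 * v ^ 3 * κ * dp) * e + v ^ 2 * v * ε * (v ^ 2 - a) +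
        (a''pp + (-(v ^ 2 * κ * dα) - αα / 2)) + (2 * v ^ 2 * κ * dp) * (trF - v * trK) +
      2 * ((v ^ 4 * κ ^ 2 * dd + v ^ 2 * κ * dα + αα / 4) -
        v * (-(v ^ 2 * κ * Kdp) - Kαp / 2))) / v ^ 2 + R +
      (-(v * κ * dp)) * (trK - Kpp / v ^ 2) + v * K' := by
    rw [← h2]
    linear_combination -hX
  rw [h3, h1] at hmax
  set Z := k * (dd - dp ^ 2 / v ^ 2) + ψ'' + b * v * H + b * αp / v ^ 2 - dp * H / v +
      2 * (Kdp - dp * Kpp / v ^ 2) / v + 2 * (dα - dp * αp / v ^ 2) / v ^ 2 +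
      2 * dp * αp / v ^ 4 + (2 * R + 2 * v * K' + 2 * a''pp / v ^ 2 + 2 * Kαp / v + a'' + Y +
        2 * ε * v * (v ^ 2 - a) + (αα - αp ^ 2 / v ^ 2) / (2 * v ^ 2)) / (2 * v ^ 2 * κ) with hZ
  have hpos : 0 < 2 * v ^ 2 * κ := by positivity
  -- This is the traced maximum inequality minus twice `hS`. The two sides contribute the same term
  -- `6 κ² v² (dd - dp² / v²)`, so nothing quadratic in `κ` survives and the division by `2 v² κ` is
  -- harmless.
  have key : Z * (2 * v ^ 2 * κ) ≤ 0 := by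
    have h5 : Z * (2 * v ^ 2 * κ) = (a'' + Y) +
        2 * (trFF - (v ^ 4 * κ ^ 2 * dd + v ^ 2 * κ * dα + αα / 4) / v ^ 2) +
        2 * ((-(3 * v ^ 3 * κ * dp) * e + v ^ 2 * v * ε * (v ^ 2 - a) +
        (a''pp + (-(v ^ 2 * κ * dα) - αα / 2)) + (2 * v ^ 2 * κ * dp) *
          ((Fpp / v ^ 2 + v * H + αp / v ^ 2) - v * trK) +
      2 * ((v ^ 4 * κ ^ 2 * dd + v ^ 2 * κ * dα + αα / 4) -
        v * (-(v ^ 2 * κ * Kdp) - Kαp / 2))) / v ^ 2 + R +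
      (-(v * κ * dp)) * (trK - Kpp / v ^ 2) + v * K') -
      v ^ 2 * ((6 * κ ^ 2 - 2 * κ * k) * (dd - dp ^ 2 / v ^ 2) -
        2 * κ * (ψ'' + b * ((Fpp / v ^ 2 + v * H + αp / v ^ 2) - Fpp / v ^ 2))) -
      2 * (trFF - 2 * (v ^ 4 * κ ^ 2 * dd + v ^ 2 * κ * dα + αα / 4) / v ^ 2 +
      Fpp ^ 2 / v ^ 4) := by
      rw [hZ, hFpp, hH]
      field_simp
      ring
    rw [h5]
    linarith
  by_contra hcon
  push Not at hcon
  exact absurd key (not_le.2 (mul_pos hcon hpos))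

set_option maxHeartbeats 2000000 in
/-- The inequality at the maximum point bounds the gradient. -/
lemma jang_gradient_bound_of_inequality {M lam b : ℝ} (hM : 1 ≤ M) (hlam : 0 < lam) (hb : 0 < b) :
    ∃ k : ℝ, 1 ≤ k ∧ ∀ v a κ ε H e ψψ ψp ψα αα αp trK Kψp Kαp Kpp a''pp R K' a'' Y ψ'' pp : ℝ,
      0 < v → v ^ 2 = a + pp → 0 ≤ pp → k ≤ κ → 0 ≤ ε → lam ≤ a → a ≤ M →
      |ψp| ≤ M * v → |αp| ≤ M * v → |ψα| ≤ M → |Kpp| ≤ M * v ^ 2 → |Kψp| ≤ M * v →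
      |Kαp| ≤ M * v → |e| ≤ M → |trK| ≤ M → |ψ''| ≤ M → |R| ≤ M * v ^ 2 → |K'| ≤ M * v →
      |a''pp| ≤ M * v ^ 2 → |a''| ≤ M → |Y| ≤ M * v ^ 2 → 0 ≤ ψψ → 0 ≤ αα → ψp ^ 2 ≤ pp * ψψ →
      αp ^ 2 ≤ pp * αα → H = e + (trK - Kpp / v ^ 2) →
      k * ((ψψ + 2 * b * ψp + b ^ 2 * pp) - (ψp + b * pp) ^ 2 / v ^ 2) + ψ'' + b * v * H +
        b * αp / v ^ 2 - (ψp + b * pp) * H / v +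
        2 * ((Kψp + b * Kpp) - (ψp + b * pp) * Kpp / v ^ 2) / v +
        2 * ((ψα + b * αp) - (ψp + b * pp) * αp / v ^ 2) / v ^ 2 +
        2 * (ψp + b * pp) * αp / v ^ 4 +
        (2 * R + 2 * v * K' + 2 * a''pp / v ^ 2 + 2 * Kαp / v + a'' + Y +
        2 * ε * v * (v ^ 2 - a) + (αα - αp ^ 2 / v ^ 2) / (2 * v ^ 2)) / (2 * v ^ 2 * κ) ≤ 0 →
      v ≤ 2 * M * (b + 2) / b := by
  -- The sum of the error bounds `t1` to `t7` below.
  set C := M + 3 * M * (b * M + M) + b * M + 2 * (M + M * M + b * M * M) +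
    2 * (M + M * M + b * M * M) + 2 * (M * M + b * M) + 5 * M with hC
  have hM0 : 0 < M := by linarith
  have hCpos : 0 < C := by positivity
  -- With this choice `k * (b ^ 2 * lam / 2)` exceeds `C`, which is `t9`.
  refine ⟨1 + 2 * C / (b ^ 2 * lam), by
    have : 0 < 2 * C / (b ^ 2 * lam) := by positivity
    linarith, ?_⟩
  intro v a κ ε H e ψψ ψp ψα αα αp trK Kψp Kαp Kpp a''pp R K' a'' Y ψ'' pp hv hw hpp hκ hε ha haM
    hψp hαp hψα hKpp hKψp hKαp he htrK hψ hR hK' happ haa hY hψψ hαα hCS1 hCS2 hH hineq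
  set k := 1 + 2 * C / (b ^ 2 * lam) with hk
  have hk1 : 1 ≤ k := by
    have : 0 < 2 * C / (b ^ 2 * lam) := by positivity
    linarith
  by_contra hvb
  push Not at hvb
  have hvb' : 2 * M * (b + 2) < b * v := by rwa [div_lt_iff₀ hb, mul_comm v b] at hvb
  have hv1 : 1 ≤ v := by
    by_contra h
    push Not at h
    have h1 : b * v ≤ b * 1 := mul_le_mul_of_nonneg_left h.le hb.le
    have h2 : b ≤ M * b := le_mul_of_one_le_left hb.le hM
    linarith only [h1, h2, hvb', hM0, hb]
  obtain ⟨s, hs⟩ : ∃ s, s = 1 / v := ⟨_, rfl⟩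
  have hs0 : 0 < s := by rw [hs]; positivity
  have hs1 : s ≤ 1 := by rw [hs, div_le_one hv]; exact hv1
  have hvs : v * s = 1 := by rw [hs]; field_simp
  have hsb : 2 * M * (b + 2) * s < b := by
    calc 2 * M * (b + 2) * s < b * v * s := by gcongr
      _ = b := by rw [mul_assoc, hvs, mul_one]
  -- rescaled quantities
  have resc : ∀ {x : ℝ}, |x| ≤ M * v → |x * s| ≤ M := by
    intro x hx
    rw [abs_mul, abs_of_pos hs0]
    calc |x| * s ≤ M * v * s := by gcongr
      _ = M := by rw [mul_assoc, hvs, mul_one]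
  have resc2 : ∀ {x : ℝ}, |x| ≤ M * v ^ 2 → |x * s ^ 2| ≤ M := by
    intro x hx
    rw [abs_mul, abs_of_pos (by positivity : (0 : ℝ) < s ^ 2)]
    calc |x| * s ^ 2 ≤ M * v ^ 2 * s ^ 2 := by gcongr
      _ = M * (v * s) ^ 2 := by ring
      _ = M := by rw [hvs]; ring
  have hv0 := hv.ne'
  have b1 := resc hψp
  have b2 := resc hαp
  have b3 := resc2 hKpp
  have b4 := resc hKψp
  have b5 := resc hKαp
  have b6 := resc2 hR
  have b7 := resc hK'
  have b8 := resc2 happ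
  have b9 := resc2 hY
  have ha0 : 0 < a := by linarith
  have hpps : pp * s ^ 2 ≤ 1 := by
    have : (v * s) ^ 2 = 1 := by rw [hvs]; ring
    have h1 := mul_nonneg ha0.le (sq_nonneg s)
    have h2 : (v * s) ^ 2 = a * s ^ 2 + pp * s ^ 2 := by rw [mul_pow, hw]; ring
    linarith only [h1, h2, this]
  have hpps0 : 0 ≤ pp * s ^ 2 := by positivity
  have hHb : |H| ≤ 3 * M := by
    have : H = e + trK - Kpp * s ^ 2 := by rw [hH, hs]; ring
    rw [this]
    calc |e + trK - Kpp * s ^ 2| ≤ |e| + |trK| + |Kpp * s ^ 2| :=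
          (abs_sub _ _).trans (by gcongr; exact abs_add_le _ _)
      _ ≤ 3 * M := by linarith
  have has : |a| ≤ M := by rw [abs_of_pos ha0]; exact haM
  have habs_s : |s| ≤ 1 := by rw [abs_of_pos hs0]; exact hs1
  have habs_b : |b| ≤ b := (abs_of_pos hb).le
  have hprod : ∀ {x y X Y : ℝ}, |x| ≤ X → |y| ≤ Y → |x * y| ≤ X * Y := fun hx hy => by
    rw [abs_mul]
    exact mul_le_mul hx hy (abs_nonneg _) ((abs_nonneg _).trans hx)
  -- first-order terms
  have t1 : -M ≤ ψ'' := (abs_le.1 hψ).1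
  -- Each of `b v H` and `b pp H / v` has size `v`, but `pp = v² - a` reduces their difference to `b
  -- a H / v`.
  have t2 : -(3 * M * (b * M + M)) ≤ b * v * H - (ψp + b * pp) * H / v := by
    have e1 : b * v * H - (ψp + b * pp) * H / v = H * (b * a * s - ψp * s) := by
      have : pp = v ^ 2 - a := by linarith
      rw [this, hs]
      field_simp
      ring
    rw [e1]
    refine neg_le_of_abs_le (hprod hHb ?_)
    calc |b * a * s - ψp * s| ≤ |b * a * s| + |ψp * s| := abs_sub _ _
      _ ≤ b * M * 1 + M := add_le_add (hprod (hprod habs_b has) habs_s) b1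
      _ = b * M + M := by ring
  have t3 : -(b * M) ≤ b * αp / v ^ 2 := by
    have e1 : b * αp / v ^ 2 = b * (αp * s) * s := by rw [hs]; field_simp
    rw [e1]
    refine neg_le_of_abs_le ((hprod (hprod habs_b b2) habs_s).trans (by rw [mul_one]))
  have t4 : -(2 * (M + M * M + b * M * M)) ≤
      2 * ((Kψp + b * Kpp) - (ψp + b * pp) * Kpp / v ^ 2) / v := by
    have e1 : 2 * ((Kψp + b * Kpp) - (ψp + b * pp) * Kpp / v ^ 2) / v =
        2 * (Kψp * s - (ψp * s) * (Kpp * s ^ 2) + b * a * (Kpp * s ^ 2) * s) := by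
      have : pp = v ^ 2 - a := by linarith
      rw [this, hs]
      field_simp
      ring
    rw [e1]
    have := hprod b1 b3
    have h2 := hprod (hprod (hprod habs_b has) b3) habs_s
    have := abs_le.1 b4
    have := abs_le.1 (hprod b1 b3)
    have := abs_le.1 h2
    linarith
  have t5 : -(2 * (M + M * M + b * M * M)) ≤
      2 * ((ψα + b * αp) - (ψp + b * pp) * αp / v ^ 2) / v ^ 2 := by
    have e1 : 2 * ((ψα + b * αp) - (ψp + b * pp) * αp / v ^ 2) / v ^ 2 =
        2 * ((ψα - (ψp * s) * (αp * s)) * s + b * a * (αp * s) * s * s) * s := by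
      have : pp = v ^ 2 - a := by linarith
      rw [this, hs]
      field_simp
      ring
    rw [e1]
    have h1 : |ψα - (ψp * s) * (αp * s)| ≤ M + M * M :=
      (abs_sub _ _).trans (add_le_add hψα (hprod b1 b2))
    have h2 := hprod h1 habs_s
    have h3 := hprod (hprod (hprod (hprod habs_b has) b2) habs_s) habs_s
    have h4 := hprod ((abs_add_le _ _).trans (add_le_add h2 h3)) habs_s
    have := abs_le.1 h4
    linarith
  have t6 : -(2 * (M * M + b * M)) ≤ 2 * (ψp + b * pp) * αp / v ^ 4 := by
    have e1 : 2 * (ψp + b * pp) * αp / v ^ 4 =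
        2 * ((ψp * s) * (αp * s) * s + b * (pp * s ^ 2) * (αp * s)) * s := by
      rw [hs]
      field_simp
    rw [e1]
    have h1 : |pp * s ^ 2| ≤ 1 := by rw [abs_of_nonneg hpps0]; exact hpps
    have h4 := hprod ((abs_add_le _ _).trans (add_le_add (hprod (hprod b1 b2) habs_s)
      (hprod (hprod habs_b h1) b2))) habs_s
    have := abs_le.1 h4
    linarith
  have hκ0 : 0 < κ := by linarith
  -- The term with `ε` and, by Cauchy–Schwarz, the one with `αα` are nonnegative and are dropped.
  -- The rest is of order `v²`, and `κ ≥ k ≥ 1` makes the bound for the quotient independent of `κ`.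
  have t7 : -(5 * M) ≤ (2 * R + 2 * v * K' + 2 * a''pp / v ^ 2 + 2 * Kαp / v + a'' + Y +
        2 * ε * v * (v ^ 2 - a) + (αα - αp ^ 2 / v ^ 2) / (2 * v ^ 2)) / (2 * v ^ 2 * κ) := by
    have n1 : 0 ≤ 2 * ε * v * (v ^ 2 - a) := by
      have : v ^ 2 - a = pp := by linarith
      rw [this]; positivity
    have n2 : 0 ≤ (αα - αp ^ 2 / v ^ 2) / (2 * v ^ 2) := by
      refine div_nonneg ?_ (by positivity)
      rw [sub_nonneg, div_le_iff₀ (by positivity)]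
      have := mul_nonneg ha0.le hαα
      rw [hw]
      linarith only [this, hCS2]
    have n3 : -(10 * M * v ^ 2) ≤ 2 * R + 2 * v * K' + 2 * a''pp / v ^ 2 + 2 * Kαp / v + a'' + Y := by
      have h1 := abs_le.1 hR
      have h2 : |v * K'| ≤ M * v ^ 2 := by
        rw [abs_mul, abs_of_pos hv]
        calc v * |K'| ≤ v * (M * v) := mul_le_mul_of_nonneg_left hK' hv.le
          _ = M * v ^ 2 := by ring
      have h3 : |a''pp / v ^ 2| ≤ M := by
        rw [abs_div, abs_of_pos (by positivity : (0 : ℝ) < v ^ 2), div_le_iff₀ (by positivity)]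
        exact happ
      have h4 : |Kαp / v| ≤ M := by
        rw [abs_div, abs_of_pos hv, div_le_iff₀ hv]
        exact hKαp
      have h5 := abs_le.1 hY
      have h2 := abs_le.1 h2
      have h3 := abs_le.1 h3
      have h4 := abs_le.1 h4
      have h6 := abs_le.1 haa
      have h7 : M ≤ M * v ^ 2 := le_mul_of_one_le_right hM0.le (one_le_pow₀ hv1)
      have e3 : 2 * a''pp / v ^ 2 = 2 * (a''pp / v ^ 2) := by ring
      have e4 : 2 * Kαp / v = 2 * (Kαp / v) := by ring
      rw [e3, e4]
      linarith only [h1, h2, h3, h4, h5, h6, h7]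
    rw [le_div_iff₀ (by positivity)]
    have : 10 * M * v ^ 2 ≤ 10 * M * v ^ 2 * κ := by
      have : 0 < 10 * M * v ^ 2 := by positivity
      exact le_mul_of_one_le_right this.le (hk1.trans hκ)
    have e5 : -(5 * M) * (2 * v ^ 2 * κ) = -(10 * M * v ^ 2 * κ) := by ring
    linarith only [n1, n2, n3, this, e5]
  -- the main term
  have t8 : k * (b ^ 2 * lam / 2) ≤
      k * ((ψψ + 2 * b * ψp + b ^ 2 * pp) - (ψp + b * pp) ^ 2 / v ^ 2) := by
    refine mul_le_mul_of_nonneg_left ?_ (by linarith)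
    have e1 : (ψψ + 2 * b * ψp + b ^ 2 * pp) - (ψp + b * pp) ^ 2 / v ^ 2 =
        (ψψ - ψp ^ 2 / v ^ 2) + a * (b ^ 2 * (1 - a * s * s) + 2 * b * (ψp * s) * s) := by
      have : pp = v ^ 2 - a := by linarith
      rw [this, hs]
      field_simp
      ring
    have n1 : 0 ≤ ψψ - ψp ^ 2 / v ^ 2 := by
      rw [sub_nonneg, div_le_iff₀ (by positivity)]
      have := mul_nonneg ha0.le hψψ
      rw [hw]
      linarith only [this, hCS1]
    have n2 : b ^ 2 / 2 ≤ b ^ 2 * (1 - a * s * s) + 2 * b * (ψp * s) * s := by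
      have h1 := (abs_le.1 b1).1
      have h2 : a * s * s ≤ M * s := by
        refine mul_le_mul_of_nonneg_right ?_ hs0.le
        calc a * s ≤ M * 1 := mul_le_mul haM hs1 hs0.le hM0.le
          _ = M := mul_one M
      have h3 : -M * s ≤ (ψp * s) * s := mul_le_mul_of_nonneg_right h1 hs0.le
      have h6 : b * (a * s * s) ≤ b * (M * s) := mul_le_mul_of_nonneg_left h2 hb.le
      have h4 : b / 2 ≤ b * (1 - a * s * s) + 2 * ((ψp * s) * s) := by
        linarith only [h3, h6, hsb]
      have h7 := mul_le_mul_of_nonneg_left h4 hb.le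
      linarith only [h7]
    rw [e1]
    have h5 : lam * (b ^ 2 / 2) ≤ a * (b ^ 2 * (1 - a * s * s) + 2 * b * (ψp * s) * s) :=
      mul_le_mul ha n2 (by positivity) ha0.le
    linarith only [h5, n1]
  have t9 : C < k * (b ^ 2 * lam / 2) := by
    have : k * (b ^ 2 * lam / 2) = b ^ 2 * lam / 2 + C := by
      rw [hk]
      field_simp
    rw [this]
    have : 0 < b ^ 2 * lam / 2 := by positivity
    linarith only [this]
  linarith only [hineq, t1, t2, t3, t4, t5, t6, t7, t8, t9, hC]

/-! ### Second-order jets of functions of one variable -/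

/-- `F` has value `a`, first derivative `b` and second derivative `c` at `0`. -/
def HasJet2 (F : ℝ → ℝ) (a b c : ℝ) : Prop :=
  F 0 = a ∧ ∃ F' : ℝ → ℝ, (∀ᶠ t in 𝓝 0, HasDerivAt F (F' t) t) ∧ F' 0 = b ∧ HasDerivAt F' c 0

namespace HasJet2

variable {F G : ℝ → ℝ} {a b c a' b' c' : ℝ}

lemma hasDerivAt (h : HasJet2 F a b c) : HasDerivAt F b 0 := by
  obtain ⟨-, F', h1, h2, -⟩ := h
  exact h2 ▸ h1.self_of_nhds

lemma const (a : ℝ) : HasJet2 (fun _ => a) a 0 0 :=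
  ⟨rfl, fun _ => 0, Filter.Eventually.of_forall fun t => hasDerivAt_const t a, rfl,
    hasDerivAt_const 0 0⟩

lemma add (hF : HasJet2 F a b c) (hG : HasJet2 G a' b' c') :
    HasJet2 (fun t => F t + G t) (a + a') (b + b') (c + c') := by
  obtain ⟨h0, F', h1, h2, h3⟩ := hF
  obtain ⟨k0, G', k1, k2, k3⟩ := hG
  refine ⟨by simp only [h0, k0], fun t => F' t + G' t, ?_, by simp only [h2, k2], h3.fun_add k3⟩
  filter_upwards [h1, k1] with t ht kt using ht.fun_add kt

lemma mul (hF : HasJet2 F a b c) (hG : HasJet2 G a' b' c') :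
    HasJet2 (fun t => F t * G t) (a * a') (b * a' + a * b') (c * a' + 2 * b * b' + a * c') := by
  have hF1 := hF.hasDerivAt
  have hG1 := hG.hasDerivAt
  obtain ⟨h0, F', h1, h2, h3⟩ := hF
  obtain ⟨k0, G', k1, k2, k3⟩ := hG
  refine ⟨by simp only [h0, k0], fun t => F' t * G t + F t * G' t, ?_, by simp only [h0, k0, h2, k2], ?_⟩
  · filter_upwards [h1, k1] with t ht kt using ht.fun_mul kt
  · convert! (h3.fun_mul hG1).fun_add (hF1.fun_mul k3) using 1
    rw [h0, k0, h2, k2]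
    ring

lemma sum {ι : Type*} {s : Finset ι} {F : ι → ℝ → ℝ} {a b c : ι → ℝ}
    (h : ∀ i ∈ s, HasJet2 (F i) (a i) (b i) (c i)) :
    HasJet2 (fun t => ∑ i ∈ s, F i t) (∑ i ∈ s, a i) (∑ i ∈ s, b i) (∑ i ∈ s, c i) := by
  classical
  induction s using Finset.induction_on with
  | empty => simpa using const 0
  | insert i s hi ih =>
    simp only [Finset.sum_insert hi]
    exact (h i (by simp)).add (ih fun j hj => h j (by simp [hj]))

lemma exp (hF : HasJet2 F a b c) :
    HasJet2 (fun t => Real.exp (F t)) (Real.exp a) (Real.exp a * b)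
      (Real.exp a * (b ^ 2 + c)) := by
  have hF1 := hF.hasDerivAt
  obtain ⟨h0, F', h1, h2, h3⟩ := hF
  refine ⟨by simp only [h0], fun t => Real.exp (F t) * F' t, ?_, by simp only [h0, h2], ?_⟩
  · filter_upwards [h1] with t ht using ht.exp
  · convert! hF1.exp.fun_mul h3 using 1
    rw [h0, h2]
    ring

lemma congr (hF : HasJet2 F a b c) (h : F =ᶠ[𝓝 0] G) : HasJet2 G a b c := by
  obtain ⟨h0, F', h1, h2, h3⟩ := hF
  refine ⟨by rw [← h.self_of_nhds, h0], F', ?_, h2, h3⟩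
  filter_upwards [h1, h.eventuallyEq_nhds] with t ht hG using ht.congr_of_eventuallyEq hG.symm

lemma unique (hF : HasJet2 F a b c) (hF' : HasJet2 F a' b' c') : a = a' ∧ b = b' ∧ c = c' := by
  have hF1 := hF.hasDerivAt
  have hF1' := hF'.hasDerivAt
  obtain ⟨h0, F', h1, h2, h3⟩ := hF
  obtain ⟨k0, G', k1, k2, k3⟩ := hF'
  refine ⟨by rw [← h0, ← k0], hF1.unique hF1', ?_⟩
  have : F' =ᶠ[𝓝 0] G' := by
    filter_upwards [h1, k1] with t ht kt using ht.unique kt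
  exact (h3.congr_of_eventuallyEq this.symm).unique k3

/-- A positive second derivative would make `0` a local minimum as well; then `F` would be locally
constant and its jet would vanish. -/
lemma isLocalMax (hF : HasJet2 F a b c) (h : IsLocalMax F 0) : b = 0 ∧ c ≤ 0 := by
  have hb : b = 0 := h.hasDerivAt_eq_zero hF.hasDerivAt
  refine ⟨hb, ?_⟩
  by_contra hc
  push Not at hc
  obtain ⟨h0, F', h1, h2, h3⟩ := id hF
  have hd : deriv F =ᶠ[𝓝 0] F' := by
    filter_upwards [h1] with t ht using ht.deriv
  have hdd : deriv (deriv F) 0 = c := by rw [hd.deriv_eq, h3.deriv]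
  have hmin := isLocalMin_of_deriv_deriv_pos (f := F) (x₀ := 0) (by rw [hdd]; exact hc)
    (by rw [hd.self_of_nhds, h2, hb]) hF.hasDerivAt.continuousAt
  have hconst : F =ᶠ[𝓝 0] fun _ => F 0 := by
    filter_upwards [h, hmin] with t ht ht' using le_antisymm ht ht'
  have := (hF.congr hconst).unique (const (F 0))
  linarith [this.2.2]

end HasJet2

lemma ContDiffAt.hasJet2 {E : Type*} [NormedAddCommGroup E] [NormedSpace ℝ E] {F : E → ℝ} {y : E}
    (h : ContDiffAt ℝ 2 F y) (v : E) :
    HasJet2 (fun t => F (y + t • v)) (F y) (fderiv ℝ F y v)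
      (fderiv ℝ (fderiv ℝ F) y v v) := by
  have hl : ∀ t : ℝ, HasDerivAt (fun t : ℝ => y + t • v) v t := fun t => by
    simpa using ((hasDerivAt_id t).smul_const v).const_add y
  refine ⟨by simp, fun t => fderiv ℝ F (y + t • v) v, ?_, by simp, ?_⟩
  · have h1 : Filter.Tendsto (fun t : ℝ => y + t • v) (𝓝 0) (𝓝 y) := by
      simpa using (hl 0).continuousAt.tendsto
    filter_upwards [h1.eventually (h.eventually (by simp))] with t ht
    exact (ht.differentiableAt (by norm_num)).hasFDerivAt.comp_hasDerivAt t (hl t)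
  · have h2 : DifferentiableAt ℝ (fderiv ℝ F) y :=
      (h.fderiv_right (m := 1) (by norm_num)).differentiableAt (by norm_num)
    have h3 := hasDerivAt_line (h2.clm_apply (differentiableAt_const v)) v
    rw [fderiv_clm_apply h2 (by fun_prop)] at h3
    simpa using h3

/-! ### Traces with respect to the graph metric -/

/-- The trace of the bilinear form `B` with respect to `δ - p ⊗ p / w`. -/
noncomputable def graphTrace {n : ℕ} (p : Eucl n) (w : ℝ) (B : Eucl n → Eucl n → ℝ) : ℝ :=
  ∑ k, B (coordVec k) (coordVec k) - B p p / w

/-- Bilinearity of a function of two vectors. -/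
structure IsBilin {n : ℕ} (B : Eucl n → Eucl n → ℝ) : Prop where
  add_left : ∀ u v w, B (u + v) w = B u w + B v w
  smul_left : ∀ (c : ℝ) v w, B (c • v) w = c * B v w
  add_right : ∀ u v w, B u (v + w) = B u v + B u w
  smul_right : ∀ (c : ℝ) v w, B v (c • w) = c * B v w

section GraphTrace

variable {n : ℕ} {p : Eucl n} {w a : ℝ} {B : Eucl n → Eucl n → ℝ}

lemma isBilin_clm (L : Eucl n →L[ℝ] Eucl n →L[ℝ] ℝ) : IsBilin fun v w => L v w := by
  constructor <;> simp

lemma IsBilin.sum_left (hB : IsBilin B) (v w : Eucl n) :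
    ∑ k, v k * B (coordVec k) w = B v w := by
  let L : Eucl n →ₗ[ℝ] ℝ :=
    { toFun := fun v => B v w
      map_add' := fun u v => hB.add_left u v w
      map_smul' := fun c v => hB.smul_left c v w }
  change ∑ k, v k * L (coordVec k) = L v
  conv_rhs => rw [← sum_coordVec v]
  simp

lemma IsBilin.sum_right (hB : IsBilin B) (v w : Eucl n) :
    ∑ k, w k * B v (coordVec k) = B v w := by
  let L : Eucl n →ₗ[ℝ] ℝ :=
    { toFun := fun w => B v w
      map_add' := fun u w => hB.add_right v u w
      map_smul' := fun c w => hB.smul_right c v w }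
  change ∑ k, w k * L (coordVec k) = L w
  conv_rhs => rw [← sum_coordVec w]
  simp

lemma IsBilin.eq_bilin (hB : IsBilin B) (v w : Eucl n) :
    bilin (fun i j => B (coordVec i) (coordVec j)) v w = B v w := by
  rw [← hB.sum_left]
  simp only [← hB.sum_right (coordVec _) w, bilin, Finset.mul_sum]
  exact Finset.sum_congr rfl fun i _ => Finset.sum_congr rfl fun j _ => by ring

/-- A frame for the tensor `δ - p ⊗ p / w`. -/
noncomputable def graphFrame (p : Eucl n) (w a : ℝ) (k : Fin n) : Eucl n :=
  coordVec k + (-((w + Real.sqrt (a * w))⁻¹ * p k)) • p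

/-- The frame vectors are the columns of a square root `1 - c p pᵀ` of `δ - p ⊗ p / w`, where `c`
solves `2 c - c² |p|² = 1 / w`. Inequalities that hold in every direction can thus be traced with
the graph metric by summation. -/
lemma sum_graphFrame (ha : 0 < a) (hw : w = a + ‖p‖ ^ 2) (hB : IsBilin B) :
    ∑ k, B (graphFrame p w a k) (graphFrame p w a k) = graphTrace p w B := by
  have hw0 : 0 < w := by rw [hw]; positivity
  set c := (w + Real.sqrt (a * w))⁻¹ with hc
  have h1 : ∀ k, B (graphFrame p w a k) (graphFrame p w a k) =
      B (coordVec k) (coordVec k) - c * (p k * B (coordVec k) p) -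
        c * (p k * B p (coordVec k)) + c ^ 2 * (p k) ^ 2 * B p p := by
    intro k
    rw [graphFrame, ← hc, hB.add_left, hB.add_right, hB.add_right, hB.smul_left,
      hB.smul_left, hB.smul_right, hB.smul_right]
    ring
  have h2 : ∑ k, (p k) ^ 2 = ‖p‖ ^ 2 := by
    rw [EuclideanSpace.norm_sq_eq]
    simp
  have h3 : 2 * c - c ^ 2 * ‖p‖ ^ 2 = 1 / w := by
    have hs := Real.sq_sqrt (show 0 ≤ a * w by positivity)
    have hs0 := Real.sqrt_nonneg (a * w)
    set s := Real.sqrt (a * w)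
    have : w + s ≠ 0 := by positivity
    have hp : ‖p‖ ^ 2 = w - a := by linarith
    rw [hc, hp]
    field_simp
    linear_combination -hs
  simp only [h1, Finset.sum_add_distrib, Finset.sum_sub_distrib, ← Finset.mul_sum,
    ← Finset.sum_mul, hB.sum_left, hB.sum_right, h2]
  rw [graphTrace, div_eq_mul_one_div, ← h3]
  ring

lemma abs_graphTrace_le {C : ℝ} (hC : 0 ≤ C) (hw : 0 < w) (hp : ‖p‖ ^ 2 ≤ w)
    (hX : ∀ x y, |B x y| ≤ C * ‖x‖ * ‖y‖) :
    |graphTrace p w B| ≤ (n + 1) * C := by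
  have h1 : |∑ i, B (coordVec i) (coordVec i)| ≤ n * C := by
    calc |∑ i, B (coordVec i) (coordVec i)| ≤ ∑ i : Fin n, C := by
          refine (Finset.abs_sum_le_sum_abs _ _).trans (Finset.sum_le_sum fun i _ => ?_)
          have := hX (coordVec i) (coordVec i)
          simpa [norm_coordVec] using this
      _ = n * C := by simp
  have h2 : |B p p / w| ≤ C := by
    rw [abs_div, abs_of_pos hw, div_le_iff₀ hw]
    calc |B p p| ≤ C * ‖p‖ * ‖p‖ := hX p p
      _ = C * ‖p‖ ^ 2 := by ring
      _ ≤ C * w := by gcongr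
  calc |graphTrace p w B| ≤ |∑ i, B (coordVec i) (coordVec i)| + |B p p / w| := abs_sub _ _
    _ ≤ (n + 1) * C := by linarith

/-- The square of the norm of a symmetric form with respect to `δ - p ⊗ p / w`
is nonnegative. -/
lemma graph_normSq_nonneg (ha : 0 < a) (hw : w = a + ‖p‖ ^ 2) (hB : IsBilin B)
    (hs : ∀ v w, B v w = B w v) :
    0 ≤ ∑ i, ∑ j, B (coordVec i) (coordVec j) ^ 2 - 2 * (∑ i, B (coordVec i) p ^ 2) / w +
      B p p ^ 2 / w ^ 2 := by
  have hb : ∀ v : Eucl n, IsBilin fun x y => B v x * B v y := by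
    intro v
    constructor <;> intros <;> simp only [hB.add_right, hB.smul_right] <;> ring
  have h1 : ∀ v : Eucl n, ∑ l, B v (graphFrame p w a l) ^ 2 =
      ∑ i, B v (coordVec i) ^ 2 - B v p ^ 2 / w := by
    intro v
    simp only [sq]
    exact sum_graphFrame ha hw (hb v)
  -- The expression is the sum of the squares of all components of `B` in the graph frame; each
  -- index is traced separately.
  have h2 : ∑ k, ∑ l, B (graphFrame p w a k) (graphFrame p w a l) ^ 2 =
      ∑ i, ∑ j, B (coordVec i) (coordVec j) ^ 2 - 2 * (∑ i, B (coordVec i) p ^ 2) / w +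
      B p p ^ 2 / w ^ 2 := by
    simp only [h1, Finset.sum_sub_distrib, ← Finset.sum_div]
    rw [Finset.sum_comm]
    simp only [hs (graphFrame p w a _), h1, Finset.sum_sub_distrib, ← Finset.sum_div]
    simp only [hs p (coordVec _)]
    ring
  rw [← h2]
  positivity

/-- The vector which represents a linear form. -/
noncomputable def dualVec (L : Eucl n →L[ℝ] ℝ) : Eucl n := WithLp.toLp 2 fun i => L (coordVec i)

lemma inner_dualVec (L : Eucl n →L[ℝ] ℝ) (v : Eucl n) : inner ℝ (dualVec L) v = L v := by
  conv_rhs => rw [← sum_coordVec v]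
  simp [PiLp.inner_apply, dualVec]

lemma norm_dualVec_le (L : Eucl n →L[ℝ] ℝ) : ‖dualVec L‖ ≤ ‖L‖ := by
  have h1 : ‖dualVec L‖ * ‖dualVec L‖ ≤ ‖L‖ * ‖dualVec L‖ := by
    rw [← real_inner_self_eq_norm_mul_norm, inner_dualVec]
    exact (le_abs_self _).trans (L.le_opNorm _)
  rcases (norm_nonneg (dualVec L)).eq_or_lt with h | h
  · rw [← h]; exact norm_nonneg L
  · exact le_of_mul_le_mul_right h1 h

end GraphTrace

/-! ### The inverse metric in normal coordinates -/

namespace LocalCoords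

variable {n : ℕ} {g : Eucl n → Fin n → Fin n → ℝ} {y : Eucl n}

lemma contDiffAt_entry {E : Type*} [NormedAddCommGroup E] [NormedSpace ℝ E]
    {k : WithTop ℕ∞} {g : E → Fin n → Fin n → ℝ} {y : E}
    (hg : ContDiffAt ℝ k g y) (i j : Fin n) : ContDiffAt ℝ k (fun z => g z i j) y :=
  contDiffAt_pi.1 (contDiffAt_pi.1 hg i) j

lemma contDiffAt_det {E : Type*} [NormedAddCommGroup E] [NormedSpace ℝ E]
    {k : WithTop ℕ∞} {A : E → Matrix (Fin n) (Fin n) ℝ} {y : E}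
    (hA : ∀ i j, ContDiffAt ℝ k (fun z => A z i j) y) :
    ContDiffAt ℝ k (fun z => (A z).det) y := by
  simp only [Matrix.det_apply']
  refine ContDiffAt.sum fun σ _ => ?_
  exact contDiffAt_const.mul (contDiffAt_prod fun i _ => hA _ _)

lemma contDiffAt_invMetric {k : WithTop ℕ∞} (hg : ContDiffAt ℝ k g y)
    (hdet : IsUnit (Matrix.of (g y)).det) (i j : Fin n) :
    ContDiffAt ℝ k (fun z => invMetric g z i j) y := by
  unfold invMetric
  simp only [Matrix.inv_def, Matrix.smul_apply, Ring.inverse_eq_inv', Matrix.adjugate_apply,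
    smul_eq_mul]
  refine ContDiffAt.mul ?_ ?_
  · exact (contDiffAt_det fun a b => contDiffAt_entry hg a b).inv hdet.ne_zero
  · refine contDiffAt_det fun a b => ?_
    simp only [Matrix.updateRow_apply]
    split_ifs
    · exact contDiffAt_const
    · exact contDiffAt_entry hg a b

lemma invMetric_of_delta (h0 : g y = fun i j => if i = j then 1 else 0) (i j : Fin n) :
    invMetric g y i j = if i = j then 1 else 0 := by
  have : Matrix.of (g y) = 1 := by
    ext i j
    simp [h0, Matrix.one_apply]
  rw [invMetric, this, inv_one, Matrix.one_apply]

/-- Smoothness provides some jet of the inverse; comparing the jets of the two sides of `g⁻¹ g = 1`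
then determines it, without differentiating an explicit inverse. -/
lemma invMetric_jet (hg : ContDiffAt ℝ 2 g y)
    (h0 : g y = fun i j => if i = j then 1 else 0) (h1 : fderiv ℝ g y = 0) (v : Eucl n)
    (i j : Fin n) :
    HasJet2 (fun t => invMetric g (y + t • v) i j) (if i = j then 1 else 0) 0
      (-fderiv ℝ (fderiv ℝ g) y v v i j) := by
  have hdet : IsUnit (Matrix.of (g y)).det := by
    have : Matrix.of (g y) = 1 := by
      ext i j
      simp [h0, Matrix.one_apply]
    rw [this]
    simp
  have hd : ∀ᶠ z in 𝓝 y, IsUnit (Matrix.of (g z)).det := by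
    have h2 : ContinuousAt (fun z => (Matrix.of (g z)).det) y :=
      (contDiffAt_det (A := fun z => Matrix.of (g z)) fun a b =>
        contDiffAt_entry hg a b).continuousAt
    filter_upwards [h2.eventually_ne hdet.ne_zero] with z hz using hz.isUnit
  have hgd : DifferentiableAt ℝ g y := hg.differentiableAt (by norm_num)
  have hgj : ∀ a b, HasJet2 (fun t => g (y + t • v) a b) (if a = b then 1 else 0) 0
      (fderiv ℝ (fderiv ℝ g) y v v a b) := by
    intro a b
    have h2 := (contDiffAt_entry hg a b).hasJet2 v
    have h3 : fderiv ℝ (fun z => g z a b) y v = 0 := by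
      rw [← fderiv_entry hgd, h1]
      simp
    have h4 : fderiv ℝ (fderiv ℝ (fun z => g z a b)) y v v
        = fderiv ℝ (fderiv ℝ g) y v v a b := by
      have hd2 : DifferentiableAt ℝ (fderiv ℝ g) y :=
        (hg.fderiv_right (m := 1) (by norm_num)).differentiableAt (by norm_num)
      have e1 : fderiv ℝ (fun z => fderiv ℝ (fun z => g z a b) z v) y v
          = fderiv ℝ (fun z => fderiv ℝ g z v a b) y v := by
        have : (fun z => fderiv ℝ (fun z => g z a b) z v) =ᶠ[𝓝 y]
            fun z => fderiv ℝ g z v a b := by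
          filter_upwards [hg.eventually (by simp)] with z hz
          rw [fderiv_entry (hz.differentiableAt (by norm_num))]
        rw [this.fderiv_eq]
      rw [fderiv_clm_apply (((contDiffAt_entry hg a b).fderiv_right
        (m := 1) (by norm_num)).differentiableAt (by norm_num)) (by fun_prop)] at e1
      rw [← fderiv_entry (hd2.clm_apply (differentiableAt_const v)),
        fderiv_clm_apply hd2 (by fun_prop)] at e1
      simpa using e1
    rw [h3, h4, h0] at h2
    exact h2
  obtain ⟨b, hb⟩ : ∃ b : Fin n → Fin n → ℝ, ∃ c : Fin n → Fin n → ℝ, ∀ a d,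
      HasJet2 (fun t => invMetric g (y + t • v) a d) (if a = d then 1 else 0) (b a d) (c a d) :=
    ⟨_, _, fun a d => by
      have := (contDiffAt_invMetric hg hdet a d).hasJet2 v
      rw [invMetric_of_delta h0] at this
      exact this⟩
  obtain ⟨c, hc⟩ := hb
  have hprod : ∀ a d, HasJet2 (fun t => ∑ e, invMetric g (y + t • v) a e * g (y + t • v) e d)
      _ _ _ := fun a d => HasJet2.sum fun e _ => (hc a e).mul (hgj e d)
  have hone : ∀ a d, HasJet2 (fun t => ∑ e, invMetric g (y + t • v) a e * g (y + t • v) e d)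
      (if a = d then 1 else 0) 0 0 := by
    intro a d
    refine (HasJet2.const (if a = d then 1 else 0)).congr ?_
    have hl : Filter.Tendsto (fun t : ℝ => y + t • v) (𝓝 0) (𝓝 y) := by
      have : Continuous (fun t : ℝ => y + t • v) := by fun_prop
      simpa using this.tendsto 0
    filter_upwards [hl.eventually hd] with t ht
    have := congrFun (congrFun (Matrix.nonsing_inv_mul _ ht) a) d
    rw [Matrix.mul_apply, Matrix.one_apply] at this
    exact this.symm
  have hu := fun a d => (hprod a d).unique (hone a d)
  have hb0 : ∀ a d, b a d = 0 := by
    intro a d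
    have := (hu a d).2.1
    simpa using this
  have hc0 : c i j = -fderiv ℝ (fderiv ℝ g) y v v i j := by
    have := (hu i j).2.2
    simp [hb0, Finset.sum_add_distrib] at this
    linarith
  have := hc i j
  rwa [hb0, hc0] at this

end LocalCoords

/-! ### The polynomial form of the Jang equation. -/

namespace LocalCoords

variable {n : ℕ} {g K : Eucl n → Fin n → Fin n → ℝ} {u f a : Eucl n → ℝ} {y : Eucl n}

lemma invMetric_symm (hs : ∀ i j, g y i j = g y j i) (k l : Fin n) :
    invMetric g y k l = invMetric g y l k := by
  have : (Matrix.of (g y)).transpose = Matrix.of (g y) := by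
    ext a b
    simp [hs a b]
  have h2 : ((Matrix.of (g y))⁻¹).transpose = (Matrix.of (g y))⁻¹ := by
    rw [Matrix.transpose_nonsing_inv, this]
  exact congrFun (congrFun h2 l) k

/-- The squared slope `u⁻² + |df|²` of the graph of `f`. -/
noncomputable def slopeSq (g : Eucl n → Fin n → Fin n → ℝ) (a f : Eucl n → ℝ) (y : Eucl n) : ℝ :=
  a y + normSqD g f y

/-- The Jang equation with `a = u⁻²` in polynomial form. -/
def PolynomialJang (g K : Eucl n → Fin n → Fin n → ℝ) (a f : Eucl n → ℝ) (ε : ℝ)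
    (y : Eucl n) : Prop :=
  ∑ i, ∑ j, (slopeSq g a f y * invMetric g y i j - grad g f y i * grad g f y j) *
    (hess g f y i j - Real.sqrt (slopeSq g a f y) * K y i j) =
  slopeSq g a f y * Real.sqrt (slopeSq g a f y) * (ε * f y) + ∑ i, grad g f y i * partialDeriv a y i

lemma normSqD_nonneg (hs : ∀ i j, g y i j = g y j i)
    (hpos : ∀ v : Eucl n, v ≠ 0 → 0 < bilin (g y) v v) : 0 ≤ normSqD g f y := by
  rw [normSqD_eq, ← bilin_grad_left hs (isUnit_det_of_pos _ hs hpos)]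
  rcases eq_or_ne (gradVec g f y) 0 with h | h
  · simp [h, bilin]
  · exact (hpos _ h).le

/-- Multiplication by `w √w` clears the denominators. The two terms with `du` contract to `2 ⟨∇f,
∇u⟩ (w - |df|²) = 2 ⟨∇f, ∇u⟩ u⁻²`, which after division by `u` is `-⟨∇f, ∇a⟩` for `a = u⁻²`. -/
lemma polynomialJang_of_jang (hs : ∀ i j, g y i j = g y j i)
    (hpos : ∀ v : Eucl n, v ≠ 0 → 0 < bilin (g y) v v) (hu : DifferentiableAt ℝ u y)
    (hu0 : 0 < u y) {ε : ℝ} (h : jang g K u f y = ε * f y) :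
    PolynomialJang g K (fun z => (u z ^ 2)⁻¹) f ε y := by
  set w := slopeSq g (fun z => (u z ^ 2)⁻¹) f y with hw
  have hN0 := normSqD_nonneg (f := f) hs hpos
  have hwpos : 0 < w := by
    have : 0 < (u y ^ 2)⁻¹ := by positivity
    rw [hw, slopeSq]
    linarith
  have hD : 1 + u y ^ 2 * normSqD g f y = u y ^ 2 * w := by
    rw [hw, slopeSq]
    field_simp
  have hsq : Real.sqrt (u y ^ 2 * w) = u y * Real.sqrt w := by
    rw [Real.sqrt_mul (by positivity), Real.sqrt_sq hu0.le]
  set v := Real.sqrt w with hv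
  have hvpos : 0 < v := Real.sqrt_pos.2 hwpos
  have hvw : v ^ 2 = w := Real.sq_sqrt hwpos.le
  have ha : ∀ i, partialDeriv (fun z => (u z ^ 2)⁻¹) y i = -2 * partialDeriv u y i / u y ^ 3 := by
    intro i
    have h0 : HasDerivAt (fun x : ℝ => (x ^ 2)⁻¹) _ (u y) :=
      (hasDerivAt_pow 2 (u y)).fun_inv (by positivity)
    have h1 : HasFDerivAt (fun z => (u z ^ 2)⁻¹) _ y := h0.comp_hasFDerivAt y hu.hasFDerivAt
    rw [partialDeriv, h1.fderiv]
    simp [partialDeriv]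
    field_simp
  have hcross : ∑ i, ∑ j, (w * invMetric g y i j - grad g f y i * grad g f y j) *
      (partialDeriv u y i * partialDeriv f y j + partialDeriv f y i * partialDeriv u y j) =
      2 * (∑ i, grad g f y i * partialDeriv u y i) * (w - normSqD g f y) := by
    have e1 : ∑ i, ∑ j, invMetric g y i j * (partialDeriv u y i * partialDeriv f y j)
        = ∑ i, grad g f y i * partialDeriv u y i := by
      refine Finset.sum_congr rfl fun i _ => ?_
      rw [grad, Finset.sum_mul]
      exact Finset.sum_congr rfl fun j _ => by ring
    have e2 : ∑ i, ∑ j, invMetric g y i j * (partialDeriv f y i * partialDeriv u y j)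
        = ∑ i, grad g f y i * partialDeriv u y i := by
      rw [Finset.sum_comm]
      refine Finset.sum_congr rfl fun i _ => ?_
      rw [grad, Finset.sum_mul]
      exact Finset.sum_congr rfl fun j _ => by rw [invMetric_symm hs]; ring
    have e3 : ∑ i, ∑ j, grad g f y i * grad g f y j *
        (partialDeriv u y i * partialDeriv f y j)
        = (∑ i, grad g f y i * partialDeriv u y i) * normSqD g f y := by
      rw [normSqD, Finset.sum_mul_sum]
      exact Finset.sum_congr rfl fun i _ => Finset.sum_congr rfl fun j _ => by ring
    have e4 : ∑ i, ∑ j, grad g f y i * grad g f y j *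
        (partialDeriv f y i * partialDeriv u y j)
        = (∑ i, grad g f y i * partialDeriv u y i) * normSqD g f y := by
      rw [mul_comm, normSqD, Finset.sum_mul_sum]
      exact Finset.sum_congr rfl fun i _ => Finset.sum_congr rfl fun j _ => by ring
    calc _ = w * (∑ i, ∑ j, invMetric g y i j * (partialDeriv u y i * partialDeriv f y j)) +
        w * (∑ i, ∑ j, invMetric g y i j * (partialDeriv f y i * partialDeriv u y j)) -
        (∑ i, ∑ j, grad g f y i * grad g f y j * (partialDeriv u y i * partialDeriv f y j)) -
        (∑ i, ∑ j, grad g f y i * grad g f y j * (partialDeriv f y i * partialDeriv u y j)) := by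
          simp only [Finset.mul_sum, ← Finset.sum_add_distrib, ← Finset.sum_sub_distrib]
          exact Finset.sum_congr rfl fun i _ => Finset.sum_congr rfl fun j _ => by ring
      _ = _ := by rw [e1, e2, e3, e4]; ring
  have hmain : w * v * jang g K u f y =
      ∑ i, ∑ j, (w * invMetric g y i j - grad g f y i * grad g f y j) *
        (hess g f y i j - v * K y i j) + (u y)⁻¹ *
      ∑ i, ∑ j, (w * invMetric g y i j - grad g f y i * grad g f y j) *
      (partialDeriv u y i * partialDeriv f y j + partialDeriv f y i * partialDeriv u y j) := by
    simp only [jang, hD, hsq, Finset.mul_sum, ← Finset.sum_add_distrib]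
    refine Finset.sum_congr rfl fun i _ => Finset.sum_congr rfl fun j _ => ?_
    field_simp
    ring
  unfold PolynomialJang
  rw [← hw, ← hv]
  rw [h, hcross] at hmain
  have hwN : w - normSqD g f y = (u y ^ 2)⁻¹ := by
    rw [hw, slopeSq]
    ring
  have hlast : ∑ i, grad g f y i * partialDeriv (fun z => (u z ^ 2)⁻¹) y i =
      -2 / u y ^ 3 * ∑ i, grad g f y i * partialDeriv u y i := by
    rw [Finset.mul_sum]
    exact Finset.sum_congr rfl fun i _ => by rw [ha]; ring
  rw [hlast]
  rw [hwN] at hmain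
  rw [eq_comm] at hmain
  have e5 : (u y)⁻¹ * (2 * (∑ i, grad g f y i * partialDeriv u y i) * (u y ^ 2)⁻¹)
      = 2 / u y ^ 3 * ∑ i, grad g f y i * partialDeriv u y i := by
    field_simp
  rw [e5] at hmain
  linear_combination hmain

end LocalCoords

/-! ### The gradient bound at a maximum point in normal coordinates -/

section Line

variable {E V W : Type*} [NormedAddCommGroup E] [NormedSpace ℝ E] [NormedAddCommGroup V]
  [NormedSpace ℝ V] [NormedAddCommGroup W] [NormedSpace ℝ W] {y : E}

lemma hasDerivAt_line_apply {F : E → V →L[ℝ] W} (h : DifferentiableAt ℝ F y) (v : E) (x : V) :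
    HasDerivAt (fun t : ℝ => F (y + t • v) x) (fderiv ℝ F y v x) 0 := by
  simpa using (hasDerivAt_line h v).clm_apply (hasDerivAt_const (0 : ℝ) x)

lemma hasDerivAt_line_apply_apply {F : E → V →L[ℝ] V →L[ℝ] W} (h : DifferentiableAt ℝ F y)
    (v : E) (x z : V) :
    HasDerivAt (fun t : ℝ => F (y + t • v) x z) (fderiv ℝ F y v x z) 0 := by
  simpa using (hasDerivAt_line_apply h v x).clm_apply (hasDerivAt_const (0 : ℝ) z)

/-- Because `F` vanishes at `y`, the velocity of the curve drops out. In normal coordinates `F` is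
the derivative of the metric and the curve is the gradient of `f`. -/
lemma hasDerivAt_line_apply_curve {F : E → V →L[ℝ] W} (h : DifferentiableAt ℝ F y) (h0 : F y = 0)
    (v : E) {c : ℝ → V} {c' : V} (hc : HasDerivAt c c' 0) :
    HasDerivAt (fun t : ℝ => F (y + t • v) (c t)) (fderiv ℝ F y v (c 0)) 0 := by
  simpa [h0] using (hasDerivAt_line h v).clm_apply hc

lemma fderiv_fderiv_apply_apply {F G : E → ℝ} {w : E} (hF : ContDiffAt ℝ 3 F y)
    (hG : ContDiffAt ℝ 2 G y)
    (hFG : ∀ᶠ z in 𝓝 y, ∀ v, fderiv ℝ G z v = fderiv ℝ (fderiv ℝ F) z v w) (v : E) :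
    fderiv ℝ (fderiv ℝ G) y v v = fderiv ℝ (fderiv ℝ (fderiv ℝ F)) y v v w := by
  have h3 : DifferentiableAt ℝ (fderiv ℝ G) y :=
    (hG.fderiv_right (m := 1) (by norm_num)).differentiableAt (by norm_num)
  have h4 : DifferentiableAt ℝ (fderiv ℝ (fderiv ℝ F)) y :=
    (((hF.fderiv_right (m := 2) (by norm_num)).fderiv_right
      (m := 1) (by norm_num))).differentiableAt (by norm_num)
  have hl : Filter.Tendsto (fun t : ℝ => y + t • v) (𝓝 0) (𝓝 y) := by
    have : Continuous (fun t : ℝ => y + t • v) := by fun_prop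
    simpa using this.tendsto 0
  refine (hasDerivAt_line_apply h3 v v).unique
    ((hasDerivAt_line_apply_apply h4 v v w).congr_of_eventuallyEq ?_)
  filter_upwards [hl.eventually hFG] with t ht using ht v

end Line

namespace LocalCoords

variable {n : ℕ}

/-- Solutions of the Jang equation in coordinates which are normal at the origin. -/
structure IsJangNormal (g K : Eucl n → Fin n → Fin n → ℝ) (a f : Eucl n → ℝ) (ε : ℝ) : Prop where
  contDiffAt_g : ContDiffAt ℝ 2 g 0
  g_zero : g 0 = fun i j => if i = j then 1 else 0
  fderiv_g : fderiv ℝ g 0 = 0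
  g_symm : ∀ᶠ y in 𝓝 0, ∀ i j, g y i j = g y j i
  differentiableAt_K : DifferentiableAt ℝ K 0
  K_symm : ∀ i j, K 0 i j = K 0 j i
  contDiffAt_a : ContDiffAt ℝ 2 a 0
  a_pos : 0 < a 0
  contDiffAt_f : ContDiffAt ℝ 3 f 0
  equation : ∀ᶠ y in 𝓝 0, PolynomialJang g K a f ε y

namespace IsJangNormal

variable {g K : Eucl n → Fin n → Fin n → ℝ} {a f : Eucl n → ℝ} {ε : ℝ}

lemma contDiffAt_partialDeriv {k : WithTop ℕ∞} {f : Eucl n → ℝ} {y : Eucl n}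
    (hf : ContDiffAt ℝ (k + 1) f y) (i : Fin n) :
    ContDiffAt ℝ k (fun z => partialDeriv f z i) y :=
  (hf.fderiv_right (m := k) le_rfl).clm_apply contDiffAt_const

lemma fderiv_partialDeriv {f : Eucl n → ℝ} {y : Eucl n} (hf : ContDiffAt ℝ 2 f y) (i : Fin n)
    (v : Eucl n) :
    fderiv ℝ (fun z => partialDeriv f z i) y v = fderiv ℝ (fderiv ℝ f) y v (coordVec i) := by
  have h : DifferentiableAt ℝ (fderiv ℝ f) y :=
    (hf.fderiv_right (m := 1) (by norm_num)).differentiableAt (by norm_num)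
  unfold partialDeriv
  rw [fderiv_clm_apply h (by fun_prop)]
  simp

lemma jet_partialDeriv {f : Eucl n → ℝ} {y : Eucl n} (hf : ContDiffAt ℝ 3 f y) (i : Fin n)
    (v : Eucl n) :
    HasJet2 (fun t => partialDeriv f (y + t • v) i) (partialDeriv f y i)
      (fderiv ℝ (fderiv ℝ f) y v (coordVec i))
      (fderiv ℝ (fderiv ℝ (fderiv ℝ f)) y v v (coordVec i)) := by
  have h1 := (contDiffAt_partialDeriv (k := 2) hf i).hasJet2 v
  rw [fderiv_partialDeriv (hf.of_le (by norm_num))] at h1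
  rwa [fderiv_fderiv_apply_apply (w := coordVec i) hf (contDiffAt_partialDeriv (k := 2) hf i) (by
    filter_upwards [hf.eventually (by simp)] with z hz v
    exact fderiv_partialDeriv (hz.of_le (by norm_num)) i v)] at h1

variable (h : IsJangNormal g K a f ε)

include h

lemma invMetric_zero (i j : Fin n) : invMetric g 0 i j = if i = j then 1 else 0 :=
  invMetric_of_delta h.g_zero i j

lemma grad_zero (i : Fin n) : grad g f 0 i = partialDeriv f 0 i := by
  simp [grad, h.invMetric_zero]

lemma gradVec_zero : gradVec g f 0 = dualVec (fderiv ℝ f 0) := by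
  ext i
  simp [gradVec, h.grad_zero, dualVec, partialDeriv]

lemma slopeSq_zero : slopeSq g a f 0 = a 0 + ‖dualVec (fderiv ℝ f 0)‖ ^ 2 := by
  rw [slopeSq, normSqD_eq, h.gradVec_zero, ← real_inner_self_eq_norm_sq, inner_dualVec]

/-- In normal coordinates the inverse metric is stationary with second derivative `-D²g`, so in the
product rule for `g^{ij} f_i f_j` the metric contributes only `-D²g` evaluated on the gradient. -/
lemma jet_slopeSq (v : Eucl n) :
    HasJet2 (fun t => slopeSq g a f ((0 : Eucl n) + t • v)) (slopeSq g a f 0)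
      (fderiv ℝ a 0 v + 2 * fderiv ℝ (fderiv ℝ f) 0 v (dualVec (fderiv ℝ f 0)))
      (fderiv ℝ (fderiv ℝ a) 0 v v - bilin (fderiv ℝ (fderiv ℝ g) 0 v v)
          (dualVec (fderiv ℝ f 0)) (dualVec (fderiv ℝ f 0)) +
        2 * ∑ i, fderiv ℝ (fderiv ℝ f) 0 v (coordVec i) ^ 2 +
        2 * fderiv ℝ (fderiv ℝ (fderiv ℝ f)) 0 v v (dualVec (fderiv ℝ f 0))) := by
  have h1 := h.contDiffAt_a.hasJet2 v
  have h2 := fun i => jet_partialDeriv h.contDiffAt_f i v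
  have h3 := fun i j => invMetric_jet h.contDiffAt_g h.g_zero h.fderiv_g v i j
  have h4 := h1.add (HasJet2.sum (s := Finset.univ) fun i _ =>
    (HasJet2.sum (s := Finset.univ) fun j _ => (h3 i j).mul (h2 j)).mul (h2 i))
  have hl : ∀ L : Eucl n →L[ℝ] ℝ, L (dualVec (fderiv ℝ f 0))
      = ∑ i, partialDeriv f 0 i * L (coordVec i) := by
    intro L
    conv_lhs => rw [← sum_coordVec (dualVec (fderiv ℝ f 0))]
    simp [dualVec, partialDeriv]
  convert! h4 using 1
  · simp [slopeSq, normSqD, h.grad_zero]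
  · simp only [hl, zero_mul, zero_add, ite_mul, one_mul, Finset.sum_ite_eq, Finset.mem_univ,
      if_true, Finset.mul_sum]
    congr 1
    exact Finset.sum_congr rfl fun i _ => by ring
  · simp only [hl, zero_mul, zero_add, ite_mul, one_mul, Finset.sum_ite_eq, Finset.mem_univ,
      if_true, Finset.mul_sum, mul_zero, add_zero, Finset.sum_add_distrib, bilin]
    have e : ∑ i, (∑ j, -fderiv ℝ (fderiv ℝ g) 0 v v i j * partialDeriv f 0 j) *
        partialDeriv f 0 i = -∑ i, ∑ j, fderiv ℝ (fderiv ℝ g) 0 v v i j *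
          (dualVec (fderiv ℝ f 0)) i * (dualVec (fderiv ℝ f 0)) j := by
      simp only [Finset.sum_mul, ← Finset.sum_neg_distrib]
      exact Finset.sum_congr rfl fun i _ => Finset.sum_congr rfl fun j _ => by
        simp [dualVec, partialDeriv]; ring
    simp only [add_mul, Finset.sum_add_distrib]
    rw [e]
    have e2 : ∑ i, 2 * fderiv ℝ (fderiv ℝ f) 0 v (coordVec i) ^ 2 =
      ∑ i, 2 * (fderiv ℝ (fderiv ℝ f) 0 v) (coordVec i) *
        (fderiv ℝ (fderiv ℝ f) 0 v) (coordVec i) :=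
      Finset.sum_congr rfl fun i _ => by ring
    have e3 : ∑ i, 2 * (partialDeriv f 0 i * (fderiv ℝ (fderiv ℝ (fderiv ℝ f)) 0 v v) (coordVec i))
      = ∑ i, fderiv ℝ (fderiv ℝ (fderiv ℝ f)) 0 v v (coordVec i) * partialDeriv f 0 i +
        ∑ i, partialDeriv f 0 i * fderiv ℝ (fderiv ℝ (fderiv ℝ f)) 0 v v (coordVec i) := by
      rw [← Finset.sum_add_distrib]
      exact Finset.sum_congr rfl fun i _ => by ring
    rw [e2, e3]
    ring

omit h in
/-- The consequences of the maximum principle for `(exp (k φ) - 1)² w`. -/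
lemma maximum_conditions {φ w : ℝ → ℝ} {k φ0 φ1 φ2 w0 w1 w2 : ℝ} (hφ : HasJet2 φ φ0 φ1 φ2)
    (hw : HasJet2 w w0 w1 w2) (hk : 0 < k) (hφ0 : 0 < φ0)
    (hmax : IsLocalMax (fun t => (Real.exp (k * φ t) - 1) ^ 2 * w t) 0) :
    ∃ κ, κ = k * Real.exp (k * φ0) / (Real.exp (k * φ0) - 1) ∧
      w1 = -(2 * w0 * κ * φ1) ∧
      w2 ≤ w0 * ((6 * κ ^ 2 - 2 * κ * k) * φ1 ^ 2 - 2 * κ * φ2) := by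
  refine ⟨_, rfl, ?_⟩
  have h1 := (((HasJet2.const k).mul hφ).exp).add (HasJet2.const (-1))
  have h2 := (h1.mul h1).mul hw
  have h3 : IsLocalMax (fun t => (Real.exp (k * φ t) + -1) * (Real.exp (k * φ t) + -1) * w t) 0 := by
    convert! hmax using 2 with t
    ring
  obtain ⟨e1, e2⟩ := h2.isLocalMax h3
  have hE : 0 < Real.exp (k * φ0) - 1 := by
    have := Real.add_one_lt_exp (show k * φ0 ≠ 0 by positivity)
    have : 0 < k * φ0 := by positivity
    linarith
  set E := Real.exp (k * φ0)
  -- The derivatives are expressed by `η = exp (k φ) - 1` and its logarithmic derivative `κ` with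
  -- respect to `φ`; the common factor `η ^ 2` can then be cancelled.
  obtain ⟨η, hη⟩ : ∃ η, η = E - 1 := ⟨_, rfl⟩
  have hη0 : 0 < η := by rw [hη]; exact hE
  obtain ⟨κ, hκ⟩ : ∃ κ, κ = k * E / (E - 1) := ⟨_, rfl⟩
  have hEκ : k * E = η * κ := by rw [hκ, ← hη]; field_simp
  rw [← hκ]
  have e1' : η * (w1 + 2 * w0 * κ * φ1) = 0 := by
    have : η * (η * (w1 + 2 * w0 * κ * φ1)) = 0 := by
      rw [← e1, show E + -1 = η by rw [hη]; ring]
      linear_combination -(2 * η * φ1 * w0) * hEκ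
    rcases mul_eq_zero.1 this with h | h
    · exact absurd h hη0.ne'
    · exact h
  have hw1 : w1 = -(2 * w0 * κ * φ1) := by
    rcases mul_eq_zero.1 e1' with h | h
    · exact absurd h hη0.ne'
    · linarith
  refine ⟨hw1, ?_⟩
  -- Inserting `hw1` in the mixed term gives `-8 κ² φ1²`; with `2 κ² φ1²` from the square this is
  -- the coefficient `6` on the other side.
  have e2' : η ^ 2 * (w2 - w0 * ((6 * κ ^ 2 - 2 * κ * k) * φ1 ^ 2 - 2 * κ * φ2)) ≤ 0 := by
    refine le_of_eq_of_le ?_ e2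
    rw [show E + -1 = η by rw [hη]; ring, hw1]
    have h5 : E * (0 * φ0 + k * φ1) = η * κ * φ1 := by rw [← hEκ]; ring
    have h6 : E * ((0 * φ0 + k * φ1) ^ 2 + (0 * φ0 + 2 * 0 * φ1 + k * φ2)) =
        η * κ * (k * φ1 ^ 2 + φ2) := by rw [← hEκ]; ring
    rw [h5, h6]
    ring
  have : w2 - w0 * ((6 * κ ^ 2 - 2 * κ * k) * φ1 ^ 2 - 2 * κ * φ2) ≤ 0 := by
    by_contra hc
    push Not at hc
    exact absurd e2' (not_le.2 (by positivity))
  linarith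

/-- The derivative of the Christoffel terms in the Hessian. -/
noncomputable def _root_.LocalCoords.christoffelDeriv (g : Eucl n → Fin n → Fin n → ℝ)
    (p v w : Eucl n) : ℝ :=
  (1 / 2) * (bilin (fderiv ℝ (fderiv ℝ g) 0 p v) w p + bilin (fderiv ℝ (fderiv ℝ g) 0 p w) v p -
    bilin (fderiv ℝ (fderiv ℝ g) 0 p p) v w)

lemma hess_zero (i j : Fin n) :
    hess g f 0 i j = fderiv ℝ (fderiv ℝ f) 0 (coordVec i) (coordVec j) := by
  have hg := h.contDiffAt_g.differentiableAt (by norm_num : (2 : WithTop ℕ∞) ≠ 0)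
  have hf : DifferentiableAt ℝ (fderiv ℝ f) 0 :=
    (h.contDiffAt_f.fderiv_right (m := 2) (by norm_num)).differentiableAt (by norm_num)
  rw [hess_eq hg h.g_symm.self_of_nhds hf, hessForm, h.fderiv_g]
  simp [bilin]

lemma hasDerivAt_grad (v : Eucl n) (i : Fin n) :
    HasDerivAt (fun t : ℝ => grad g f ((0 : Eucl n) + t • v) i)
      (fderiv ℝ (fderiv ℝ f) 0 v (coordVec i)) 0 := by
  have h2 := fun i => (jet_partialDeriv h.contDiffAt_f i v).hasDerivAt
  have h3 := fun i j => (invMetric_jet h.contDiffAt_g h.g_zero h.fderiv_g v i j).hasDerivAt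
  have := HasDerivAt.fun_sum (u := Finset.univ) fun j (_ : j ∈ Finset.univ) =>
    (h3 i j).fun_mul (h2 j)
  convert! this using 1
  simp [h.invMetric_zero]

lemma hasDerivAt_gradVec (v : Eucl n) :
    HasDerivAt (fun t : ℝ => gradVec g f ((0 : Eucl n) + t • v))
      (dualVec (fderiv ℝ (fderiv ℝ f) 0 v)) 0 := by
  have h1 := HasDerivAt.fun_sum (u := Finset.univ) fun i (_ : i ∈ Finset.univ) =>
    (h.hasDerivAt_grad v i).smul_const (coordVec i : Eucl n)
  have h2 : (fun t : ℝ => gradVec g f ((0 : Eucl n) + t • v)) = fun t : ℝ =>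
      ∑ i, grad g f ((0 : Eucl n) + t • v) i • (coordVec i : Eucl n) := by
    funext t
    exact (sum_coordVec (gradVec g f ((0 : Eucl n) + t • v))).symm
  have h3 : dualVec (fderiv ℝ (fderiv ℝ f) 0 v) =
      ∑ i, fderiv ℝ (fderiv ℝ f) 0 v (coordVec i) • (coordVec i : Eucl n) :=
    (sum_coordVec (dualVec (fderiv ℝ (fderiv ℝ f) 0 v))).symm
  rw [h2, h3]
  exact h1

/-- The Christoffel symbols vanish at the origin. Hence the derivative of the gradient multiplying
them does not contribute, and only second derivatives of the metric remain. -/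
lemma hasDerivAt_hess (v : Eucl n) (i j : Fin n) :
    HasDerivAt (fun t : ℝ => hess g f ((0 : Eucl n) + t • v) i j)
      (fderiv ℝ (fderiv ℝ (fderiv ℝ f)) 0 v (coordVec i) (coordVec j) -
        (1 / 2) * (bilin (fderiv ℝ (fderiv ℝ g) 0 v (coordVec i)) (coordVec j)
          (dualVec (fderiv ℝ f 0)) + bilin (fderiv ℝ (fderiv ℝ g) 0 v (coordVec j)) (coordVec i)
          (dualVec (fderiv ℝ f 0)) - bilin (fderiv ℝ (fderiv ℝ g) 0 v (dualVec (fderiv ℝ f 0)))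
            (coordVec i) (coordVec j))) 0 := by
  have hl : Filter.Tendsto (fun t : ℝ => (0 : Eucl n) + t • v) (𝓝 0) (𝓝 0) := by
    have : Continuous (fun t : ℝ => (0 : Eucl n) + t • v) := by fun_prop
    simpa using this.tendsto 0
  have hev : (fun t : ℝ => hess g f ((0 : Eucl n) + t • v) i j) =ᶠ[𝓝 0]
      fun t : ℝ => hessForm g f ((0 : Eucl n) + t • v) (gradVec g f ((0 : Eucl n) + t • v))
        (coordVec i) (coordVec j) := by
    filter_upwards [hl.eventually (h.contDiffAt_g.eventually (by simp)),
      hl.eventually (h.contDiffAt_f.eventually (by simp)), hl.eventually h.g_symm] with t h1 h2 h3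
    exact hess_eq (h1.differentiableAt (by norm_num)) h3
      ((h2.fderiv_right (m := 2) (by norm_num)).differentiableAt (by norm_num)) i j
  refine HasDerivAt.congr_of_eventuallyEq ?_ hev
  have hN := h.hasDerivAt_gradVec v
  have hf2 : DifferentiableAt ℝ (fderiv ℝ (fderiv ℝ f)) 0 :=
    ((h.contDiffAt_f.fderiv_right (m := 2) (by norm_num)).fderiv_right
      (m := 1) (by norm_num)).differentiableAt (by norm_num)
  have hg2 : DifferentiableAt ℝ (fderiv ℝ g) 0 :=
    (h.contDiffAt_g.fderiv_right (m := 1) (by norm_num)).differentiableAt (by norm_num)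
  have d1 := hasDerivAt_line_apply_apply hf2 v (coordVec i) (coordVec j)
  have d2 := hasDerivAt_line_apply hg2 v (coordVec i)
  have d2' := hasDerivAt_line_apply hg2 v (coordVec j)
  have d3 := hasDerivAt_line_apply_curve hg2 h.fderiv_g v hN
  have e1 := d2.bilin (hasDerivAt_const 0 (coordVec j)) hN
  have e2 := d2'.bilin (hasDerivAt_const 0 (coordVec i)) hN
  have e3 := d3.bilin (hasDerivAt_const 0 (coordVec i)) (hasDerivAt_const 0 (coordVec j))
  have hS : ∀ x y : Eucl n, _root_.bilin (0 : Fin n → Fin n → ℝ) x y = 0 := by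
    intro x y
    simp [_root_.bilin]
  have hz : (0 : Eucl n) + (0 : ℝ) • v = 0 := by simp
  have e4 := d1.fun_sub (((e1.fun_add e2).fun_sub e3).const_mul (1 / 2))
  simp only [hz, h.fderiv_g, h.gradVec_zero, zero_apply, hS, add_zero] at e4
  exact e4

omit h in
lemma sum_delta_sub (c : ℝ) (x y : Eucl n) (Z : Fin n → Fin n → ℝ) :
    ∑ i, ∑ j, (c * (if i = j then 1 else 0) - x i * y j) * Z i j =
      c * ∑ i, Z i i - bilin Z x y := by
  simp only [sub_mul, Finset.sum_sub_distrib, bilin, Finset.mul_sum]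
  congr 1
  · simp
  · exact Finset.sum_congr rfl fun i _ => Finset.sum_congr rfl fun j _ => by ring

omit h in
lemma bilin_sub_smul (A B : Fin n → Fin n → ℝ) (c : ℝ) (v w : Eucl n) :
    bilin (fun i j => A i j - c * B i j) v w = bilin A v w - c * bilin B v w := by
  simp only [bilin, Finset.mul_sum, ← Finset.sum_sub_distrib]
  exact Finset.sum_congr rfl fun i _ => Finset.sum_congr rfl fun j _ => by ring

/-- The equation at the origin. -/
lemma equation_zero {p : Eucl n} (hp : p = dualVec (fderiv ℝ f 0)) {w : ℝ}
    (hw : w = slopeSq g a f 0) :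
    w * (∑ i, fderiv ℝ (fderiv ℝ f) 0 (coordVec i) (coordVec i) - Real.sqrt w * ∑ i, K 0 i i) -
      (fderiv ℝ (fderiv ℝ f) 0 p p - Real.sqrt w * bilin (K 0) p p) =
    w * Real.sqrt w * (ε * f 0) + fderiv ℝ a 0 p := by
  have h1 := h.equation.self_of_nhds
  unfold PolynomialJang at h1
  have hg : ∀ i, grad g f 0 i = p i := fun i => by
    rw [h.grad_zero, hp]
    rfl
  simp only [h.invMetric_zero, hg, h.hess_zero, ← hw, sum_delta_sub, bilin_sub_smul,
    Finset.sum_sub_distrib, ← Finset.mul_sum,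
    (isBilin_clm (fderiv ℝ (fderiv ℝ f) 0)).eq_bilin] at h1
  rw [h1, fderiv_eq_sum]
  simp only [mul_comm (partialDeriv _ _ _)]

/-- The derivative of the equation in the direction of the gradient. -/
lemma equation_deriv {p : Eucl n} (hp : p = dualVec (fderiv ℝ f 0)) {w v w1 v1 : ℝ}
    (hw : w = slopeSq g a f 0) (hv : v = Real.sqrt w)
    (hw1 : w1 = fderiv ℝ a 0 p + 2 * fderiv ℝ (fderiv ℝ f) 0 p p) (hv1 : v1 = w1 / (2 * v))
    {F : Eucl n} (hF : F = dualVec (fderiv ℝ (fderiv ℝ f) 0 p)) :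
    w1 * (∑ i, fderiv ℝ (fderiv ℝ f) 0 (coordVec i) (coordVec i) - v * ∑ i, K 0 i i) -
      2 * (‖F‖ ^ 2 - v * bilin (K 0) F p) +
      (w * (∑ i, (fderiv ℝ (fderiv ℝ (fderiv ℝ f)) 0 p (coordVec i) (coordVec i) -
          christoffelDeriv g p (coordVec i) (coordVec i) - v1 * K 0 i i -
          v * fderiv ℝ K 0 p i i)) -
        (fderiv ℝ (fderiv ℝ (fderiv ℝ f)) 0 p p p - christoffelDeriv g p p p -
          v1 * bilin (K 0) p p - v * bilin (fderiv ℝ K 0 p) p p)) =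
    (w1 * v + w * v1) * (ε * f 0) + w * v * (ε * ‖p‖ ^ 2) +
      (fderiv ℝ (fderiv ℝ a) 0 p p + inner ℝ (dualVec (fderiv ℝ a 0)) F) := by
  have hwpos : 0 < w := by
    rw [hw, h.slopeSq_zero]
    have := h.a_pos
    positivity
  have hl : Filter.Tendsto (fun t : ℝ => (0 : Eucl n) + t • p) (𝓝 0) (𝓝 0) := by
    have : Continuous (fun t : ℝ => (0 : Eucl n) + t • p) := by fun_prop
    simpa using this.tendsto 0
  have hz : (0 : Eucl n) + (0 : ℝ) • p = 0 := by simp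
  have hg : ∀ i, grad g f 0 i = p i := fun i => by
    rw [h.grad_zero, hp]
    rfl
  have hFi : ∀ i, fderiv ℝ (fderiv ℝ f) 0 p (coordVec i) = F i := fun i => by
    rw [hF]
    rfl
  have dw : HasDerivAt (fun t : ℝ => slopeSq g a f ((0 : Eucl n) + t • p)) w1 0 := by
    rw [hw1, hp]
    exact (h.jet_slopeSq _).hasDerivAt
  have dv : HasDerivAt (fun t : ℝ => Real.sqrt (slopeSq g a f ((0 : Eucl n) + t • p))) v1 0 := by
    have := dw.sqrt (by rw [hz, ← hw]; exact hwpos.ne')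
    rw [hz, ← hw, ← hv] at this
    rwa [hv1]
  have dI := fun i j => (invMetric_jet h.contDiffAt_g h.g_zero h.fderiv_g p i j).hasDerivAt
  have dN := fun i => h.hasDerivAt_grad p i
  have dH := fun i j => h.hasDerivAt_hess p i j
  have dK : ∀ i j, HasDerivAt (fun t : ℝ => K ((0 : Eucl n) + t • p) i j)
      (fderiv ℝ K 0 p i j) 0 := fun i j =>
    (hasDerivAt_pi.1 (hasDerivAt_pi.1 (hasDerivAt_line h.differentiableAt_K p) i)) j
  have df := hasDerivAt_line (h.contDiffAt_f.differentiableAt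
    (by norm_num : (3 : WithTop ℕ∞) ≠ 0)) p
  have da : ∀ i, HasDerivAt (fun t : ℝ => partialDeriv a ((0 : Eucl n) + t • p) i)
      (fderiv ℝ (fderiv ℝ a) 0 p (coordVec i)) 0 := by
    intro i
    have := hasDerivAt_line ((contDiffAt_partialDeriv (k := 1)
      h.contDiffAt_a i).differentiableAt (by norm_num)) p
    rwa [fderiv_partialDeriv h.contDiffAt_a] at this
  have dL := HasDerivAt.fun_sum (u := Finset.univ) fun i (_ : i ∈ Finset.univ) =>
    HasDerivAt.fun_sum (u := Finset.univ) fun j (_ : j ∈ Finset.univ) =>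
      ((dw.fun_mul (dI i j)).fun_sub ((dN i).fun_mul (dN j))).fun_mul
        ((dH i j).fun_sub (dv.fun_mul (dK i j)))
  have dR := ((dw.fun_mul dv).fun_mul (df.const_mul ε)).fun_add
    (HasDerivAt.fun_sum (u := Finset.univ) fun i (_ : i ∈ Finset.univ) => (dN i).fun_mul (da i))
  -- The two sides of the equation agree along the line `t ↦ t p` near the origin, so their
  -- derivatives agree.
  have heq := (dL.congr_of_eventuallyEq (f₁ := fun t : ℝ =>
    slopeSq g a f ((0 : Eucl n) + t • p) * Real.sqrt (slopeSq g a f ((0 : Eucl n) + t • p)) *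
      (ε * f ((0 : Eucl n) + t • p)) + ∑ i, grad g f ((0 : Eucl n) + t • p) i *
        partialDeriv a ((0 : Eucl n) + t • p) i) (by
      filter_upwards [hl.eventually h.equation] with t ht
      exact ht.symm)).unique dR
  simp only [hz, h.invMetric_zero, hg, h.hess_zero, ← hw, ← hv, hFi, ← hp, mul_zero, add_zero]
    at heq
  have hR : ∀ i j, (1 / 2) * (bilin (fderiv ℝ (fderiv ℝ g) 0 p (coordVec i)) (coordVec j) p +
      bilin (fderiv ℝ (fderiv ℝ g) 0 p (coordVec j)) (coordVec i) p -
      bilin (fderiv ℝ (fderiv ℝ g) 0 p p) (coordVec i) (coordVec j)) =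
      christoffelDeriv g p (coordVec i) (coordVec j) := fun i j => rfl
  simp only [hR] at heq
  have hBR : IsBilin (christoffelDeriv g p) := by
    have hA : ∀ (A B : Fin n → Fin n → ℝ) (v w : Eucl n),
        bilin (A + B) v w = bilin A v w + bilin B v w := by
      intro A B v w
      simp only [bilin, ← Finset.sum_add_distrib]
      exact Finset.sum_congr rfl fun i _ => Finset.sum_congr rfl fun j _ => by simp; ring
    have hS : ∀ (c : ℝ) (A : Fin n → Fin n → ℝ) (v w : Eucl n),
        bilin (c • A) v w = c * bilin A v w := by
      intro c A v w
      simp only [bilin, Finset.mul_sum]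
      exact Finset.sum_congr rfl fun i _ => Finset.sum_congr rfl fun j _ => by simp; ring
    constructor <;> intros <;> simp only [christoffelDeriv, map_add, map_smul, hA, hS,
      bilin_add_left, bilin_add_right, bilin_smul_left, bilin_smul_right] <;> ring
  set Z : Fin n → Fin n → ℝ := fun i j =>
    fderiv ℝ (fderiv ℝ f) 0 (coordVec i) (coordVec j) - v * K 0 i j with hZ
  set X : Fin n → Fin n → ℝ := fun i j =>
    fderiv ℝ (fderiv ℝ (fderiv ℝ f)) 0 p (coordVec i) (coordVec j) -
      christoffelDeriv g p (coordVec i) (coordVec j) - v1 * K 0 i j - v * fderiv ℝ K 0 p i j with hX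
  -- Rearranged into three sums of the form treated by `sum_delta_sub`; the middle one, with scalar
  -- `0` and the factor `-1`, accounts for `p ⊗ F`.
  have hsplit : ∀ i j, (w1 * (if i = j then 1 else 0) - (F i * p j + p i * F j)) *
      (fderiv ℝ (fderiv ℝ f) 0 (coordVec i) (coordVec j) - v * K 0 i j) +
      (w * (if i = j then 1 else 0) - p i * p j) *
      (fderiv ℝ (fderiv ℝ (fderiv ℝ f)) 0 p (coordVec i) (coordVec j) -
      christoffelDeriv g p (coordVec i) (coordVec j) - (v1 * K 0 i j + v * fderiv ℝ K 0 p i j)) =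
      (w1 * (if i = j then 1 else 0) - F i * p j) * Z i j - (0 * (if i = j then 1 else 0)
        - p i * F j) * (-1 * Z i j) + (w * (if i = j then 1 else 0) - p i * p j) * X i j := by
    intro i j
    simp only [hZ, hX]
    ring
  simp only [hsplit, Finset.sum_add_distrib, Finset.sum_sub_distrib, sum_delta_sub] at heq
  have hnegZ : bilin (fun i j => -1 * Z i j) p F = - bilin Z p F := by
    simp [bilin]
  have hZF : ∀ x y, bilin Z x y = fderiv ℝ (fderiv ℝ f) 0 x y - v * bilin (K 0) x y := by
    intro x y
    rw [hZ, bilin_sub_smul, (isBilin_clm (fderiv ℝ (fderiv ℝ f) 0)).eq_bilin]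
  have hXp : bilin X p p = fderiv ℝ (fderiv ℝ (fderiv ℝ f)) 0 p p p - christoffelDeriv g p p p -
          v1 * bilin (K 0) p p - v * bilin (fderiv ℝ K 0 p) p p := by
    rw [hX, bilin_sub_smul, bilin_sub_smul]
    congr 2
    have := bilin_sub_smul (fun i j => fderiv ℝ (fderiv ℝ (fderiv ℝ f)) 0 p (coordVec i)
      (coordVec j)) (fun i j => christoffelDeriv g p (coordVec i) (coordVec j)) 1 p p
    simp only [one_mul] at this
    rw [this, (isBilin_clm (fderiv ℝ (fderiv ℝ (fderiv ℝ f)) 0 p)).eq_bilin, hBR.eq_bilin]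
  have hsymf : ∀ x y, fderiv ℝ (fderiv ℝ f) 0 x y = fderiv ℝ (fderiv ℝ f) 0 y x :=
    (h.contDiffAt_f.of_le (by norm_num : (2 : WithTop ℕ∞) ≤ 3)).isSymmSndFDerivAt (by simp)
  have hFF : fderiv ℝ (fderiv ℝ f) 0 p F = ‖F‖ ^ 2 := by
    rw [← real_inner_self_eq_norm_sq]
    conv_rhs => rw [hF, inner_dualVec]
    rw [hF]
  have hdf : fderiv ℝ f 0 p = ‖p‖ ^ 2 := by
    rw [← real_inner_self_eq_norm_sq]
    conv_rhs => rw [hp, inner_dualVec]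
    rw [hp]
  have hpa : ∑ i, p i * fderiv ℝ (fderiv ℝ a) 0 p (coordVec i) = fderiv ℝ (fderiv ℝ a) 0 p p :=
    (isBilin_clm (fderiv ℝ (fderiv ℝ a) 0)).sum_right p p
  have hFa : ∑ i, F i * partialDeriv a 0 i = inner ℝ (dualVec (fderiv ℝ a 0)) F := by
    rw [inner_dualVec, fderiv_eq_sum]
    exact Finset.sum_congr rfl fun i _ => by ring
  rw [hnegZ, hZF, hZF, hXp, hsymf F p, hFF, bilin_symm _ h.K_symm p F, hdf, hpa, hFa] at heq
  simp only [hZ, hX, Finset.sum_sub_distrib, ← Finset.mul_sum] at heq ⊢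
  linear_combination heq

end IsJangNormal

end LocalCoords

/-! ### The maximum principle in normal coordinates. -/

namespace LocalCoords

variable {n : ℕ} {g K : Eucl n → Fin n → Fin n → ℝ} {a f : Eucl n → ℝ} {ε : ℝ}

section ThirdDerivative

variable {E : Type*} [NormedAddCommGroup E] [NormedSpace ℝ E] {F : E → ℝ} {y : E}

lemma fderiv_fderiv_fderiv_symm_right (hF : ContDiffAt ℝ 3 F y) (u v w : E) :
    fderiv ℝ (fderiv ℝ (fderiv ℝ F)) y u v w = fderiv ℝ (fderiv ℝ (fderiv ℝ F)) y u w v := by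
  have h4 : DifferentiableAt ℝ (fderiv ℝ (fderiv ℝ F)) y :=
    (((hF.fderiv_right (m := 2) (by norm_num)).fderiv_right
      (m := 1) (by norm_num))).differentiableAt (by norm_num)
  have hl : Filter.Tendsto (fun t : ℝ => y + t • u) (𝓝 0) (𝓝 y) := by
    have : Continuous (fun t : ℝ => y + t • u) := by fun_prop
    simpa using this.tendsto 0
  refine (hasDerivAt_line_apply_apply h4 u v w).unique
    ((hasDerivAt_line_apply_apply h4 u w v).congr_of_eventuallyEq ?_)
  filter_upwards [hl.eventually (hF.eventually (by simp))] with t ht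
  exact (ht.of_le (by norm_num : (2 : WithTop ℕ∞) ≤ 3)).isSymmSndFDerivAt (by simp) v w

/-- This matches the third derivatives in the Hessian of `|df|²` with those in the equation
differentiated along `p`. As partial derivatives commute, curvature enters only through second
derivatives of the metric. -/
lemma fderiv_fderiv_fderiv_rotate (hF : ContDiffAt ℝ 3 F y) (v p : E) :
    fderiv ℝ (fderiv ℝ (fderiv ℝ F)) y v v p = fderiv ℝ (fderiv ℝ (fderiv ℝ F)) y p v v := by
  rw [fderiv_fderiv_fderiv_symm_right hF]
  have h := (hF.fderiv_right (m := 2) (by norm_num)).isSymmSndFDerivAt (by simp) v p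
  rw [h]

end ThirdDerivative

section IsBilin

variable {B B' : Eucl n → Eucl n → ℝ}

lemma _root_.IsBilin.add (h : IsBilin B) (h' : IsBilin B') :
    IsBilin fun x y => B x y + B' x y := by
  constructor <;> intros <;> simp only [h.add_left, h.add_right, h.smul_left, h.smul_right,
    h'.add_left, h'.add_right, h'.smul_left, h'.smul_right] <;> ring

lemma _root_.IsBilin.sub (h : IsBilin B) (h' : IsBilin B') :
    IsBilin fun x y => B x y - B' x y := by
  constructor <;> intros <;> simp only [h.add_left, h.add_right, h.smul_left, h.smul_right,
    h'.add_left, h'.add_right, h'.smul_left, h'.smul_right] <;> ring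

lemma _root_.IsBilin.const_mul (h : IsBilin B) (c : ℝ) : IsBilin fun x y => c * B x y := by
  constructor <;> intros <;> simp only [h.add_left, h.add_right, h.smul_left, h.smul_right] <;> ring

lemma _root_.IsBilin.sum {ι : Type*} [Fintype ι] {B : ι → Eucl n → Eucl n → ℝ}
    (h : ∀ i, IsBilin (B i)) : IsBilin fun x y => ∑ i, B i x y := by
  constructor <;> intros <;> simp only [(h _).add_left, (h _).add_right, (h _).smul_left,
    (h _).smul_right, Finset.sum_add_distrib, Finset.mul_sum]

lemma _root_.isBilin_clm_apply {V : Type*} [NormedAddCommGroup V] [NormedSpace ℝ V]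
    (L : Eucl n →L[ℝ] Eucl n →L[ℝ] V) (l : V →L[ℝ] ℝ) : IsBilin fun x y => l (L x y) := by
  constructor <;> simp

end IsBilin

lemma isBilin_fderiv_fderiv_bilin (g : Eucl n → Fin n → Fin n → ℝ) (p : Eucl n) :
    IsBilin fun x y => bilin (fderiv ℝ (fderiv ℝ g) 0 x y) p p := by
  have hA : ∀ (A B : Fin n → Fin n → ℝ) (v w : Eucl n),
      bilin (A + B) v w = bilin A v w + bilin B v w := by
    intro A B v w
    simp only [bilin, ← Finset.sum_add_distrib]
    exact Finset.sum_congr rfl fun i _ => Finset.sum_congr rfl fun j _ => by simp; ring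
  have hS : ∀ (c : ℝ) (A : Fin n → Fin n → ℝ) (v w : Eucl n),
      bilin (c • A) v w = c * bilin A v w := by
    intro c A v w
    simp only [bilin, Finset.mul_sum]
    exact Finset.sum_congr rfl fun i _ => Finset.sum_congr rfl fun j _ => by simp; ring
  constructor <;> intros <;> simp [hA, hS]

/-- The inequality at a maximum point of `(exp (k (ψ + b f)) - 1)² w`. -/
lemma IsJangNormal.inequality_of_isLocalMax (h : IsJangNormal g K a f ε) {ψ : Eucl n → ℝ}
    (hψ : ContDiffAt ℝ 2 ψ 0) {k b : ℝ} (hk : 0 < k) (hφ0 : 0 < ψ 0 + b * f 0)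
    (hmax : IsLocalMax (fun y => (Real.exp (k * (ψ y + b * f y)) - 1) ^ 2 * slopeSq g a f y) 0)
    {p q α : Eucl n} (hp : p = dualVec (fderiv ℝ f 0)) (hq : q = dualVec (fderiv ℝ ψ 0))
    (hα : α = dualVec (fderiv ℝ a 0)) {w v H : ℝ} (hw : w = slopeSq g a f 0)
    (hv : v = Real.sqrt w)
    (hH : H = ε * f 0 + (∑ i, K 0 i i - bilin (K 0) p p / v ^ 2)) :
    ∃ κ, k ≤ κ ∧
      k * ((‖q‖ ^ 2 + 2 * b * inner ℝ q p + b ^ 2 * ‖p‖ ^ 2) -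
        (inner ℝ q p + b * ‖p‖ ^ 2) ^ 2 / v ^ 2) +
        graphTrace p w (fun x y => fderiv ℝ (fderiv ℝ ψ) 0 x y) + b * v * H +
        b * inner ℝ α p / v ^ 2 - (inner ℝ q p + b * ‖p‖ ^ 2) * H / v +
        2 * ((bilin (K 0) q p + b * bilin (K 0) p p) -
          (inner ℝ q p + b * ‖p‖ ^ 2) * bilin (K 0) p p / v ^ 2) / v +
        2 * ((inner ℝ q α + b * inner ℝ α p) -
          (inner ℝ q p + b * ‖p‖ ^ 2) * inner ℝ α p / v ^ 2) / v ^ 2 +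
        2 * (inner ℝ q p + b * ‖p‖ ^ 2) * inner ℝ α p / v ^ 4 +
        (2 * graphTrace p w (christoffelDeriv g p) +
          2 * v * graphTrace p w (bilin (fderiv ℝ K 0 p)) +
          2 * fderiv ℝ (fderiv ℝ a) 0 p p / v ^ 2 + 2 * bilin (K 0) α p / v +
          graphTrace p w (fun x y => fderiv ℝ (fderiv ℝ a) 0 x y) +
          -graphTrace p w (fun x y => bilin (fderiv ℝ (fderiv ℝ g) 0 x y) p p) +
        2 * ε * v * (v ^ 2 - a 0) + (‖α‖ ^ 2 - inner ℝ α p ^ 2 / v ^ 2) / (2 * v ^ 2)) /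
          (2 * v ^ 2 * κ) ≤ 0 := by
  have hwp : w = a 0 + ‖p‖ ^ 2 := by rw [hw, h.slopeSq_zero, hp]
  have hw0 : 0 < w := by
    rw [hwp]
    have := h.a_pos
    positivity
  have hv0 : 0 < v := by rw [hv]; exact Real.sqrt_pos.2 hw0
  have hvw : v ^ 2 = w := by rw [hv]; exact Real.sq_sqrt hw0.le
  have hfp : ∀ x, fderiv ℝ f 0 x = inner ℝ p x := fun x => by rw [hp, inner_dualVec]
  have hψq : ∀ x, fderiv ℝ ψ 0 x = inner ℝ q x := fun x => by rw [hq, inner_dualVec]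
  have haα : ∀ x, fderiv ℝ a 0 x = inner ℝ α x := fun x => by rw [hα, inner_dualVec]
  have hE : 0 < Real.exp (k * (ψ 0 + b * f 0)) - 1 := by
    have := Real.add_one_lt_exp (show k * (ψ 0 + b * f 0) ≠ 0 by positivity)
    have : 0 < k * (ψ 0 + b * f 0) := by positivity
    linarith
  obtain ⟨κ, hκ⟩ : ∃ κ, κ = k * Real.exp (k * (ψ 0 + b * f 0)) /
    (Real.exp (k * (ψ 0 + b * f 0)) - 1) := ⟨_, rfl⟩
  have hkκ : k ≤ κ := by
    rw [hκ, le_div_iff₀ hE]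
    nlinarith only [hk, hE]
  have hκ0 : 0 < κ := hk.trans_le hkκ
  obtain ⟨d, hd⟩ : ∃ d, d = q + b • p := ⟨_, rfl⟩
  -- The derivative tests on the line in direction `x`. The first is an identity of linear forms in
  -- `x`; the second can be summed over any family of directions.
  have hcond : ∀ x : Eucl n, (inner ℝ α x + 2 * fderiv ℝ (fderiv ℝ f) 0 x p
        = -(2 * w * κ * inner ℝ d x)) ∧
      (fderiv ℝ (fderiv ℝ a) 0 x x - bilin (fderiv ℝ (fderiv ℝ g) 0 x x) p p +
        2 * ∑ i, fderiv ℝ (fderiv ℝ f) 0 x (coordVec i) ^ 2 +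
        2 * fderiv ℝ (fderiv ℝ (fderiv ℝ f)) 0 x x p) ≤
      w * ((6 * κ ^ 2 - 2 * κ * k) * inner ℝ d x ^ 2 -
        2 * κ * (fderiv ℝ (fderiv ℝ ψ) 0 x x + b * fderiv ℝ (fderiv ℝ f) 0 x x)) := by
    intro x
    have j1 := (hψ.hasJet2 x).add ((HasJet2.const b).mul
      ((h.contDiffAt_f.of_le (by norm_num : (2 : WithTop ℕ∞) ≤ 3)).hasJet2 x))
    have hl : Filter.Tendsto (fun t : ℝ => (0 : Eucl n) + t • x) (𝓝 0) (𝓝 0) := by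
      have : Continuous (fun t : ℝ => (0 : Eucl n) + t • x) := by fun_prop
      simpa using this.tendsto 0
    have hm : IsLocalMax (fun t : ℝ => (Real.exp (k * (ψ ((0 : Eucl n) + t • x) +
        b * f ((0 : Eucl n) + t • x))) - 1) ^ 2 * slopeSq g a f ((0 : Eucl n) + t • x)) 0 := by
      have := hl.eventually hmax
      filter_upwards [this] with t ht
      simpa using ht
    obtain ⟨κ', e0, e1, e2⟩ := maximum_conditions j1 (h.jet_slopeSq x) hk hφ0 hm
    rw [← hκ] at e0
    rw [e0, ← hp, ← hw, hψq, hfp, haα] at e1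
    rw [e0, ← hp, ← hw, hψq, hfp] at e2
    have hdx : inner ℝ d x = inner ℝ q x + b * inner ℝ p x := by
      rw [hd, inner_add_left, real_inner_smul_left]
    rw [hdx]
    constructor
    · linear_combination e1
    · refine e2.trans (le_of_eq ?_)
      ring
  have hsymf : ∀ x y, fderiv ℝ (fderiv ℝ f) 0 x y = fderiv ℝ (fderiv ℝ f) 0 y x :=
    (h.contDiffAt_f.of_le (by norm_num : (2 : WithTop ℕ∞) ≤ 3)).isSymmSndFDerivAt (by simp)
  obtain ⟨F, hF⟩ : ∃ F, F = dualVec (fderiv ℝ (fderiv ℝ f) 0 p) := ⟨_, rfl⟩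
  have hFx : ∀ x, fderiv ℝ (fderiv ℝ f) 0 p x = inner ℝ F x := fun x => by rw [hF, inner_dualVec]
  -- The first-order condition in all directions determines `Hess f (p, ·)` completely.
  have hFd : F = -(w * κ) • d + (-(1 / 2) : ℝ) • α := by
    refine ext_inner_right ℝ fun x => ?_
    rw [← hFx, hsymf, inner_add_left, real_inner_smul_left, real_inner_smul_left]
    linear_combination (1 / 2) * (hcond x).1
  have hFF : ‖F‖ ^ 2 = v ^ 4 * κ ^ 2 * ‖d‖ ^ 2 + v ^ 2 * κ * inner ℝ d α + ‖α‖ ^ 2 / 4 := by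
    rw [← real_inner_self_eq_norm_sq, ← real_inner_self_eq_norm_sq, ← real_inner_self_eq_norm_sq,
      hFd]
    simp only [inner_add_left, inner_add_right, real_inner_smul_left, real_inner_smul_right,
      real_inner_comm d α, ← hvw]
    ring
  have hFpp : fderiv ℝ (fderiv ℝ f) 0 p p = -(v ^ 2 * κ * inner ℝ d p) - inner ℝ α p / 2 := by
    rw [hFx, hFd, inner_add_left, real_inner_smul_left, real_inner_smul_left, hvw]
    ring
  have hw1 : -(2 * w * κ * inner ℝ d p) =
      fderiv ℝ a 0 p + 2 * fderiv ℝ (fderiv ℝ f) 0 p p := by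
    rw [haα, (hcond p).1]
  have hv1 : -(v * κ * inner ℝ d p) = -(2 * w * κ * inner ℝ d p) / (2 * v) := by
    rw [← hvw]
    field_simp
  have E0 := h.equation_zero hp hw
  have E1 := h.equation_deriv hp hw hv hw1 hv1 hF
  have hKF : bilin (K 0) F p = -(v ^ 2 * κ * bilin (K 0) d p) - bilin (K 0) α p / 2 := by
    rw [hFd, bilin_add_left, bilin_smul_left, bilin_smul_left, hvw]
    ring
  have hαF : inner ℝ α F = -(v ^ 2 * κ * inner ℝ d α) - ‖α‖ ^ 2 / 2 := by
    rw [hFd, inner_add_right, real_inner_smul_right, real_inner_smul_right,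
      real_inner_self_eq_norm_sq, real_inner_comm, hvw]
    ring
  have hS := graph_normSq_nonneg h.a_pos hwp (isBilin_clm (fderiv ℝ (fderiv ℝ f) 0)) hsymf
  have hsumF : ∑ i, fderiv ℝ (fderiv ℝ f) 0 p (coordVec i) ^ 2 = ‖F‖ ^ 2 := by
    rw [EuclideanSpace.norm_sq_eq]
    refine Finset.sum_congr rfl fun i _ => ?_
    rw [Real.norm_eq_abs, sq_abs, hF]
    rfl
  have hsumF' : ∑ i, fderiv ℝ (fderiv ℝ f) 0 (coordVec i) p ^ 2 = ‖F‖ ^ 2 := by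
    rw [← hsumF]
    exact Finset.sum_congr rfl fun i _ => by rw [hsymf]
  simp only [hsumF'] at hS
  have hBL : IsBilin fun x y => fderiv ℝ (fderiv ℝ a) 0 x y -
      bilin (fderiv ℝ (fderiv ℝ g) 0 x y) p p +
        2 * ∑ i, fderiv ℝ (fderiv ℝ f) 0 x (coordVec i) * fderiv ℝ (fderiv ℝ f) 0 y (coordVec i) +
        2 * fderiv ℝ (fderiv ℝ (fderiv ℝ f)) 0 x y p := by
    refine IsBilin.add (IsBilin.add (IsBilin.sub (isBilin_clm _) (isBilin_fderiv_fderiv_bilin g p))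
      (IsBilin.const_mul (IsBilin.sum fun i => ?_) 2)) (IsBilin.const_mul ?_ 2)
    · constructor <;> intros <;> simp <;> ring
    · exact isBilin_clm_apply (fderiv ℝ (fderiv ℝ (fderiv ℝ f)) 0)
        (ContinuousLinearMap.apply ℝ ℝ p)
  have hBR : IsBilin fun x y => w * ((6 * κ ^ 2 - 2 * κ * k) * (inner ℝ d x * inner ℝ d y) -
        2 * κ * (fderiv ℝ (fderiv ℝ ψ) 0 x y + b * fderiv ℝ (fderiv ℝ f) 0 x y)) := by
    constructor <;> intros <;> simp [inner_add_right, real_inner_smul_right] <;> ring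
  -- Summation over the graph frame takes the trace with the principal part of the equation, so the
  -- third derivatives appear in the combination that `E1` controls.
  have hM := Finset.sum_le_sum fun k (_ : k ∈ Finset.univ) => (hcond (graphFrame p w (a 0) k)).2
  simp only [sq (fderiv ℝ (fderiv ℝ f) 0 _ _), sq (inner ℝ d _)] at hM
  rw [sum_graphFrame h.a_pos hwp hBL, sum_graphFrame h.a_pos hwp hBR] at hM
  simp only [graphTrace, Finset.sum_add_distrib, Finset.sum_sub_distrib, ← Finset.mul_sum,
    ← sq (inner ℝ d _), ← sq (fderiv ℝ (fderiv ℝ f) 0 _ _), hsumF,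
    fderiv_fderiv_fderiv_rotate h.contDiffAt_f _ p] at hM
  have hsumd : ∑ i, inner ℝ d (coordVec i) ^ 2 = ‖d‖ ^ 2 := by
    rw [EuclideanSpace.norm_sq_eq]
    refine Finset.sum_congr rfl fun i _ => ?_
    rw [Real.norm_eq_abs, sq_abs, coordVec, EuclideanSpace.inner_single_right]
    simp
  rw [hsumd] at hM
  have hdd : ‖d‖ ^ 2 = ‖q‖ ^ 2 + 2 * b * inner ℝ q p + b ^ 2 * ‖p‖ ^ 2 := by
    rw [hd, ← real_inner_self_eq_norm_sq, ← real_inner_self_eq_norm_sq,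
      ← real_inner_self_eq_norm_sq]
    simp only [inner_add_left, inner_add_right, real_inner_smul_left, real_inner_smul_right,
      real_inner_comm q p]
    ring
  have hdp : inner ℝ d p = inner ℝ q p + b * ‖p‖ ^ 2 := by
    rw [hd, inner_add_left, real_inner_smul_left, real_inner_self_eq_norm_sq]
  have hdα : inner ℝ d α = inner ℝ q α + b * inner ℝ α p := by
    rw [hd, inner_add_left, real_inner_smul_left, real_inner_comm p α]
  have hKd : bilin (K 0) d p = bilin (K 0) q p + b * bilin (K 0) p p := by
    rw [hd, bilin_add_left, bilin_smul_left]
  refine ⟨κ, hkκ, ?_⟩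
  rw [← hdd, ← hdp, ← hdα, ← hKd]
  refine jang_maximum_inequality (trF := ∑ i, fderiv ℝ (fderiv ℝ f) 0 (coordVec i) (coordVec i))
    (trT := ∑ i, fderiv ℝ (fderiv ℝ (fderiv ℝ f)) 0 p (coordVec i) (coordVec i))
    (Tpp := fderiv ℝ (fderiv ℝ (fderiv ℝ f)) 0 p p p)
    (trX := ∑ i, (fderiv ℝ (fderiv ℝ (fderiv ℝ f)) 0 p (coordVec i) (coordVec i) -
          christoffelDeriv g p (coordVec i) (coordVec i) - -(v * κ * inner ℝ d p) * K 0 i i -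
          v * fderiv ℝ K 0 p i i))
    (Xpp := (fderiv ℝ (fderiv ℝ (fderiv ℝ f)) 0 p p p - christoffelDeriv g p p p -
          -(v * κ * inner ℝ d p) * bilin (K 0) p p - v * bilin (fderiv ℝ K 0 p) p p))
    (trFF := ∑ i, ∑ j, fderiv ℝ (fderiv ℝ f) 0 (coordVec i) (coordVec j) ^ 2)
    hv0 hκ0 hFpp hH ?_ ?_ ?_ ?_ ?_
  · rw [← haα, hvw]
    rw [← hv] at E0
    exact E0
  · simp only [graphTrace, Finset.sum_sub_distrib, ← Finset.mul_sum, bilin_coordVec, hvw]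
    ring
  · rw [← hFF, ← hKF, ← hαF]
    rw [hwp] at hvw
    have hpp : ‖p‖ ^ 2 = v ^ 2 - a 0 := by linarith only [hvw]
    rw [hpp] at E1
    rw [hwp, ← hvw] at E1
    rw [← hα] at E1
    linear_combination E1
  · rw [← hFF, hvw]
    have : v ^ 4 = w ^ 2 := by rw [← hvw]; ring
    rw [this]
    exact hS
  · rw [← hFF, hvw]
    simp only [graphTrace]
    have e1 : ∀ {x y x' y' : ℝ}, x ≤ y → x = x' → y = y' → x' ≤ y' := by
      intro x y x' y' h1 h2 h3
      rwa [← h2, ← h3]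
    refine e1 hM ?_ ?_
    · ring
    · ring

lemma abs_bilin_le_of_le {A : Fin n → Fin n → ℝ} {M : ℝ} (hA : ‖A‖ ≤ M) (x y : Eucl n) :
    |bilin A x y| ≤ (n : ℝ) ^ 2 * M * ‖x‖ * ‖y‖ := by
  refine (abs_bilin_le A x y).trans ?_
  gcongr

lemma abs_apply_apply_le {V : Type*} [NormedAddCommGroup V] [NormedSpace ℝ V]
    {L : Eucl n →L[ℝ] Eucl n →L[ℝ] V} {M : ℝ} (hL : ‖L‖ ≤ M) (x y : Eucl n) :
    ‖L x y‖ ≤ M * ‖x‖ * ‖y‖ := by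
  refine (L.le_opNorm₂ x y).trans ?_
  gcongr

/-- The gradient bound at a maximum point in normal coordinates. -/
theorem exists_slope_bound_of_isLocalMax (n : ℕ) {M lam b : ℝ} (hM : 1 ≤ M) (hlam : 0 < lam)
    (hb : 0 < b) :
    ∃ k : ℝ, 1 ≤ k ∧ ∃ V : ℝ, ∀ (g K : Eucl n → Fin n → Fin n → ℝ) (a f ψ : Eucl n → ℝ) (ε : ℝ),
      IsJangNormal g K a f ε → ContDiffAt ℝ 2 ψ 0 → 0 ≤ ε → lam ≤ a 0 → a 0 ≤ M →
      ‖fderiv ℝ a 0‖ ≤ M → ‖fderiv ℝ (fderiv ℝ a) 0‖ ≤ M → ‖fderiv ℝ ψ 0‖ ≤ M →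
      ‖fderiv ℝ (fderiv ℝ ψ) 0‖ ≤ M → ‖K 0‖ ≤ M → ‖fderiv ℝ K 0‖ ≤ M →
      ‖fderiv ℝ (fderiv ℝ g) 0‖ ≤ M → |ε * f 0| ≤ M → 0 < ψ 0 + b * f 0 →
      IsLocalMax (fun y => (Real.exp (k * (ψ y + b * f y)) - 1) ^ 2 * slopeSq g a f y) 0 →
      Real.sqrt (slopeSq g a f 0) ≤ V := by
  -- A single bound for all scalars in the inequality: `n ^ 2` comes from bilinear forms, `n + 1`
  -- from graph traces, `2` from the Christoffel terms and `M ^ 2` from products of two bounded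
  -- quantities.
  obtain ⟨M', hM'⟩ : ∃ M' : ℝ, M' = 2 * (n + 1) * ((n : ℝ) ^ 2 + 1) * M ^ 2 := ⟨_, rfl⟩
  have hM0 : 0 < M := by linarith
  have hn : (0 : ℝ) ≤ n := Nat.cast_nonneg n
  have hn2 : (0 : ℝ) ≤ n ^ 2 := by positivity
  have hn3 : (0 : ℝ) ≤ n * n ^ 2 := by positivity
  have hMM : M ≤ M ^ 2 := by nlinarith only [hM]
  have hA : ∀ c : ℝ, c ≤ 2 * (n + 1) * ((n : ℝ) ^ 2 + 1) → c * M ^ 2 ≤ M' := by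
    intro c hc
    rw [hM']
    gcongr
  have hA1 : ∀ c : ℝ, 0 ≤ c → c ≤ 2 * (n + 1) * ((n : ℝ) ^ 2 + 1) → c * M ≤ M' := by
    intro c hc0 hc
    refine le_trans ?_ (hA c hc)
    gcongr
  have hM1 : 1 ≤ M' := by
    have h1 := hA 1 (by linarith only [hn, hn2, hn3])
    linarith only [h1, hMM, hM]
  obtain ⟨k, hk1, hk⟩ := jang_gradient_bound_of_inequality hM1 hlam hb
  refine ⟨k, hk1, 2 * M' * (b + 2) / b, ?_⟩
  intro g K a f ψ ε h hψ hε hla haM ha1 ha2 hψ1 hψ2 hK0 hK1 hg2 he hφ hmax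
  obtain ⟨p, hp⟩ : ∃ p, p = dualVec (fderiv ℝ f 0) := ⟨_, rfl⟩
  obtain ⟨q, hq⟩ : ∃ q, q = dualVec (fderiv ℝ ψ 0) := ⟨_, rfl⟩
  obtain ⟨α, hα⟩ : ∃ α, α = dualVec (fderiv ℝ a 0) := ⟨_, rfl⟩
  obtain ⟨w, hw⟩ : ∃ w, w = slopeSq g a f 0 := ⟨_, rfl⟩
  obtain ⟨v, hv⟩ : ∃ v, v = Real.sqrt w := ⟨_, rfl⟩
  rw [← hw, ← hv]
  obtain ⟨κ, hκ, hineq⟩ := h.inequality_of_isLocalMax hψ (by linarith) hφ hmax hp hq hα hw hv rfl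
  have hwp : w = a 0 + ‖p‖ ^ 2 := by rw [hw, h.slopeSq_zero, hp]
  have hw0 : 0 < w := by
    rw [hwp]
    have := h.a_pos
    positivity
  have hv0 : 0 < v := by rw [hv]; exact Real.sqrt_pos.2 hw0
  have hvw : v ^ 2 = w := by rw [hv]; exact Real.sq_sqrt hw0.le
  have hpw : ‖p‖ ^ 2 ≤ w := by
    rw [hwp]
    have := h.a_pos
    linarith
  have hpv : ‖p‖ ≤ v := by
    rw [hv]
    exact Real.le_sqrt_of_sq_le hpw
  have hqM : ‖q‖ ≤ M := by rw [hq]; exact (norm_dualVec_le _).trans hψ1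
  have hαM : ‖α‖ ≤ M := by rw [hα]; exact (norm_dualVec_le _).trans ha1
  have hMM' : M ≤ M' := by
    have := hA1 1 zero_le_one (by linarith only [hn, hn2, hn3])
    linarith only [this]
  have hM2 : M ^ 2 ≤ M' := by
    have := hA 1 (by linarith only [hn, hn2, hn3])
    linarith only [this]
  have hn2M : (n : ℝ) ^ 2 * M ≤ M' := hA1 _ hn2 (by linarith only [hn, hn2, hn3])
  have hn2M2 : (n : ℝ) ^ 2 * M ^ 2 ≤ M' := hA _ (by linarith only [hn, hn2, hn3])
  have hnM : (n : ℝ) * M ≤ M' := hA1 _ hn (by linarith only [hn, hn2, hn3])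
  have hn1M : ((n : ℝ) + 1) * M ≤ M' := hA1 _ (by positivity) (by linarith only [hn, hn2, hn3])
  have hn3M : ((n : ℝ) + 1) * (n ^ 2 * M) ≤ M' := by
    have := hA1 ((n + 1) * n ^ 2) (by positivity) (by linarith only [hn, hn2, hn3])
    linarith only [this]
  have hn4M : ((n : ℝ) + 1) * (2 * n ^ 2 * M) ≤ M' := by
    have := hA1 ((n + 1) * (2 * n ^ 2)) (by positivity) (by linarith only [hn, hn2, hn3])
    linarith only [this]
  have tr : ∀ {B : Eucl n → Eucl n → ℝ} {C : ℝ}, 0 ≤ C → (∀ x y, |B x y| ≤ C * ‖x‖ * ‖y‖) →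
      |graphTrace p w B| ≤ (n + 1) * C := fun hC hB => abs_graphTrace_le hC hw0 hpw hB
  have hg2' : ∀ x y, ‖fderiv ℝ (fderiv ℝ g) 0 x y‖ ≤ M * ‖x‖ * ‖y‖ :=
    fun x y => abs_apply_apply_le hg2 x y
  have hgb : ∀ x y z t, |bilin (fderiv ℝ (fderiv ℝ g) 0 x y) z t| ≤
      (n : ℝ) ^ 2 * M * ‖x‖ * ‖y‖ * ‖z‖ * ‖t‖ := by
    intro x y z t
    refine (abs_bilin_le_of_le (hg2' x y) z t).trans (le_of_eq ?_)
    ring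
  refine hk v (a 0) κ ε _ (ε * f 0) (‖q‖ ^ 2) (inner ℝ q p) (inner ℝ q α) (‖α‖ ^ 2) (inner ℝ α p)
    (∑ i, K 0 i i) (bilin (K 0) q p) (bilin (K 0) α p) (bilin (K 0) p p) _ _ _ _ _ _ (‖p‖ ^ 2) hv0
    (by rw [hvw, hwp]) (by positivity) hκ hε hla (haM.trans hMM') ?_ ?_ ?_ ?_ ?_ ?_
    (he.trans hMM') ?_ ?_ ?_ ?_ ?_ ?_ ?_ (by positivity) (by positivity) ?_ ?_ rfl hineq
  · calc |inner ℝ q p| ≤ ‖q‖ * ‖p‖ := abs_real_inner_le_norm q p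
      _ ≤ M' * v := by gcongr; exact hqM.trans hMM'
  · calc |inner ℝ α p| ≤ ‖α‖ * ‖p‖ := abs_real_inner_le_norm α p
      _ ≤ M' * v := by gcongr; exact hαM.trans hMM'
  · calc |inner ℝ q α| ≤ ‖q‖ * ‖α‖ := abs_real_inner_le_norm q α
      _ ≤ M * M := by gcongr
      _ ≤ M' := by linarith [sq M]
  · calc |bilin (K 0) p p| ≤ (n : ℝ) ^ 2 * M * ‖p‖ * ‖p‖ := abs_bilin_le_of_le hK0 p p
      _ ≤ (n : ℝ) ^ 2 * M * v * v := by gcongr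
      _ = (n : ℝ) ^ 2 * M * v ^ 2 := by ring
      _ ≤ M' * v ^ 2 := by gcongr
  · calc |bilin (K 0) q p| ≤ (n : ℝ) ^ 2 * M * ‖q‖ * ‖p‖ := abs_bilin_le_of_le hK0 q p
      _ ≤ (n : ℝ) ^ 2 * M * M * v := by gcongr
      _ = (n : ℝ) ^ 2 * M ^ 2 * v := by ring
      _ ≤ M' * v := by gcongr
  · calc |bilin (K 0) α p| ≤ (n : ℝ) ^ 2 * M * ‖α‖ * ‖p‖ := abs_bilin_le_of_le hK0 α p
      _ ≤ (n : ℝ) ^ 2 * M * M * v := by gcongr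
      _ = (n : ℝ) ^ 2 * M ^ 2 * v := by ring
      _ ≤ M' * v := by gcongr
  · calc |∑ i, K 0 i i| ≤ ∑ i : Fin n, M := (Finset.abs_sum_le_sum_abs _ _).trans
          (Finset.sum_le_sum fun i _ => (abs_entry_le_norm (K 0) i i).trans hK0)
      _ = n * M := by simp
      _ ≤ M' := hnM
  · exact (tr hM0.le fun x y => abs_apply_apply_le hψ2 x y).trans hn1M
  · refine (tr (C := 2 * n ^ 2 * M * v ^ 2) (by positivity) fun x y => ?_).trans ?_
    · have h1 := hgb p x y p
      have h2 := hgb p y x p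
      have h3 := hgb p p x y
      have h4 : (n : ℝ) ^ 2 * M * ‖p‖ ^ 2 * ‖x‖ * ‖y‖ ≤ n ^ 2 * M * v ^ 2 * ‖x‖ * ‖y‖ := by gcongr
      rw [christoffelDeriv, abs_le]
      rw [abs_le] at h1 h2 h3
      have h5 : 0 ≤ (n : ℝ) ^ 2 * M * v ^ 2 * ‖x‖ * ‖y‖ := by positivity
      constructor <;> linarith only [h1.1, h1.2, h2.1, h2.2, h3.1, h3.2, h4, h5]
    · calc ((n : ℝ) + 1) * (2 * n ^ 2 * M * v ^ 2) = (n + 1) * (2 * n ^ 2 * M) * v ^ 2 := by ring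
        _ ≤ M' * v ^ 2 := by gcongr
  · have hK2 : ‖fderiv ℝ K 0 p‖ ≤ M * v := by
      refine ((fderiv ℝ K 0).le_opNorm p).trans ?_
      gcongr
    refine (tr (C := n ^ 2 * (M * v)) (by positivity) fun x y =>
      abs_bilin_le_of_le hK2 x y).trans ?_
    calc ((n : ℝ) + 1) * (n ^ 2 * (M * v)) = (n + 1) * (n ^ 2 * M) * v := by ring
        _ ≤ M' * v := by gcongr
  · calc |fderiv ℝ (fderiv ℝ a) 0 p p| ≤ M * ‖p‖ * ‖p‖ := abs_apply_apply_le ha2 p p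
      _ ≤ M' * v * v := by gcongr
      _ = M' * v ^ 2 := by ring
  · exact (tr hM0.le fun x y => abs_apply_apply_le ha2 x y).trans hn1M
  · rw [abs_neg]
    refine (tr (C := n ^ 2 * M * v ^ 2) (by positivity) fun x y => ?_).trans ?_
    · refine (hgb x y p p).trans ?_
      have h4 : (n : ℝ) ^ 2 * M * ‖p‖ ^ 2 * ‖x‖ * ‖y‖ ≤ n ^ 2 * M * v ^ 2 * ‖x‖ * ‖y‖ := by gcongr
      linarith only [h4]
    · calc ((n : ℝ) + 1) * (n ^ 2 * M * v ^ 2) = (n + 1) * (n ^ 2 * M) * v ^ 2 := by ring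
        _ ≤ M' * v ^ 2 := by gcongr
  · have := abs_real_inner_le_norm q p
    calc inner ℝ q p ^ 2 = |inner ℝ q p| ^ 2 := (sq_abs _).symm
      _ ≤ (‖q‖ * ‖p‖) ^ 2 := by gcongr
      _ = ‖p‖ ^ 2 * ‖q‖ ^ 2 := by ring
  · have := abs_real_inner_le_norm α p
    calc inner ℝ α p ^ 2 = |inner ℝ α p| ^ 2 := (sq_abs _).symm
      _ ≤ (‖α‖ * ‖p‖) ^ 2 := by gcongr
      _ = ‖p‖ ^ 2 * ‖α‖ ^ 2 := by ring

end LocalCoords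

/-! ### Bounds for jets -/

section JetBound

variable {D E V W : Type*} [NormedAddCommGroup D] [NormedSpace ℝ D] [NormedAddCommGroup E]
  [NormedSpace ℝ E] [NormedAddCommGroup V] [NormedSpace ℝ V] [NormedAddCommGroup W]
  [NormedSpace ℝ W]

/-- `F` is `C^k` at `y`, and its derivatives of order up to `k` at `y` are bounded by `C`. -/
structure JetBound (k : ℕ) (C : ℝ) (F : E → V) (y : E) : Prop where
  contDiffAt : ContDiffAt ℝ k F y
  bound : ∀ j ≤ k, ‖iteratedFDeriv ℝ j F y‖ ≤ C

namespace JetBound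

variable {k : ℕ} {C C' : ℝ} {F : E → V} {y : E}

lemma nonneg (h : JetBound k C F y) : 0 ≤ C := (norm_nonneg _).trans (h.bound 0 (Nat.zero_le k))

lemma mono (h : JetBound k C F y) (hC : C ≤ C') : JetBound k C' F y :=
  ⟨h.contDiffAt, fun j hj => (h.bound j hj).trans hC⟩

lemma of_le (h : JetBound k C F y) {l : ℕ} (hl : l ≤ k) : JetBound l C F y :=
  ⟨h.contDiffAt.of_le (by exact_mod_cast hl), fun j hj => h.bound j (hj.trans hl)⟩

lemma congr {G : E → V} (h : JetBound k C F y) (hFG : F =ᶠ[𝓝 y] G) : JetBound k C G y :=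
  ⟨h.contDiffAt.congr_of_eventuallyEq hFG.symm, fun j hj => by
    rw [← (hFG.iteratedFDeriv ℝ j).self_of_nhds]; exact h.bound j hj⟩

lemma norm_le (h : JetBound k C F y) : ‖F y‖ ≤ C := by
  simpa using h.bound 0 (Nat.zero_le k)

lemma norm_fderiv_le (h : JetBound k C F y) (hk : 1 ≤ k) : ‖fderiv ℝ F y‖ ≤ C := by
  rw [← norm_iteratedFDeriv_one]
  exact h.bound 1 hk

lemma norm_fderiv_fderiv_le (h : JetBound k C F y) (hk : 2 ≤ k) :
    ‖fderiv ℝ (fderiv ℝ F) y‖ ≤ C := by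
  rw [← norm_iteratedFDeriv_one, norm_iteratedFDeriv_fderiv]
  exact h.bound 2 hk

lemma of_norm_le_two (h : ContDiffAt ℝ 2 F y) (h0 : ‖F y‖ ≤ C) (h1 : ‖fderiv ℝ F y‖ ≤ C)
    (h2 : ‖fderiv ℝ (fderiv ℝ F) y‖ ≤ C) : JetBound 2 C F y := by
  refine ⟨h, fun j hj => ?_⟩
  interval_cases j
  · simpa using h0
  · rwa [norm_iteratedFDeriv_one]
  · rwa [← norm_iteratedFDeriv_fderiv, norm_iteratedFDeriv_one]

lemma const (c : V) (k : ℕ) (y : E) : JetBound k ‖c‖ (fun _ : E => c) y := by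
  refine ⟨contDiffAt_const, fun j _ => ?_⟩
  rcases Nat.eq_zero_or_pos j with rfl | hj
  · simp
  · rw [iteratedFDeriv_const_of_ne hj.ne']
    simp

lemma add {G : E → V} (hF : JetBound k C F y) (hG : JetBound k C' G y) :
    JetBound k (C + C') (fun z => F z + G z) y := by
  refine ⟨hF.contDiffAt.add hG.contDiffAt, fun j hj => ?_⟩
  have hj' : ((j : ℕ) : WithTop ℕ∞) ≤ k := by exact_mod_cast hj
  rw [fun_iteratedFDeriv_add_apply (hF.contDiffAt.of_le hj') (hG.contDiffAt.of_le hj')]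
  exact (norm_add_le _ _).trans (add_le_add (hF.bound j hj) (hG.bound j hj))

lemma sum {ι : Type*} [Fintype ι] {F : ι → E → V} (h : ∀ i, JetBound k C (F i) y) :
    JetBound k (Fintype.card ι * C) (fun z => ∑ i, F i z) y := by
  classical
  have : ∀ s : Finset ι, JetBound k (s.card * C) (fun z => ∑ i ∈ s, F i z) y := by
    intro s
    induction s using Finset.induction_on with
    | empty => simpa using const (0 : V) k y
    | insert i s hi ih =>
      simp only [Finset.sum_insert hi, Finset.card_insert_of_notMem hi]
      refine ((h i).add ih).mono (le_of_eq ?_)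
      push_cast
      ring
  exact this Finset.univ

lemma clm_comp (hF : JetBound k C F y) (L : V →L[ℝ] W) : JetBound k (‖L‖ * C) (fun z => L (F z)) y :=
  ⟨L.contDiff.contDiffAt.comp y hF.contDiffAt, fun j hj =>
    (L.norm_iteratedFDeriv_comp_left hF.contDiffAt (by exact_mod_cast hj)).trans
      (mul_le_mul_of_nonneg_left (hF.bound j hj) (norm_nonneg L))⟩

lemma apply {ι : Type*} [Fintype ι] {F : E → ι → V} (hF : JetBound k C F y) (i : ι) :
    JetBound k C (fun z => F z i) y := by
  refine (hF.clm_comp (ContinuousLinearMap.proj (R := ℝ) (φ := fun _ : ι => V) i)).mono ?_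
  refine mul_le_of_le_one_left hF.nonneg ?_
  refine ContinuousLinearMap.opNorm_le_bound _ zero_le_one fun v => ?_
  rw [one_mul]
  exact norm_le_pi_norm v i

lemma pi {ι : Type*} [Fintype ι] {F : E → ι → V} (hC : 0 ≤ C)
    (h : ∀ i, JetBound k C (fun z => F z i) y) : JetBound k C F y := by
  have hF : ContDiffAt ℝ k F y := contDiffAt_pi.2 fun i => (h i).contDiffAt
  refine ⟨hF, fun j hj => ContinuousMultilinearMap.opNorm_le_bound hC fun v => ?_⟩
  refine (pi_norm_le_iff_of_nonneg (by positivity)).2 fun i => ?_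
  have h1 : iteratedFDeriv ℝ j F y v i = iteratedFDeriv ℝ j (fun z => F z i) y v := by
    have := (ContinuousLinearMap.proj (R := ℝ) (φ := fun _ : ι => V) i).iteratedFDeriv_comp_left
      hF (i := j) (by exact_mod_cast hj)
    change _ = iteratedFDeriv ℝ j
      ((ContinuousLinearMap.proj (R := ℝ) (φ := fun _ : ι => V) i) ∘ F) y v
    rw [this]
    rfl
  rw [h1]
  exact ((iteratedFDeriv ℝ j (fun z => F z i) y).le_opNorm v).trans (by
    gcongr; exact (h i).bound j hj)

lemma exists_contDiffOn (h : ContDiffAt ℝ k F y) : ∃ U, IsOpen U ∧ y ∈ U ∧ ContDiffOn ℝ k F U := by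
  obtain ⟨U, hU, hF⟩ := h.contDiffOn le_rfl (by simp)
  exact ⟨interior U, isOpen_interior, mem_interior_iff_mem_nhds.2 hU, hF.mono interior_subset⟩

/-- By the Leibniz rule; the binomial coefficients of order `j ≤ k` sum to `2 ^ j`. -/
lemma mul {F G : E → ℝ} (hF : JetBound k C F y) (hG : JetBound k C' G y) :
    JetBound k (2 ^ k * C * C') (fun z => F z * G z) y := by
  refine ⟨hF.contDiffAt.mul hG.contDiffAt, fun j hj => ?_⟩
  obtain ⟨U, hU, hyU, hFU⟩ := exists_contDiffOn hF.contDiffAt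
  obtain ⟨U', hU', hyU', hGU⟩ := exists_contDiffOn hG.contDiffAt
  have hUU : IsOpen (U ∩ U') := hU.inter hU'
  have hy : y ∈ U ∩ U' := ⟨hyU, hyU'⟩
  have h1 := norm_iteratedFDerivWithin_mul_le (hFU.mono inter_subset_left)
    (hGU.mono inter_subset_right) hUU.uniqueDiffOn hy (n := j) (by exact_mod_cast hj)
  simp only [iteratedFDerivWithin_of_isOpen _ hUU hy] at h1
  refine h1.trans ?_
  have hC := hF.nonneg
  have hC' := hG.nonneg
  calc ∑ i ∈ Finset.range (j + 1), (j.choose i : ℝ) * ‖iteratedFDeriv ℝ i F y‖ *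
        ‖iteratedFDeriv ℝ (j - i) G y‖ ≤ ∑ i ∈ Finset.range (j + 1), (j.choose i : ℝ) * C * C' := by
        refine Finset.sum_le_sum fun i hi => ?_
        have hi' : i ≤ j := Nat.lt_succ_iff.1 (Finset.mem_range.1 hi)
        gcongr
        · exact hF.bound i (hi'.trans hj)
        · exact hG.bound _ ((Nat.sub_le j i).trans hj)
    _ = 2 ^ j * C * C' := by
        rw [← Finset.sum_mul, ← Finset.sum_mul]
        congr 2
        exact_mod_cast Nat.sum_range_choose j
    _ ≤ 2 ^ k * C * C' := by
        gcongr
        norm_num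

/-- By the Faà di Bruno estimate, which wants the derivative of order `i` of `σ` bounded by `B ^ i`;
since `1 ≤ B`, one bound `B` serves for all orders. The value of `σ` is not bounded, as it plays no
role. -/
lemma comp {σ : D → E} {x : D} {B : ℝ} (hF : JetBound k C F (σ x)) (hσ : ContDiffAt ℝ k σ x)
    (hB : 1 ≤ B) (hσB : ∀ j, 1 ≤ j → j ≤ k → ‖iteratedFDeriv ℝ j σ x‖ ≤ B) :
    JetBound k (k.factorial * C * B ^ k) (fun z => F (σ z)) x := by
  refine ⟨hF.contDiffAt.comp x hσ, fun j hj => ?_⟩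
  obtain ⟨U, hU, hyU, hFU⟩ := exists_contDiffOn hF.contDiffAt
  obtain ⟨U', hU', hyU', hσU⟩ := exists_contDiffOn hσ
  have hO : IsOpen (U' ∩ σ ⁻¹' U) := hσU.continuousOn.isOpen_inter_preimage hU' hU
  have hx : x ∈ U' ∩ σ ⁻¹' U := ⟨hyU', hyU⟩
  have hC := hF.nonneg
  have h1 := norm_iteratedFDerivWithin_comp_le (n := j) (C := C) (D := B) hFU
    (hσU.mono inter_subset_left) (by exact_mod_cast hj) hU.uniqueDiffOn hO.uniqueDiffOn
    (fun z hz => hz.2) hx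
    (fun i hi => by
      rw [iteratedFDerivWithin_of_isOpen _ hU hyU]
      exact hF.bound i (hi.trans hj))
    (fun i hi1 hi => by
      rw [iteratedFDerivWithin_of_isOpen _ hO hx]
      exact (hσB i hi1 (hi.trans hj)).trans (le_self_pow₀ hB (by omega)))
  rw [iteratedFDerivWithin_of_isOpen _ hO hx] at h1
  refine h1.trans ?_
  have : (j.factorial : ℝ) ≤ k.factorial := by exact_mod_cast Nat.factorial_le hj
  have : B ^ j ≤ B ^ k := pow_le_pow_right₀ hB hj
  gcongr

lemma exists_of_isCompact {U S : Set E} (hU : IsOpen U) (hF : ContDiffOn ℝ k F U)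
    (hS : IsCompact S) (hSU : S ⊆ U) : ∃ C, ∀ y ∈ S, JetBound k C F y := by
  have h1 : ∀ j ≤ k, ∃ C, ∀ y ∈ S, ‖iteratedFDeriv ℝ j F y‖ ≤ C := by
    intro j hj
    have h2 := (hF.continuousOn_iteratedFDerivWithin (m := j) (by exact_mod_cast hj)
      hU.uniqueDiffOn).mono hSU
    obtain ⟨C, hC⟩ := hS.exists_bound_of_continuousOn h2
    exact ⟨C, fun y hy => by
      rw [← iteratedFDerivWithin_of_isOpen _ hU (hSU hy)]; exact hC y hy⟩
  choose! C hC using h1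
  refine ⟨∑ j ∈ Finset.range (k + 1), |C j|, fun y hy =>
    ⟨hF.contDiffAt (hU.mem_nhds (hSU hy)), fun j hj => ?_⟩⟩
  exact (hC j hj y hy).trans ((le_abs_self _).trans (Finset.single_le_sum
    (f := fun j => |C j|) (fun i _ => abs_nonneg _) (Finset.mem_range.2 (Nat.lt_succ_of_le hj))))

end JetBound

end JetBound

/-! ### Normal coordinates -/

lemma JetBound.affine {E V : Type*} [NormedAddCommGroup E] [NormedSpace ℝ E] [NormedAddCommGroup V]
    [NormedSpace ℝ V] {L : V} {M : E →L[ℝ] V} {C : ℝ} (hL : ‖L‖ ≤ C) (hM : ‖M‖ ≤ C) :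
    JetBound 2 C (fun y => L + M y) 0 := by
  have hd : fderiv ℝ (fun y => L + M y) = fun _ => M := by
    funext y
    rw [fderiv_const_add]
    exact M.fderiv
  refine JetBound.of_norm_le_two (contDiffAt_const.add M.contDiff.contDiffAt) ?_ ?_ ?_
  · rwa [map_zero, add_zero]
  · rwa [hd]
  · rw [hd]
    exact ((JetBound.const M 1 0).norm_fderiv_le le_rfl).trans hM

namespace LocalCoords

variable {n : ℕ} {g : Eucl n → Fin n → Fin n → ℝ} {σ : Eucl n → Eucl n} {z : Eucl n}

/-- The linear map which takes the coordinate vectors to the vectors `b i`. -/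
noncomputable def linMap {V : Type*} [NormedAddCommGroup V] [NormedSpace ℝ V] (b : Fin n → V) :
    Eucl n →L[ℝ] V :=
  ∑ i, (EuclideanSpace.proj i : Eucl n →L[ℝ] ℝ).smulRight (b i)

section LinMap

variable {V : Type*} [NormedAddCommGroup V] [NormedSpace ℝ V]

lemma linMap_apply (b : Fin n → V) (v : Eucl n) : linMap b v = ∑ i, v i • b i := by
  simp [linMap]

lemma linMap_coordVec (b : Fin n → V) (i : Fin n) : linMap b (coordVec i) = b i := by
  simp [linMap_apply]

lemma norm_linMap_le {b : Fin n → V} {C : ℝ} (hC : 0 ≤ C) (hb : ∀ i, ‖b i‖ ≤ C) :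
    ‖linMap b‖ ≤ n * C := by
  refine ContinuousLinearMap.opNorm_le_bound _ (by positivity) fun v => ?_
  rw [linMap_apply]
  calc ‖∑ i, v i • b i‖ ≤ ∑ i : Fin n, ‖v‖ * C := norm_sum_le_of_le _ fun i _ => by
        rw [norm_smul]
        gcongr
        · exact abs_coord_le_norm v i
        · exact hb i
    _ = n * C * ‖v‖ := by simp; ring

end LinMap

/-- A quadratic map with given `2`-jet at the origin. -/
noncomputable def quadMap (z : Eucl n) (L : Eucl n →L[ℝ] Eucl n)
    (M : Eucl n →L[ℝ] Eucl n →L[ℝ] Eucl n) (y : Eucl n) : Eucl n :=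
  z + L y + (1 / 2 : ℝ) • M y y

lemma contDiff_quadMap (z : Eucl n) (L : Eucl n →L[ℝ] Eucl n)
    (M : Eucl n →L[ℝ] Eucl n →L[ℝ] Eucl n) {k : WithTop ℕ∞} : ContDiff ℝ k (quadMap z L M) := by
  unfold quadMap
  exact (contDiff_const.add L.contDiff).add ((M.contDiff.clm_apply contDiff_id).const_smul _)

lemma fderiv_quadMap (z : Eucl n) (L : Eucl n →L[ℝ] Eucl n)
    (M : Eucl n →L[ℝ] Eucl n →L[ℝ] Eucl n) (hM : ∀ v w, M v w = M w v) :
    fderiv ℝ (quadMap z L M) = fun y => L + M y := by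
  funext y
  refine ContinuousLinearMap.ext fun v => ?_
  have h1 := ((L.hasFDerivAt (x := y)).const_add z).add
    ((M.hasFDerivAt.clm_apply (hasFDerivAt_id y)).const_smul (1 / 2 : ℝ))
  have h2 : fderiv ℝ (quadMap z L M) y = _ := h1.fderiv
  rw [h2]
  simp only [add_apply, smul_apply,
    ContinuousLinearMap.comp_apply, ContinuousLinearMap.flip_apply, ContinuousLinearMap.id_apply,
    id_eq, hM v y]
  module

lemma fderiv_symm (hg : DifferentiableAt ℝ g z) (hs : ∀ᶠ y in 𝓝 z, ∀ i j, g y i j = g y j i)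
    (v : Eucl n) (i j : Fin n) : fderiv ℝ g z v i j = fderiv ℝ g z v j i := by
  rw [fderiv_entry hg, fderiv_entry hg]
  have : (fun y => g y i j) =ᶠ[𝓝 z] fun y => g y j i := by
    filter_upwards [hs] with y hy using hy i j
  rw [this.fderiv_eq]

lemma norm_le_of_bilin_eq_one {A : Fin n → Fin n → ℝ} {lam : ℝ} (hlam : 0 < lam)
    (hA : ∀ v, lam * ‖v‖ ^ 2 ≤ bilin A v v) {v : Eucl n} (hv : bilin A v v = 1) :
    ‖v‖ ≤ Real.sqrt lam⁻¹ := by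
  refine Real.le_sqrt_of_sq_le ?_
  rw [← one_div, le_div_iff₀ hlam]
  have := hA v
  linarith

lemma bilin_pos_of_le {A : Fin n → Fin n → ℝ} {lam : ℝ} (hlam : 0 < lam)
    (hA : ∀ v, lam * ‖v‖ ^ 2 ≤ bilin A v v) (v : Eucl n) (hv : v ≠ 0) : 0 < bilin A v v := by
  refine lt_of_lt_of_le ?_ (hA v)
  have := norm_pos_iff.2 hv
  positivity

/-- The components of a linear combination of a frame with respect to the metric. -/
lemma bilin_sum_frame {A : Fin n → Fin n → ℝ} {b : Fin n → Eucl n}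
    (hb : ∀ i j, bilin A (b i) (b j) = if i = j then 1 else 0) (c : Fin n → ℝ) (j : Fin n) :
    bilin A (∑ k, c k • b k) (b j) = c j := by
  rw [bilin_sum_left]
  simp [bilin_smul_left, hb]

/-- Coordinates in which a metric agrees with the Euclidean metric to first order,
with uniform bounds. -/
theorem exists_normalCoordinates (n : ℕ) {lam Λ : ℝ} (hlam : 0 < lam) (hΛ : 0 ≤ Λ) :
    ∃ B : ℝ, 1 ≤ B ∧ ∀ (g : Eucl n → Fin n → Fin n → ℝ) (z : Eucl n), JetBound 2 Λ g z →
      (∀ᶠ y in 𝓝 z, ∀ i j, g y i j = g y j i) → (∀ v, lam * ‖v‖ ^ 2 ≤ bilin (g z) v v) →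
      ∃ σ : Eucl n → Eucl n, σ 0 = z ∧ ContDiff ℝ ∞ σ ∧ Function.Injective (fderiv ℝ σ 0) ∧
        JetBound 2 B (fderiv ℝ σ) 0 ∧ (pullback σ g 0 = fun i j => if i = j then 1 else 0) ∧
        fderiv ℝ (pullback σ g) 0 = 0 := by
  obtain ⟨β, hβ⟩ : ∃ β, β = Real.sqrt lam⁻¹ := ⟨_, rfl⟩
  have hβ0 : 0 ≤ β := by rw [hβ]; exact Real.sqrt_nonneg _
  obtain ⟨γ, hγ⟩ : ∃ γ, γ = n * ((1 / 2) * (3 * (n ^ 2 * (Λ * β) * β * β)) * β) := ⟨_, rfl⟩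
  have hγ0 : 0 ≤ γ := by rw [hγ]; positivity
  refine ⟨1 + n * β + n * (n * γ), by
    have : 0 ≤ n * β + n * (n * γ) := by positivity
    linarith, ?_⟩
  intro g z hg hs hpos
  have hgd := hg.contDiffAt.differentiableAt (by norm_num)
  obtain ⟨b, hb⟩ := exists_bilin_orthonormal _ hs.self_of_nhds (bilin_pos_of_le hlam hpos)
  have hbβ : ∀ i, ‖b i‖ ≤ β := fun i => by
    rw [hβ]
    exact norm_le_of_bilin_eq_one hlam hpos (by rw [hb]; simp)
  obtain ⟨G, hG⟩ : ∃ G : Fin n → Fin n → Fin n → ℝ, G = fun i j k =>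
    bilin (fderiv ℝ g z (b i)) (b j) (b k) := ⟨_, rfl⟩
  have hGs : ∀ i j k, G i j k = G i k j := fun i j k => by
    rw [hG]
    exact bilin_symm _ (fderiv_symm hgd hs (b i)) _ _
  have hGb : ∀ i j k, |G i j k| ≤ n ^ 2 * (Λ * β) * β * β := by
    intro i j k
    have h1 : ‖fderiv ℝ g z (b i)‖ ≤ Λ * β := ((fderiv ℝ g z).le_opNorm _).trans (by
      gcongr
      · exact hg.norm_fderiv_le (by norm_num)
      · exact hbβ i)
    rw [hG]
    refine (abs_bilin_le_of_le h1 (b j) (b k)).trans ?_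
    gcongr
    · exact hbβ j
    · exact hbβ k
  -- Minus the Christoffel symbols in the frame `b`. A quadratic map with these coefficients uses
  -- only first derivatives of `g` at `z`, so it is smooth although `g` is merely `C²`, and bounds
  -- for `g` give bounds for the coordinates.
  obtain ⟨c, hc⟩ : ∃ c : Fin n → Fin n → Eucl n, c = fun i j =>
    ∑ k, (-(1 / 2) * (G i j k + G j i k - G k i j)) • b k := ⟨_, rfl⟩
  have hcs : ∀ i j, c i j = c j i := fun i j => by
    simp only [hc]
    exact Finset.sum_congr rfl fun k _ => by rw [hGs k i j, add_comm]
  have hcb : ∀ i j, ‖c i j‖ ≤ γ := by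
    intro i j
    simp only [hc]
    calc _ ≤ ∑ k : Fin n, (1 / 2) * (3 * (n ^ 2 * (Λ * β) * β * β)) * β :=
          norm_sum_le_of_le _ fun k _ => by
            rw [norm_smul]
            have h1 := abs_le.1 (hGb i j k)
            have h2 := abs_le.1 (hGb j i k)
            have h3 := abs_le.1 (hGb k i j)
            have h4 : ‖-(1 / 2) * (G i j k + G j i k - G k i j)‖ ≤
                (1 / 2) * (3 * (n ^ 2 * (Λ * β) * β * β)) := by
              rw [Real.norm_eq_abs, abs_le]
              constructor <;> linarith only [h1.1, h1.2, h2.1, h2.2, h3.1, h3.2]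
            gcongr
            exact hbβ k
      _ = γ := by rw [hγ]; simp
  obtain ⟨L, hL⟩ : ∃ L, L = linMap b := ⟨_, rfl⟩
  obtain ⟨M, hM⟩ : ∃ M : Eucl n →L[ℝ] Eucl n →L[ℝ] Eucl n,
    M = linMap fun i => linMap fun j => c i j := ⟨_, rfl⟩
  have hMs : ∀ v w, M v w = M w v := by
    intro v w
    simp only [hM, linMap_apply, sum_apply, smul_apply, Finset.smul_sum]
    rw [Finset.sum_comm]
    exact Finset.sum_congr rfl fun i _ => Finset.sum_congr rfl fun j _ => by
      rw [hcs, smul_comm]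
  have hLb : ‖L‖ ≤ n * β := by rw [hL]; exact norm_linMap_le hβ0 hbβ
  have hMb : ‖M‖ ≤ n * (n * γ) := by
    rw [hM]
    exact norm_linMap_le (by positivity) fun i => norm_linMap_le hγ0 (hcb i)
  have hd := fderiv_quadMap z L M hMs
  have hd2 : fderiv ℝ (fun y => L + M y) = fun _ => M := by
    funext y
    rw [fderiv_const_add]
    exact M.fderiv
  have h0 : fderiv ℝ (quadMap z L M) 0 = L := by rw [hd]; simp
  have hσ0 : quadMap z L M 0 = z := by simp [quadMap]
  have hLe : ∀ i, L (coordVec i) = b i := fun i => by rw [hL, linMap_coordVec]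
  have hMe : ∀ i j, M (coordVec i) (coordVec j) = c i j := fun i j => by
    rw [hM, linMap_coordVec, linMap_coordVec]
  have hpull : pullback (quadMap z L M) g 0 = fun i j => if i = j then 1 else 0 := by
    funext i j
    simp only [pullback, hσ0, h0, hLe, hb]
  refine ⟨quadMap z L M, hσ0, contDiff_quadMap z L M, ?_, ?_, hpull, ?_⟩
  · rw [injective_iff_map_eq_zero]
    intro v hv
    ext j
    have h1 : bilin (g z) (∑ i, v i • b i) (b j) = 0 := by
      rw [h0, hL, linMap_apply] at hv
      rw [hv]
      simp [bilin]
    rw [bilin_sum_frame hb] at h1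
    simpa using h1
  · rw [hd]
    have hn : 0 ≤ n * β := by positivity
    have hn' : 0 ≤ n * (n * γ) := by positivity
    exact JetBound.affine (by linarith) (by linarith)
  -- In the frame, the derivative of the pulled-back metric is `G l i j + ⟨c l i, b j⟩ + ⟨b i, c l
  -- j⟩`, and the choice of `c` makes it zero.
  · refine ContinuousLinearMap.ext fun v => ?_
    rw [← sum_coordVec v, map_sum]
    simp only [map_smul, zero_apply]
    refine Finset.sum_eq_zero fun l _ => ?_
    suffices h : fderiv ℝ (pullback (quadMap z L M) g) 0 (coordVec l) = 0 by rw [h, smul_zero]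
    funext i j
    rw [← bilin_coordVec (fderiv ℝ (pullback (quadMap z L M) g) 0 (coordVec l)) i j,
      bilin_fderiv_pullback (contDiff_quadMap z L M).contDiffAt (by rw [hσ0]; exact hgd)]
    have h2 : fderiv ℝ (fderiv ℝ (quadMap z L M)) 0 = M := by rw [hd, hd2]
    have h3 : ∀ i j k, bilin (g z) (c i j) (b k) = -(1 / 2) * (G i j k + G j i k - G k i j) := by
      intro i j k
      simp only [hc]
      exact bilin_sum_frame hb _ k
    have h4 : bilin (fderiv ℝ g z (b l)) (b i) (b j) = G l i j := by rw [hG]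
    rw [h2, h0, hσ0, hLe, hLe, hLe, hMe, hMe, bilin_symm _ hs.self_of_nhds (b i), h3, h3, h4,
      hGs l j i]
    rw [hGs i l j, hGs i j l, hGs j l i]
    simp only [Pi.zero_apply]
    rw [hGs i l j, hGs j i l]
    ring

end LocalCoords

/-! ### The local gradient estimate in coordinates -/

namespace LocalCoords

variable {n : ℕ} {g K : Eucl n → Fin n → Fin n → ℝ} {u f : Eucl n → ℝ} {σ : Eucl n → Eucl n}

lemma jetBound_pullback {k : ℕ} {C B : ℝ} {y : Eucl n} (hg : JetBound k C g (σ y))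
    (hσ : ContDiffAt ℝ k σ y) (hB : 1 ≤ B)
    (hσB : ∀ j, 1 ≤ j → j ≤ k → ‖iteratedFDeriv ℝ j σ y‖ ≤ B)
    (hσ' : JetBound k B (fderiv ℝ σ) y) :
    JetBound k (n * (n * (2 ^ k * (2 ^ k * (k.factorial * C * B ^ k) * B) * B)))
      (pullback σ g) y := by
  have hC := hg.nonneg
  have hD : ∀ a i, JetBound k B (fun z => fderiv ℝ σ z (coordVec i) a) y := by
    intro a i
    let L : (Eucl n →L[ℝ] Eucl n) →L[ℝ] ℝ :=
      (EuclideanSpace.proj a : Eucl n →L[ℝ] ℝ).comp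
        (ContinuousLinearMap.apply ℝ (Eucl n) (coordVec i))
    refine (hσ'.clm_comp L).mono (mul_le_of_le_one_left hσ'.nonneg ?_)
    refine L.opNorm_le_bound zero_le_one fun A => ?_
    calc ‖A (coordVec i) a‖ ≤ ‖A (coordVec i)‖ := abs_coord_le_norm _ a
      _ ≤ ‖A‖ * ‖(coordVec i : Eucl n)‖ := A.le_opNorm _
      _ = 1 * ‖A‖ := by rw [norm_coordVec]; ring
  refine JetBound.pi (by positivity) fun i => JetBound.pi (by positivity) fun j => ?_
  unfold pullback bilin
  have h1 := fun a b => ((((hg.comp hσ hB hσB).apply a).apply b).mul (hD a i)).mul (hD b j)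
  simpa using JetBound.sum fun a => JetBound.sum fun b => h1 a b

/-- The hypotheses of the local gradient estimate at the point `y`. -/
structure JangData (g K : Eucl n → Fin n → Fin n → ℝ) (u f : Eucl n → ℝ)
    (lam Λ m T ε : ℝ) (y : Eucl n) : Prop where
  jet_g : JetBound 2 Λ g y
  g_symm : ∀ i j, g y i j = g y j i
  g_pos : ∀ v, lam * ‖v‖ ^ 2 ≤ bilin (g y) v v
  jet_K : JetBound 1 Λ K y
  K_symm : ∀ i j, K y i j = K y j i
  jet_u : JetBound 2 Λ u y
  le_u : m ≤ u y
  contDiffAt_f : ContDiffAt ℝ 3 f y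
  jang_eq : jang g K u f y = ε * f y
  abs_le : |u y * f y| ≤ T

namespace JangData

variable {lam Λ m T ε : ℝ} {y z : Eucl n}

lemma contDiffAt_partialDeriv (h : JangData g K u f lam Λ m T ε y) (i : Fin n) :
    ContDiffAt ℝ 2 (fun z => partialDeriv f z i) y :=
  (h.contDiffAt_f.fderiv_right (m := 2) (by norm_num)).clm_apply contDiffAt_const

lemma continuousAt_slopeSq (h : JangData g K u f lam Λ m T ε y) (hlam : 0 < lam) (hm : 0 < m) :
    ContinuousAt (slopeSq g (fun z => (u z ^ 2)⁻¹) f) y := by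
  have hu : u y ≠ 0 := (hm.trans_le h.le_u).ne'
  have h1 : ContinuousAt (fun z => (u z ^ 2)⁻¹) y :=
    (h.jet_u.contDiffAt.continuousAt.pow 2).inv₀ (pow_ne_zero 2 hu)
  have h2 : ∀ i j, ContinuousAt (fun z => invMetric g z i j) y := fun i j =>
    (contDiffAt_invMetric h.jet_g.contDiffAt
      (isUnit_det_of_pos _ h.g_symm (bilin_pos_of_le hlam h.g_pos)) i j).continuousAt
  have h3 := fun i => (h.contDiffAt_partialDeriv i).continuousAt
  unfold slopeSq normSqD grad
  exact h1.add (tendsto_finsetSum _ fun i _ =>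
    (tendsto_finsetSum _ fun j _ => (h2 i j).mul (h3 j)).mul (h3 i))

lemma abs_f_le (h : JangData g K u f lam Λ m T ε y) (hm : 0 < m) : |f y| ≤ T / m := by
  rw [le_div_iff₀ hm]
  calc |f y| * m ≤ |f y| * |u y| := by gcongr; exact h.le_u.trans (le_abs_self _)
    _ = |u y * f y| := by rw [abs_mul, mul_comm]
    _ ≤ T := h.abs_le

lemma slopeSq_pullback (h : JangData g K u f lam Λ m T ε (σ y)) (hlam : 0 < lam)
    (hσ : DifferentiableAt ℝ σ y) (hinj : Function.Injective (fderiv ℝ σ y)) :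
    slopeSq (pullback σ g) (fun z => (u (σ z) ^ 2)⁻¹) (f ∘ σ) y =
      slopeSq g (fun z => (u z ^ 2)⁻¹) f (σ y) := by
  rw [slopeSq, normSqD_pullback hσ hinj h.g_symm (bilin_pos_of_le hlam h.g_pos)
    (h.contDiffAt_f.differentiableAt (by norm_num))]
  rfl

lemma slopeSq_pos (h : JangData g K u f lam Λ m T ε y) (hlam : 0 < lam) (hm : 0 < m) :
    0 < slopeSq g (fun z => (u z ^ 2)⁻¹) f y := by
  have h1 := normSqD_nonneg (f := f) h.g_symm (bilin_pos_of_le hlam h.g_pos)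
  have h2 : 0 < u y := hm.trans_le h.le_u
  have : 0 < (u y ^ 2)⁻¹ := by positivity
  unfold slopeSq
  linarith

/-- The equation is needed near the origin, since it gets differentiated; coordinate invariance
therefore requires an injective differential in a neighbourhood and not only at the origin. -/
lemma isJangNormal (h : ∀ᶠ y in 𝓝 z, JangData g K u f lam Λ m T ε y) (hlam : 0 < lam)
    (hm : 0 < m) (hσz : σ 0 = z) (hσ : ContDiff ℝ ∞ σ)
    (hinj : ∀ᶠ y in 𝓝 0, Function.Injective (fderiv ℝ σ y))
    (hpull : pullback σ g 0 = fun i j => if i = j then 1 else 0)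
    (hpull' : fderiv ℝ (pullback σ g) 0 = 0) (hg2 : ContDiffAt ℝ 2 (pullback σ g) 0) :
    IsJangNormal (pullback σ g) (pullback σ K) (fun y => (u (σ y) ^ 2)⁻¹) (f ∘ σ) ε := by
  subst hσz
  have hσ2 : ∀ y, ContDiffAt ℝ 2 σ y := fun y =>
    (show ContDiff ℝ 2 σ from mod_cast contDiff_infty.1 hσ 2).contDiffAt
  have hσ3 : ContDiffAt ℝ 3 σ 0 :=
    (show ContDiff ℝ 3 σ from mod_cast contDiff_infty.1 hσ 3).contDiffAt
  have h0 := h.self_of_nhds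
  have he := (hσ.continuous.tendsto 0).eventually h
  have hu0 : 0 < u (σ 0) := hm.trans_le h0.le_u
  refine ⟨hg2, hpull, hpull', ?_, ?_, ?_, ?_, by positivity, h0.contDiffAt_f.comp 0 hσ3, ?_⟩
  · filter_upwards [he] with y hy i j using bilin_symm _ hy.g_symm _ _
  · exact differentiableAt_pullback (hσ2 0) (h0.jet_K.contDiffAt.differentiableAt (by norm_num))
  · exact fun i j => bilin_symm _ h0.K_symm _ _
  · exact ((h0.jet_u.contDiffAt.comp 0 (hσ2 0)).pow 2).inv (by positivity)
  · filter_upwards [he, hinj] with y hy hi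
    have hpos := bilin_pos_of_le hlam hy.g_pos
    have hud := hy.jet_u.contDiffAt.differentiableAt (by norm_num)
    refine polynomialJang_of_jang (u := u ∘ σ) (fun i j => bilin_symm _ hy.g_symm _ _) ?_
      (hud.comp y ((hσ2 y).differentiableAt (by norm_num))) (hm.trans_le hy.le_u) ?_
    · intro v hv
      rw [bilin_pullback]
      exact hpos _ fun h => hv (hi (by simpa using h))
    · rw [jang_pullback (hσ2 y) hi (hy.jet_g.contDiffAt.differentiableAt (by norm_num)) hy.g_symm
        hpos (hy.contDiffAt_f.of_le (by norm_num)) hud]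
      exact hy.jang_eq

end JangData

/-- The bound for the slope at a maximum point of the auxiliary function. -/
theorem exists_slope_bound (n : ℕ) {r lam Λ m T b : ℝ} (hr : 0 < r) (hlam : 0 < lam) (hΛ : 0 < Λ)
    (hm : 0 < m) (hT : 0 < T) (hb : 0 < b) :
    ∃ k : ℝ, 1 ≤ k ∧ ∃ V : ℝ, ∀ (g K : Eucl n → Fin n → Fin n → ℝ) (u f : Eucl n → ℝ)
      (y₀ z : Eucl n) (c ε : ℝ), 0 ≤ ε → ε ≤ 1 → |c| ≤ 2 → ‖z - y₀‖ ≤ r →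
      (∀ᶠ y in 𝓝 z, JangData g K u f lam Λ m T ε y) →
      0 < c + -(2 / r ^ 2) * ‖z - y₀‖ ^ 2 + b * f z →
      IsLocalMax (fun y => (Real.exp (k * (c + -(2 / r ^ 2) * ‖y - y₀‖ ^ 2 + b * f y)) - 1) ^ 2 *
        slopeSq g (fun z => (u z ^ 2)⁻¹) f y) z →
      Real.sqrt (slopeSq g (fun z => (u z ^ 2)⁻¹) f z) ≤ V := by
  obtain ⟨B, hB1, hB⟩ := exists_normalCoordinates n hlam hΛ.le
  have hB0 : 0 < B := by linarith
  -- The values of `u` lie in the compact interval `[m, Λ]` away from `0`, so the jets of `u⁻²` are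
  -- bounded by those of `u`.
  obtain ⟨A, hA⟩ : ∃ A, ∀ x ∈ Icc m Λ, JetBound 2 A (fun x : ℝ => (x ^ 2)⁻¹) x := by
    refine JetBound.exists_of_isCompact (U := Ioi 0) isOpen_Ioi ?_ isCompact_Icc
      fun x hx => hm.trans_le hx.1
    exact (contDiffOn_id.pow 2).inv fun x hx => by
      have : (0 : ℝ) < x := hx
      simp only [id]
      positivity
  obtain ⟨H, hH⟩ : ∃ H, ∀ x ∈ Metric.closedBall (0 : Eucl n) r,
      JetBound 2 H (fun x : Eucl n => -(2 / r ^ 2) * ‖x‖ ^ 2) x :=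
    JetBound.exists_of_isCompact isOpen_univ (contDiff_const.mul (contDiff_norm_sq ℝ)).contDiffOn
      (isCompact_closedBall _ _) (subset_univ _)
  have hH0 : 0 ≤ H := (hH 0 (by simp [hr.le])).nonneg
  obtain ⟨U1, hU1⟩ : ∃ U1, U1 = 1 + Nat.factorial 2 * Λ * B ^ 2 := ⟨_, rfl⟩
  have hU10 : 1 ≤ U1 := by
    rw [hU1]
    have : 0 < Nat.factorial 2 * Λ * B ^ 2 := by positivity
    linarith
  obtain ⟨A1, hA1⟩ : ∃ A1, A1 = Nat.factorial 2 * |A| * U1 ^ 2 := ⟨_, rfl⟩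
  obtain ⟨H1, hH1⟩ : ∃ H1, H1 = 2 + Nat.factorial 2 * H * B ^ 2 := ⟨_, rfl⟩
  obtain ⟨P1, hP1⟩ : ∃ P1, P1 = n * (n * (2 ^ 1 * (2 ^ 1 * (Nat.factorial 1 * Λ * B ^ 1) * B) * B))
    := ⟨_, rfl⟩
  obtain ⟨P2, hP2⟩ : ∃ P2, P2 = n * (n * (2 ^ 2 * (2 ^ 2 * (Nat.factorial 2 * Λ * B ^ 2) * B) * B))
    := ⟨_, rfl⟩
  have hA10 : 0 ≤ A1 := by rw [hA1]; positivity
  have hH10 : 0 ≤ H1 := by rw [hH1]; positivity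
  have hP10 : 0 ≤ P1 := by rw [hP1]; positivity
  have hP20 : 0 ≤ P2 := by rw [hP2]; positivity
  have hTm : 0 < T / m := by positivity
  -- `k` and `V` are fixed before the data. `M` is the sum of all bounds in normal coordinates, and
  -- `(Λ ^ 2)⁻¹` bounds `u⁻²` from below because `u ≤ Λ`.
  obtain ⟨k, hk1, V, hV⟩ := exists_slope_bound_of_isLocalMax n (M := 1 + A1 + H1 + P1 + P2 + T / m)
    (lam := (Λ ^ 2)⁻¹) (b := b) (by linarith) (by positivity) hb
  refine ⟨k, hk1, V, ?_⟩
  intro g K u f y₀ z c ε hε0 hε1 hc hz h hφ hmax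
  have h0 := h.self_of_nhds
  obtain ⟨σ, hσz, hσ, hi0, hσ', hp0, hp1⟩ := hB g z h0.jet_g
    (h.mono fun y hy => hy.g_symm) h0.g_pos
  subst hσz
  have hinj : ∀ᶠ y in 𝓝 0, Function.Injective (fderiv ℝ σ y) := by
    have hc : Continuous (fderiv ℝ σ) := hσ.continuous_fderiv (by simp)
    exact (hc.tendsto 0).eventually
      ((ContinuousLinearMap.isOpen_injective (𝕜 := ℝ)).mem_nhds hi0)
  have hσB : ∀ k' ≤ 2, ∀ j, 1 ≤ j → j ≤ k' → ‖iteratedFDeriv ℝ j σ 0‖ ≤ B := by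
    intro k' hk' j hj1 hj2
    obtain ⟨l, rfl⟩ : ∃ l, j = l + 1 := ⟨j - 1, by omega⟩
    rw [← norm_iteratedFDeriv_fderiv]
    exact hσ'.bound l (by omega)
  have hσ2 : ContDiffAt ℝ 2 σ 0 :=
    (show ContDiff ℝ 2 σ from mod_cast contDiff_infty.1 hσ 2).contDiffAt
  have jg := jetBound_pullback h0.jet_g hσ2 hB1 (hσB 2 le_rfl) hσ'
  have jK := jetBound_pullback h0.jet_K (hσ2.of_le (by norm_num)) hB1 (hσB 1 (by norm_num))
    (hσ'.of_le (by norm_num))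
  rw [← hP2] at jg
  rw [← hP1] at jK
  have hN := JangData.isJangNormal h hlam hm rfl hσ hinj hp0 hp1 jg.contDiffAt
  have hu0 : 0 < u (σ 0) := hm.trans_le h0.le_u
  have huΛ : u (σ 0) ≤ Λ := (le_abs_self _).trans h0.jet_u.norm_le
  have ju := h0.jet_u.comp hσ2 hB1 (hσB 2 le_rfl)
  have ja : JetBound 2 A1 (fun y => (u (σ y) ^ 2)⁻¹) 0 := by
    refine ((hA (u (σ 0)) ⟨h0.le_u, huΛ⟩).comp (σ := fun y => u (σ y)) ju.contDiffAt hU10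
      fun j _ hj => (ju.bound j hj).trans (by rw [hU1]; linarith)).mono ?_
    rw [hA1]
    gcongr
    exact le_abs_self A
  have jψ : JetBound 2 H1 (fun y => c + -(2 / r ^ 2) * ‖σ y - y₀‖ ^ 2) 0 := by
    have hσy : ∀ j, 1 ≤ j → j ≤ 2 → ‖iteratedFDeriv ℝ j (fun y => σ y - y₀) 0‖ ≤ B := by
      intro j hj1 hj2
      obtain ⟨l, rfl⟩ : ∃ l, j = l + 1 := ⟨j - 1, by omega⟩
      rw [← norm_iteratedFDeriv_fderiv]
      have : fderiv ℝ (fun y => σ y - y₀) = fderiv ℝ σ := by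
        funext y
        rw [fderiv_sub_const]
      rw [this]
      exact hσ'.bound l (by omega)
    have h1 := (hH (σ 0 - y₀) (by simpa using hz)).comp (σ := fun y => σ y - y₀)
      (hσ2.sub contDiffAt_const) hB1 hσy
    refine ((JetBound.const c 2 0).add h1).mono ?_
    rw [hH1, Real.norm_eq_abs]
    linarith
  have he : |ε * f (σ 0)| ≤ T / m := by
    rw [abs_mul, abs_of_nonneg hε0]
    calc ε * |f (σ 0)| ≤ 1 * (T / m) := by
          gcongr
          exact h0.abs_f_le hm
      _ = T / m := one_mul _
  have hw : ∀ᶠ y in 𝓝 0, slopeSq (pullback σ g) (fun z => (u (σ z) ^ 2)⁻¹) (f ∘ σ) y =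
      slopeSq g (fun z => (u z ^ 2)⁻¹) f (σ y) := by
    filter_upwards [(hσ.continuous.tendsto 0).eventually h, hinj] with y hy hi
    exact hy.slopeSq_pullback hlam (hσ.differentiable (by simp) y) hi
  have hmax' : IsLocalMax (fun y => (Real.exp (k * ((c + -(2 / r ^ 2) * ‖σ y - y₀‖ ^ 2) +
      b * (f ∘ σ) y)) - 1) ^ 2 *
        slopeSq (pullback σ g) (fun z => (u (σ z) ^ 2)⁻¹) (f ∘ σ) y) 0 := by
    filter_upwards [hw, (hσ.continuous.tendsto 0).eventually hmax] with y hy hy'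
    rw [hy, hw.self_of_nhds]
    exact hy'
  rw [← hw.self_of_nhds]
  refine hV _ _ _ _ _ ε hN jψ.contDiffAt hε0 ?_ ?_ ?_ ?_ ?_ ?_ ?_ ?_ ?_ ?_ hφ hmax'
  · have : u (σ 0) ^ 2 ≤ Λ ^ 2 := by gcongr
    exact inv_anti₀ (by positivity) this
  · exact ((le_abs_self _).trans ja.norm_le).trans (by linarith)
  · exact (ja.norm_fderiv_le (by norm_num)).trans (by linarith)
  · exact (ja.norm_fderiv_fderiv_le (by norm_num)).trans (by linarith)
  · exact (jψ.norm_fderiv_le (by norm_num)).trans (by linarith)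
  · exact (jψ.norm_fderiv_fderiv_le (by norm_num)).trans (by linarith)
  · exact jK.norm_le.trans (by linarith)
  · exact (jK.norm_fderiv_le (by norm_num)).trans (by linarith)
  · exact (jg.norm_fderiv_fderiv_le (by norm_num)).trans (by linarith)
  · exact he.trans (by linarith)

/-- The local gradient estimate. -/
theorem exists_local_gradient_bound (n : ℕ) {r lam Λ m T : ℝ} (hr : 0 < r) (hlam : 0 < lam)
    (hΛ : 0 < Λ) (hm : 0 < m) (hT : 0 < T) :
    ∃ C : ℝ, ∀ (g K : Eucl n → Fin n → Fin n → ℝ) (u f : Eucl n → ℝ) (y₀ : Eucl n) (ε : ℝ),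
      0 ≤ ε → ε ≤ 1 → (∀ y ∈ Metric.ball y₀ r, JangData g K u f lam Λ m T ε y) →
      u y₀ ^ 2 * normSqD g f y₀ ≤ C := by
  -- From `|f| ≤ T / m` this `b` gives `|b f| ≤ 1 / 4`.
  obtain ⟨k, hk1, V, hV⟩ := exists_slope_bound n (r := r / 2) (b := m / (4 * T)) (by positivity)
    hlam hΛ hm hT (by positivity)
  have hk0 : 0 < k := by linarith
  refine ⟨Λ ^ 2 * ((Real.exp (k * (3 / 2)) - 1) ^ 2 * V ^ 2 / (Real.exp k - 1) ^ 2), ?_⟩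
  intro g K u f y₀ ε hε0 hε1 h
  obtain ⟨b, hb⟩ : ∃ b, b = m / (4 * T) := ⟨_, rfl⟩
  rw [← hb] at hV
  have hb0 : 0 < b := by rw [hb]; positivity
  -- Normalised to be `1` at the centre. At distance `r / 2` the quadratic penalty equals `2`, so
  -- there `φ ≤ 3 / 2 - 2 < 0`.
  obtain ⟨φ, hφ⟩ : ∃ φ : Eucl n → ℝ, φ = fun y =>
    (1 - b * f y₀) + -(2 / (r / 2) ^ 2) * ‖y - y₀‖ ^ 2 + b * f y := ⟨_, rfl⟩
  obtain ⟨w, hw⟩ : ∃ w, w = slopeSq g (fun z => (u z ^ 2)⁻¹) f := ⟨_, rfl⟩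
  have hy₀ : y₀ ∈ Metric.ball y₀ r := Metric.mem_ball_self hr
  have hbf : ∀ y ∈ Metric.ball y₀ r, |b * f y| ≤ 1 / 4 := by
    intro y hy
    rw [abs_mul, abs_of_pos hb0]
    calc b * |f y| ≤ b * (T / m) := by gcongr; exact (h y hy).abs_f_le hm
      _ = 1 / 4 := by rw [hb]; field_simp
  have hsub : Metric.closedBall y₀ (r / 2) ⊆ Metric.ball y₀ r :=
    Metric.closedBall_subset_ball (by linarith)
  have hφc : ∀ y ∈ Metric.ball y₀ r, ContinuousAt φ y := by
    intro y hy
    have h1 := (h y hy).contDiffAt_f.continuousAt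
    have h2 : Continuous fun y : Eucl n =>
      (1 - b * f y₀) + -(2 / (r / 2) ^ 2) * ‖y - y₀‖ ^ 2 := by fun_prop
    rw [hφ]
    exact h2.continuousAt.add (h1.const_mul b)
  have hφle : ∀ y ∈ Metric.ball y₀ r, φ y ≤ 3 / 2 - 2 / (r / 2) ^ 2 * ‖y - y₀‖ ^ 2 := by
    intro y hy
    have h1 := abs_le.1 (hbf y hy)
    have h2 := abs_le.1 (hbf y₀ hy₀)
    rw [hφ]
    simp only
    linarith
  have hφ0 : φ y₀ = 1 := by rw [hφ]; simp
  obtain ⟨Q, hQ⟩ : ∃ Q : Eucl n → ℝ, Q = fun y => (Real.exp (k * φ y) - 1) ^ 2 * w y := ⟨_, rfl⟩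
  have hQc : ∀ y ∈ Metric.ball y₀ r, ContinuousAt Q y := by
    intro y hy
    rw [hQ, hw]
    exact ((((hφc y hy).const_mul k).rexp.sub continuousAt_const).pow 2).mul
      ((h y hy).continuousAt_slopeSq hlam hm)
  -- The square in `Q` is also positive where `φ < 0`, so the maximum is taken over `φ ≥ 0` only.
  -- There `Q > 0` at the maximum point excludes `φ = 0`, and the penalty excludes the sphere; hence
  -- the maximum is local in the full space.
  obtain ⟨S, hS⟩ : ∃ S, S = Metric.closedBall y₀ (r / 2) ∩ φ ⁻¹' Ici 0 := ⟨_, rfl⟩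
  have hScl : IsCompact S := by
    rw [hS]
    refine (isCompact_closedBall y₀ (r / 2)).of_isClosed_subset ?_ inter_subset_left
    exact ContinuousOn.preimage_isClosed_of_isClosed
      (fun y hy => (hφc y (hsub hy)).continuousWithinAt) Metric.isClosed_closedBall isClosed_Ici
  have hy₀S : y₀ ∈ S := by
    rw [hS]
    exact ⟨Metric.mem_closedBall_self (by linarith), by simp [hφ0]⟩
  obtain ⟨z, hzS, hzmax⟩ := hScl.exists_isMaxOn ⟨y₀, hy₀S⟩ (f := Q) fun y hy =>
    (hQc y (hsub (by rw [hS] at hy; exact hy.1))).continuousWithinAt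
  rw [hS] at hzS
  have hzb := hsub hzS.1
  have hw0 : ∀ y ∈ Metric.ball y₀ r, 0 < w y := fun y hy => by
    rw [hw]
    exact (h y hy).slopeSq_pos hlam hm
  have hek : 0 < Real.exp k - 1 := by
    have := Real.add_one_lt_exp hk0.ne'
    linarith
  have hQ0 : Q y₀ = (Real.exp k - 1) ^ 2 * w y₀ := by rw [hQ]; simp [hφ0]
  have hQz : Q y₀ ≤ Q z := hzmax hy₀S
  have hQpos : 0 < Q z := by
    refine lt_of_lt_of_le ?_ hQz
    rw [hQ0]
    have := hw0 y₀ hy₀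
    positivity
  have hφz : 0 < φ z := by
    refine lt_of_le_of_ne hzS.2 fun h0 => ?_
    rw [hQ] at hQpos
    simp [← h0] at hQpos
  have hzlt : ‖z - y₀‖ < r / 2 := by
    have h1 := hφle z hzb
    by_contra hc
    push Not at hc
    have h2 : (r / 2) ^ 2 ≤ ‖z - y₀‖ ^ 2 := by gcongr
    have h3 : 2 ≤ 2 / (r / 2) ^ 2 * ‖z - y₀‖ ^ 2 := by
      rw [div_mul_eq_mul_div, le_div_iff₀ (by positivity)]
      linarith
    linarith
  have hlocal : IsLocalMax Q z := by
    have hz' : z ∈ Metric.ball y₀ (r / 2) := by rwa [Metric.mem_ball, dist_eq_norm]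
    filter_upwards [Metric.isOpen_ball.mem_nhds hz', (hφc z hzb).eventually (lt_mem_nhds hφz)]
      with y hy hy'
    exact hzmax (by rw [hS]; exact ⟨Metric.ball_subset_closedBall hy, le_of_lt hy'⟩)
  have hb0' := abs_le.1 (hbf y₀ hy₀)
  have hVz : Real.sqrt (w z) ≤ V := by
    rw [hw]
    refine hV g K u f y₀ z (1 - b * f y₀) ε hε0 hε1 ?_ hzlt.le ?_ ?_ ?_
    · rw [abs_le]
      constructor <;> linarith
    · filter_upwards [Metric.isOpen_ball.mem_nhds hzb] with y hy using h y hy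
    · rw [hφ] at hφz
      exact hφz
    · rw [hQ, hw, hφ] at hlocal
      exact hlocal
  have hwz : w z ≤ V ^ 2 := by
    rw [← Real.sq_sqrt (hw0 z hzb).le]
    gcongr
  have hφz2 : φ z ≤ 3 / 2 := by
    have h1 := hφle z hzb
    have : 0 ≤ 2 / (r / 2) ^ 2 * ‖z - y₀‖ ^ 2 := by positivity
    linarith
  have hez : 0 ≤ Real.exp (k * φ z) - 1 := by
    have := Real.add_one_le_exp (k * φ z)
    have : 0 < k * φ z := by positivity
    linarith
  have hfin : w y₀ ≤ (Real.exp (k * (3 / 2)) - 1) ^ 2 * V ^ 2 / (Real.exp k - 1) ^ 2 := by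
    rw [le_div_iff₀ (by positivity), mul_comm, ← hQ0]
    refine hQz.trans ?_
    simp only [hQ]
    have := (hw0 z hzb).le
    gcongr
  have h0 := h y₀ hy₀
  have hu0 : 0 < u y₀ := hm.trans_le h0.le_u
  have huΛ : u y₀ ≤ Λ := (le_abs_self _).trans h0.jet_u.norm_le
  have hN : normSqD g f y₀ ≤ w y₀ := by
    rw [hw, slopeSq]
    have : 0 < (u y₀ ^ 2)⁻¹ := by positivity
    linarith
  have hw0' := (hw0 y₀ hy₀).le
  calc u y₀ ^ 2 * normSqD g f y₀ ≤ u y₀ ^ 2 * w y₀ := by gcongr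
    _ ≤ Λ ^ 2 * w y₀ := by gcongr
    _ ≤ _ := by gcongr

end LocalCoords

/-! ### Smooth local parametrizations of the manifold -/

section Param

variable {n : ℕ} {H : Type*} [TopologicalSpace H] {I : ModelWithCorners ℝ (Eucl n) H}
  {M : Type*} [TopologicalSpace M] [ChartedSpace H M]

variable (I) in
/-- `φ` is a smooth immersion of the open set `Ω` into the manifold. -/
structure IsParam (φ : Eucl n → M) (Ω : Set (Eucl n)) : Prop where
  isOpen : IsOpen Ω
  contMDiffOn : ContMDiffOn 𝓘(ℝ, Eucl n) I ∞ φ Ω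
  injective : ∀ y ∈ Ω, Function.Injective (mfderiv 𝓘(ℝ, Eucl n) I φ y)

lemma bilin_tensorComponents (φ : Eucl n → M) (s : Set (Eucl n)) (h : TwoTensor I M)
    (y v w : Eucl n) :
    bilin (tensorComponents I φ s h y) v w =
      h (φ y) (mfderivWithin 𝓘(ℝ, Eucl n) I φ s y v) (mfderivWithin 𝓘(ℝ, Eucl n) I φ s y w) := by
  let A : Eucl n →ₗ[ℝ] TangentSpace I (φ y) :=
    (mfderivWithin 𝓘(ℝ, Eucl n) I φ s y : Eucl n →L[ℝ] TangentSpace I (φ y)).toLinearMap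
  change bilin (fun i j => h (φ y) (A (coordVec i)) (A (coordVec j))) v w = h (φ y) (A v) (A w)
  conv_rhs => rw [← sum_coordVec v, ← sum_coordVec w]
  simp only [map_sum, map_smul, LinearMap.sum_apply, LinearMap.smul_apply, smul_eq_mul, bilin,
    Finset.mul_sum]
  rw [Finset.sum_comm]
  exact Finset.sum_congr rfl fun i _ => Finset.sum_congr rfl fun j _ => by ring

lemma tensorComponents_of_mem_nhds {φ : Eucl n → M} {s : Set (Eucl n)} {h : TwoTensor I M}
    {y : Eucl n} (hs : s ∈ 𝓝 y) : tensorComponents I φ s h y = tensorComponents I φ univ h y := by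
  unfold tensorComponents
  rw [mfderivWithin_of_mem_nhds hs, mfderivWithin_univ]

namespace IsParam

variable {φ : Eucl n → M} {Ω : Set (Eucl n)} {y : Eucl n}

lemma contMDiffAt (hφ : IsParam I φ Ω) (hy : y ∈ Ω) : ContMDiffAt 𝓘(ℝ, Eucl n) I ∞ φ y :=
  hφ.contMDiffOn.contMDiffAt (hφ.isOpen.mem_nhds hy)

lemma mdifferentiableAt (hφ : IsParam I φ Ω) (hy : y ∈ Ω) :
    MDifferentiableAt 𝓘(ℝ, Eucl n) I φ y :=
  (hφ.contMDiffAt hy).mdifferentiableAt (by simp)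

lemma surjective (hφ : IsParam I φ Ω) (hy : y ∈ Ω) :
    Function.Surjective (mfderiv 𝓘(ℝ, Eucl n) I φ y) := by
  have h := hφ.injective y hy
  let A : Eucl n →ₗ[ℝ] Eucl n :=
    (mfderiv 𝓘(ℝ, Eucl n) I φ y : Eucl n →L[ℝ] Eucl n).toLinearMap
  exact LinearMap.surjective_of_injective (f := A) h

/-- A differentiable map from a boundaryless space whose differential is onto cannot hit the
boundary. Along a parametrization, derivatives of chart expressions within `range I` are therefore
ordinary derivatives. -/
lemma isInteriorPoint [IsManifold I ∞ M] (hφ : IsParam I φ Ω) (hy : y ∈ Ω) :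
    I.IsInteriorPoint (φ y) := by
  have : IsManifold I 1 M := IsManifold.of_le (n := ∞) (by simp)
  exact (hφ.mdifferentiableAt hy).isInteriorPoint_of_surjective_mfderiv (hφ.surjective hy)
    (BoundarylessManifold.isInteriorPoint' y)

lemma contDiffAt_transition [IsManifold I ∞ M] (hφ : IsParam I φ Ω) (hy : y ∈ Ω) {q : M}
    (hq : φ y ∈ (chartAt H q).source) : ContDiffAt ℝ ∞ (fun z => extChartAt I q (φ z)) y := by
  rw [← contMDiffAt_iff_contDiffAt]
  exact (contMDiffAt_extChartAt' hq).comp y (hφ.contMDiffAt hy)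

lemma eventually_mem_source (hφ : IsParam I φ Ω) (hy : y ∈ Ω) :
    ∀ᶠ z in 𝓝 y, φ z ∈ (extChartAt I (φ y)).source :=
  (hφ.contMDiffAt hy).continuousAt.eventually (extChartAt_source_mem_nhds (φ y))

lemma mfderiv_eq [IsManifold I ∞ M] (hφ : IsParam I φ Ω) {q : M} (hy : y ∈ Ω)
    (hq : ∀ᶠ z in 𝓝 y, φ z ∈ (extChartAt I q).source) (v : Eucl n) :
    (mfderiv 𝓘(ℝ, Eucl n) I φ y v : Eucl n) =
      mfderivWithin 𝓘(ℝ, Eucl n) I (extChartAt I q).symm (range I) (extChartAt I q (φ y))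
        (fderiv ℝ (fun z => extChartAt I q (φ z)) y v) := by
  have : IsManifold I 1 M := IsManifold.of_le (n := ∞) (by simp)
  have hq0 : φ y ∈ (extChartAt I q).source := hq.self_of_nhds
  have h1 : HasMFDerivAt 𝓘(ℝ, Eucl n) 𝓘(ℝ, Eucl n) (fun z => extChartAt I q (φ z)) y
      (fderiv ℝ (fun z => extChartAt I q (φ z)) y) :=
    ((hφ.contDiffAt_transition hy (by simpa using hq0)).differentiableAt
      (by simp)).hasFDerivAt.hasMFDerivAt
  have h2 := (mdifferentiableWithinAt_extChartAt_symm (I := I)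
    ((extChartAt I q).map_source hq0)).hasMFDerivWithinAt
  have h3 := hasMFDerivWithinAt_univ.1 (HasMFDerivWithinAt.comp y h2
    (hasMFDerivWithinAt_univ.2 h1) (by
      intro z _
      exact ⟨chartAt H q (φ z), rfl⟩))
  have h4 : φ =ᶠ[𝓝 y] (extChartAt I q).symm ∘ fun z => extChartAt I q (φ z) := by
    filter_upwards [hq] with z hz
    exact ((extChartAt I q).left_inv hz).symm
  have h5 := (h3.congr_of_eventuallyEq h4).mfderiv
  rw [h5]
  rfl

lemma injective_fderiv_transition [IsManifold I ∞ M] (hφ : IsParam I φ Ω) {q : M} (hy : y ∈ Ω)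
    (hq : ∀ᶠ z in 𝓝 y, φ z ∈ (extChartAt I q).source) :
    Function.Injective (fderiv ℝ (fun z => extChartAt I q (φ z)) y) := by
  intro v w hvw
  refine hφ.injective y hy ?_
  have h1 := hφ.mfderiv_eq hy hq v
  have h2 := hφ.mfderiv_eq hy hq w
  rw [hvw] at h1
  exact h1.trans h2.symm

lemma tensorComponents_eq_pullback [IsManifold I ∞ M] (hφ : IsParam I φ Ω) {q : M} (hy : y ∈ Ω)
    (hq : ∀ᶠ z in 𝓝 y, φ z ∈ (extChartAt I q).source) (h : TwoTensor I M) :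
    tensorComponents I φ univ h y =
      LocalCoords.pullback (fun z => extChartAt I q (φ z)) (chartComponents I q h) y := by
  funext i j
  have h1 := hφ.mfderiv_eq hy hq (coordVec i)
  have h2 := hφ.mfderiv_eq hy hq (coordVec j)
  have h3 : (extChartAt I q).symm (extChartAt I q (φ y)) = φ y :=
    (extChartAt I q).left_inv hq.self_of_nhds
  unfold tensorComponents LocalCoords.pullback chartComponents
  rw [bilin_tensorComponents, mfderivWithin_univ]
  -- All tangent spaces are `Eucl n` by definition, which permits a change of base point along an
  -- equality.
  have key : ∀ (p p' : M) (_ : p' = p) (v w v' w' : Eucl n), v = v' → w = w' →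
      (h p : Eucl n →ₗ[ℝ] Eucl n →ₗ[ℝ] ℝ) v w =
        (h p' : Eucl n →ₗ[ℝ] Eucl n →ₗ[ℝ] ℝ) v' w' := by
    rintro p _ rfl v w _ _ rfl rfl
    rfl
  exact key _ _ h3 _ _ _ _ h1 h2

end IsParam

end Param

namespace LocalCoords

lemma contDiffAt_pullback {n : ℕ} {k : ℕ} {g : Eucl n → Fin n → Fin n → ℝ} {σ : Eucl n → Eucl n}
    {y : Eucl n} (hg : ContDiffAt ℝ k g (σ y)) (hσ : ContDiffAt ℝ ∞ σ y) :
    ContDiffAt ℝ k (pullback σ g) y := by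
  have hσk : ContDiffAt ℝ k σ y := hσ.of_le (by exact_mod_cast le_top)
  have hσ' : ContDiffAt ℝ k (fderiv ℝ σ) y := hσ.fderiv_right (by exact_mod_cast le_top)
  have hD : ∀ i, ContDiffAt ℝ k (fun z => fderiv ℝ σ z (coordVec i)) y := fun i =>
    hσ'.clm_apply contDiffAt_const
  have hD' : ∀ a i, ContDiffAt ℝ k (fun z => fderiv ℝ σ z (coordVec i) a) y := fun a i =>
    (EuclideanSpace.proj (𝕜 := ℝ) a).contDiff.contDiffAt.comp y (hD i)
  have hG := hg.comp y hσk
  refine contDiffAt_pi.2 fun i => contDiffAt_pi.2 fun j => ?_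
  unfold pullback bilin
  refine ContDiffAt.sum fun a _ => ContDiffAt.sum fun b _ => ?_
  exact (((contDiffAt_pi.1 (contDiffAt_pi.1 hG a) b).mul (hD' a i)).mul (hD' b j))

end LocalCoords

/-! ### Tensors, the Jang operator and the gradient norm in a parametrization. -/

section Param

variable {n : ℕ} {H : Type*} [TopologicalSpace H] {I : ModelWithCorners ℝ (Eucl n) H}
  {M : Type*} [TopologicalSpace M] [ChartedSpace H M]

lemma IsParam.contDiffAt_tensorComponents [IsManifold I ∞ M] {φ : Eucl n → M}
    {Ω : Set (Eucl n)} (hφ : IsParam I φ Ω) {y : Eucl n} (hy : y ∈ Ω) {k : ℕ} {α : ℝ≥0}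
    {h : TwoTensor I M} (hh : IsCkHolderLocTensor I k α h) :
    ContDiffAt ℝ k (tensorComponents I φ univ h) y := by
  have hq := hφ.eventually_mem_source hy
  have hint := (I.isInteriorPoint_iff).1 (hφ.isInteriorPoint hy)
  have h1 : ContDiffAt ℝ k (chartComponents I (φ y) h) (extChartAt I (φ y) (φ y)) :=
    (hh (φ y)).1.contDiffAt (mem_interior_iff_mem_nhds.1 hint)
  have h2 := LocalCoords.contDiffAt_pullback (σ := fun z => extChartAt I (φ y) (φ z)) h1
    (hφ.contDiffAt_transition hy (mem_chart_source H (φ y)))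
  refine h2.congr_of_eventuallyEq ?_
  filter_upwards [hq.eventually_nhds, hφ.isOpen.mem_nhds hy] with z hz hzΩ
  exact hφ.tensorComponents_eq_pullback hzΩ hz h

lemma contDiffAt_comp_extChartAt_symm {k : WithTop ℕ∞} {f : M → ℝ} {q : M}
    (hf : ContMDiffAt I 𝓘(ℝ, ℝ) k f q) (hq : I.IsInteriorPoint q) :
    ContDiffAt ℝ k (f ∘ (extChartAt I q).symm) (extChartAt I q q) := by
  have h1 := (contMDiffAt_iff.1 hf).2
  exact h1.contDiffAt (range_mem_nhds_isInteriorPoint hq)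

section Metric

variable [RiemannianBundle (fun x : M => TangentSpace I x)]

lemma metricTensor_symm (x : M) (v w : TangentSpace I x) :
    metricTensor I M x v w = metricTensor I M x w v := by
  simp [metricTensor, real_inner_comm]

lemma metricTensor_self (x : M) (v : TangentSpace I x) : metricTensor I M x v v = ‖v‖ ^ 2 := by
  simp [metricTensor]

lemma bilin_metric_self (φ : Eucl n → M) (y v : Eucl n) :
    bilin (tensorComponents I φ univ (metricTensor I M) y) v v =
      ‖(mfderiv 𝓘(ℝ, Eucl n) I φ y v : TangentSpace I (φ y))‖ ^ 2 := by
  rw [bilin_tensorComponents, metricTensor_self, mfderivWithin_univ]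

omit [RiemannianBundle (fun x : M => TangentSpace I x)] in
lemma tensorComponents_symm {h : TwoTensor I M} (hs : ∀ x v w, h x v w = h x w v)
    (φ : Eucl n → M) (s : Set (Eucl n)) (y : Eucl n) (i j : Fin n) :
    tensorComponents I φ s h y i j = tensorComponents I φ s h y j i := hs _ _ _

lemma bilin_metric_pos {φ : Eucl n → M} {y v : Eucl n}
    (hφ : Function.Injective (mfderiv 𝓘(ℝ, Eucl n) I φ y)) (hv : v ≠ 0) :
    0 < bilin (tensorComponents I φ univ (metricTensor I M) y) v v := by
  rw [bilin_metric_self]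
  have h1 : (mfderiv 𝓘(ℝ, Eucl n) I φ y v : TangentSpace I (φ y)) ≠ 0 := fun h =>
    hv (hφ (h.trans (map_zero (mfderiv 𝓘(ℝ, Eucl n) I φ y)).symm))
  have := norm_pos_iff.2 h1
  positivity

variable [IsManifold I ∞ M]

/-- The Jang operator may be computed in any smooth parametrization. -/
lemma IsParam.jangOperator_eq {φ : Eucl n → M} {Ω : Set (Eucl n)} (hφ : IsParam I φ Ω)
    {y : Eucl n} (hy : y ∈ Ω) {α : ℝ≥0} (hg : IsCkHolderLocTensor I 2 α (metricTensor I M))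
    (K : TwoTensor I M) {u f : M → ℝ} (hu : ContMDiffAt I 𝓘(ℝ, ℝ) 2 u (φ y))
    (hf : ContMDiffAt I 𝓘(ℝ, ℝ) 2 f (φ y)) :
    jangOperator I K u f (φ y) =
      LocalCoords.jang (tensorComponents I φ univ (metricTensor I M))
        (tensorComponents I φ univ K) (u ∘ φ) (f ∘ φ) y := by
  have hq := hφ.eventually_mem_source hy
  have hip := hφ.isInteriorPoint hy
  have hint := (I.isInteriorPoint_iff).1 hip
  have hτ := hφ.contDiffAt_transition hy (mem_chart_source H (φ y))
  have hinj := hφ.injective_fderiv_transition hy hq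
  have hG : ContDiffAt ℝ 2 (chartComponents I (φ y) (metricTensor I M))
      (extChartAt I (φ y) (φ y)) := (hg (φ y)).1.contDiffAt (mem_interior_iff_mem_nhds.1 hint)
  have hpos : ∀ v : Eucl n, v ≠ 0 →
      0 < bilin (chartComponents I (φ y) (metricTensor I M) (extChartAt I (φ y) (φ y))) v v := by
    intro v hv
    have hsurj := LinearMap.surjective_of_injective
      (f := (fderiv ℝ (fun z => extChartAt I (φ y) (φ z)) y).toLinearMap) hinj
    obtain ⟨w, hw⟩ := hsurj v
    have hw' : fderiv ℝ (fun z => extChartAt I (φ y) (φ z)) y w = v := hw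
    rw [← hw', ← LocalCoords.bilin_pullback (σ := fun z => extChartAt I (φ y) (φ z)),
      ← hφ.tensorComponents_eq_pullback hy hq]
    refine bilin_metric_pos (hφ.injective y hy) ?_
    rintro rfl
    exact hv (by rw [← hw', map_zero])
  have h1 := LocalCoords.jang_pullback (σ := fun z => extChartAt I (φ y) (φ z))
    (K := chartComponents I (φ y) K)
    (hτ.of_le (WithTop.coe_le_coe.2 le_top : ((2 : ℕ∞) : WithTop ℕ∞) ≤ ∞)) hinj (hG.differentiableAt (by norm_num))
    (tensorComponents_symm metricTensor_symm _ _ _) hpos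
    (contDiffAt_comp_extChartAt_symm hf hip)
    ((contDiffAt_comp_extChartAt_symm hu hip).differentiableAt (by norm_num))
  have h2 : ∀ h : M → ℝ, (h ∘ (extChartAt I (φ y)).symm) ∘ (fun z => extChartAt I (φ y) (φ z))
      =ᶠ[𝓝 y] h ∘ φ := by
    intro h
    filter_upwards [hq] with z hz
    simp only [Function.comp_apply, (extChartAt I (φ y)).left_inv hz]
  have h3 : ∀ h : TwoTensor I M, LocalCoords.pullback (fun z => extChartAt I (φ y) (φ z))
      (chartComponents I (φ y) h) =ᶠ[𝓝 y] tensorComponents I φ univ h := by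
    intro h
    filter_upwards [hq.eventually_nhds, hφ.isOpen.mem_nhds hy] with z hz hzΩ
    exact (hφ.tensorComponents_eq_pullback hzΩ hz h).symm
  rw [LocalCoords.jang_congr (h3 _) (h3 K).self_of_nhds (h2 u) (h2 f)] at h1
  rw [h1]
  rfl

omit [IsManifold I ∞ M] in
/-- The norm of the warped differential in a smooth parametrization. -/
lemma IsParam.warpedGradNorm_le {φ : Eucl n → M} {Ω : Set (Eucl n)} (hφ : IsParam I φ Ω)
    {y : Eucl n} (hy : y ∈ Ω) {u f : M → ℝ} (hf : MDifferentiableAt I 𝓘(ℝ, ℝ) f (φ y)) :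
    warpedGradNorm I u f (φ y) ≤ Real.sqrt (u (φ y) ^ 2 *
      LocalCoords.normSqD (tensorComponents I φ univ (metricTensor I M)) (f ∘ φ) y) := by
  obtain ⟨G, hG⟩ : ∃ G, G = tensorComponents I φ univ (metricTensor I M) := ⟨_, rfl⟩
  have hs : ∀ i j, G y i j = G y j i := by
    rw [hG]
    exact tensorComponents_symm metricTensor_symm _ _ _
  have hpos : ∀ v : Eucl n, v ≠ 0 → 0 < bilin (G y) v v := by
    rw [hG]
    exact fun v hv => bilin_metric_pos (hφ.injective y hy) hv
  have hdet := isUnit_det_of_pos _ hs hpos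
  obtain ⟨N, hN⟩ : ∃ N, N = LocalCoords.gradVec G (f ∘ φ) y := ⟨_, rfl⟩
  have hNv : ∀ v, bilin (G y) N v = fderiv ℝ (f ∘ φ) y v := fun v => by
    rw [hN]
    exact LocalCoords.bilin_grad_left hs hdet v
  have hNN : LocalCoords.normSqD G (f ∘ φ) y = bilin (G y) N N := by
    rw [LocalCoords.normSqD_eq, ← hN, hNv]
  unfold warpedGradNorm
  rw [← hG, hNN]
  have hb : ∀ v, bilin (G y) v v = ‖(mfderiv 𝓘(ℝ, Eucl n) I φ y v : TangentSpace I (φ y))‖ ^ 2 :=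
    fun v => by rw [hG, bilin_metric_self]
  -- Cauchy–Schwarz in the tangent space: as the image of `N` represents `df`, its length bounds the
  -- dual norm.
  have h2 : ∀ w : Eucl n, |bilin (G y) N w| ≤
      ‖(mfderiv 𝓘(ℝ, Eucl n) I φ y N : TangentSpace I (φ y))‖ *
      ‖(mfderiv 𝓘(ℝ, Eucl n) I φ y w : TangentSpace I (φ y))‖ := fun w => by
    rw [hG, bilin_tensorComponents, mfderivWithin_univ]
    exact abs_real_inner_le_norm (F := TangentSpace I (φ y)) _ _
  refine ContinuousLinearMap.opNorm_le_bound _ (Real.sqrt_nonneg _) fun X => ?_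
  obtain ⟨w, hw⟩ : ∃ w : Eucl n, mfderiv 𝓘(ℝ, Eucl n) I φ y w = X := hφ.surjective hy X
  have h1 : covector I f (φ y) X = fderiv ℝ (f ∘ φ) y w := by
    rw [← hw, ← mfderiv_eq_fderiv, mfderiv_comp y hf (hφ.mdifferentiableAt hy)]
    rfl
  have h3 := mul_le_mul_of_nonneg_left (h2 w) (abs_nonneg (u (φ y)))
  rw [hNv, ← h1, hw] at h3
  rw [smul_apply, norm_smul, hb, ← mul_pow, Real.sqrt_sq_eq_abs, abs_mul,
    abs_norm, mul_assoc]
  exact h3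

end Metric

end Param

namespace LocalCoords

lemma normSqD_const_mul {n : ℕ} (g : Eucl n → Fin n → Fin n → ℝ) (f : Eucl n → ℝ) (y : Eucl n)
    (s : ℝ) : normSqD g (fun z => s * f z) y = s ^ 2 * normSqD g f y := by
  simp only [normSqD, grad, partialDeriv_const_mul, Finset.mul_sum, Finset.sum_mul]
  exact Finset.sum_congr rfl fun i _ => Finset.sum_congr rfl fun j _ => by ring

end LocalCoords

lemma JetBound.of_eCkNorm_le {E V : Type*} [NormedAddCommGroup E] [NormedSpace ℝ E]
    [NormedAddCommGroup V] [NormedSpace ℝ V] {k : ℕ} {C : ℝ} {F : E → V} {s : Set E} {y : E}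
    (hs : s ∈ 𝓝 y) (hF : ContDiffAt ℝ k F y) (hC : 0 ≤ C)
    (h : eCkNorm k s F ≤ ENNReal.ofReal C) : JetBound k C F y := by
  refine ⟨hF, fun j hj => ?_⟩
  have h1 : iteratedFDerivWithin ℝ j F s y = iteratedFDeriv ℝ j F y := by
    rw [← iteratedFDerivWithin_univ]
    exact iteratedFDerivWithin_congr_set (Filter.eventuallyEq_univ.2 hs) j
  have h2 : ‖iteratedFDerivWithin ℝ j F s y‖ₑ ≤ eCkNorm k s F := by
    refine le_trans ?_ (Finset.single_le_sum (fun i _ => zero_le) (Finset.mem_range_succ_iff.2 hj))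
    exact le_iSup₂ (f := fun z (_ : z ∈ s) => ‖iteratedFDerivWithin ℝ j F s z‖ₑ) y
      (mem_of_mem_nhds hs)
  rw [h1] at h2
  rw [← ENNReal.ofReal_le_ofReal_iff hC, ofReal_norm]
  exact h2.trans h

/-! ### The local estimate on the manifold. -/

section Param

variable {n : ℕ} {H : Type*} [TopologicalSpace H] {I : ModelWithCorners ℝ (Eucl n) H}
  {M : Type*} [TopologicalSpace M] [ChartedSpace H M] [IsManifold I ∞ M]

section Nhds

variable {φ : Eucl n → M} {Ω : Set (Eucl n)}

/-- A parametrization is open by the inverse function theorem in a chart. A property proved at `φ q`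
for all `q` near `y` thus holds at all points near `φ y`. -/
lemma IsParam.nhds_le_map (hφ : IsParam I φ Ω) {y : Eucl n} (hy : y ∈ Ω) :
    𝓝 (φ y) ≤ Filter.map φ (𝓝 y) := by
  have hq := hφ.eventually_mem_source hy
  have h1 : HasStrictFDerivAt (fun z => extChartAt I (φ y) (φ z)) _ y :=
    (hφ.contDiffAt_transition hy (mem_chart_source H (φ y))).hasStrictFDerivAt (by simp)
  have h2 := LinearMap.surjective_of_injective
    (f := (fderiv ℝ (fun z => extChartAt I (φ y) (φ z)) y).toLinearMap)
    (hφ.injective_fderiv_transition hy hq)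
  have h3 := h1.map_nhds_eq_of_surj (LinearMap.range_eq_top.2 h2)
  have h4 := map_extChartAt_symm_nhdsWithin_range (I := I) (φ y)
  rw [nhdsWithin_eq_nhds.2 (range_mem_nhds_isInteriorPoint (hφ.isInteriorPoint hy)), ← h3,
    Filter.map_map] at h4
  rw [← h4]
  refine (Filter.map_congr ?_).le
  filter_upwards [hq] with z hz
  exact (extChartAt I (φ y)).left_inv hz

end Nhds

variable [RiemannianBundle (fun x : M => TangentSpace I x)]

/-- The local gradient estimate in a smooth parametrization with controlled geometry. The number
`s` rescales the vertical direction. -/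
theorem exists_warpedGradNorm_bound {α : ℝ≥0}
    (hg : IsCkHolderLocTensor I 2 α (metricTensor I M)) {K : TwoTensor I M}
    (hK : ∀ x v w, K x v w = K x w v) {r lam Λ m T : ℝ} (hr : 0 < r) (hlam : 0 < lam)
    (hΛ : 0 < Λ) (hm : 0 < m) (hT : 0 < T) :
    ∃ C : ℝ, ∀ (φ : Eucl n → M) (Ω : Set (Eucl n)) (y₀ : Eucl n) (s ε : ℝ) (u f : M → ℝ),
      IsParam I φ Ω → Metric.ball y₀ r ⊆ Ω → 0 < s → s ≤ 1 → 0 ≤ ε → ε ≤ 1 →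
      ContMDiff I 𝓘(ℝ, ℝ) 2 u →
      (∀ y ∈ Metric.ball y₀ r,
        JetBound 2 Λ (tensorComponents I φ univ (metricTensor I M)) y ∧
        (∀ v, lam * ‖v‖ ^ 2 ≤ bilin (tensorComponents I φ univ (metricTensor I M) y) v v) ∧
        JetBound 1 Λ (tensorComponents I φ univ K) y ∧
        JetBound 2 Λ (fun z => s * u (φ z)) y ∧ m ≤ s * u (φ y) ∧
        ContMDiffAt I 𝓘(ℝ, ℝ) 3 f (φ y) ∧ jangOperator I K u f (φ y) = ε * f (φ y) ∧
        |u (φ y) * f (φ y)| ≤ T) →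
      warpedGradNorm I u f (φ y₀) ≤ C := by
  obtain ⟨C, hC⟩ := LocalCoords.exists_local_gradient_bound n hr hlam hΛ hm hT
  refine ⟨Real.sqrt C, ?_⟩
  intro φ Ω y₀ s ε u f hφ hΩ hs0 hs1 hε0 hε1 hu h
  have hy₀ : y₀ ∈ Metric.ball y₀ r := Metric.mem_ball_self hr
  have hf0 := (h y₀ hy₀).2.2.2.2.2.1
  refine (hφ.warpedGradNorm_le (hΩ hy₀) (hf0.mdifferentiableAt (by norm_num))).trans
    (Real.sqrt_le_sqrt ?_)
  -- The estimate is applied to `s u` and `s⁻¹ f`. The right-hand side `ε f` becomes `(ε s) (s⁻¹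
  -- f)`, and `s ≤ 1` keeps `ε s ≤ 1`.
  have key := hC (tensorComponents I φ univ (metricTensor I M)) (tensorComponents I φ univ K)
    (fun z => s * u (φ z)) (fun z => s⁻¹ * f (φ z)) y₀ (ε * s) (by positivity)
    (mul_le_one₀ hε1 hs0.le hs1) ?_
  · rw [LocalCoords.normSqD_const_mul] at key
    refine le_of_eq_of_le ?_ key
    simp only [Function.comp_def]
    field_simp
  intro y hy
  obtain ⟨h1, h2, h3, h4, h5, h6, h7, h8⟩ := h y hy
  have hfy : ContDiffAt ℝ 3 (f ∘ φ) y := by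
    rw [← contMDiffAt_iff_contDiffAt]
    exact h6.comp y ((hφ.contMDiffAt (hΩ hy)).of_le
      (WithTop.coe_le_coe.2 le_top : ((3 : ℕ∞) : WithTop ℕ∞) ≤ ∞))
  refine ⟨h1, tensorComponents_symm metricTensor_symm _ _ _, h2, h3,
    tensorComponents_symm hK _ _ _, h4, h5, contDiffAt_const.mul hfy, ?_, ?_⟩
  · have e := hφ.jangOperator_eq (hΩ hy) hg K (f := f) (hu.contMDiffAt) (h6.of_le (by norm_num))
    rw [h7] at e
    have e2 := LocalCoords.jang_scale (g := tensorComponents I φ univ (metricTensor I M))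
      (K := tensorComponents I φ univ K) (u := u ∘ φ) (f := f ∘ φ) (y := y) hs0.ne'
    simp only [Function.comp_def] at e e2
    rw [e2, ← e]
    field_simp
  · rw [show s * u (φ y) * (s⁻¹ * f (φ y)) = u (φ y) * f (φ y) by field_simp]
    exact h8

end Param

/-- The minimum over the compact product of `S` with the unit sphere is positive; homogeneity does
the rest. -/
lemma exists_bilin_lower_bound {n : ℕ} {G : Eucl n → Fin n → Fin n → ℝ} {S : Set (Eucl n)}
    (hS : IsCompact S) (hG : ContinuousOn G S)
    (hpos : ∀ y ∈ S, ∀ v : Eucl n, v ≠ 0 → 0 < bilin (G y) v v) :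
    ∃ lam : ℝ, 0 < lam ∧ ∀ y ∈ S, ∀ v, lam * ‖v‖ ^ 2 ≤ bilin (G y) v v := by
  have hc : ContinuousOn (fun p : Eucl n × Eucl n => bilin (G p.1) p.2 p.2)
      (S ×ˢ Metric.sphere 0 1) := by
    unfold bilin
    refine continuousOn_finsetSum _ fun i _ => continuousOn_finsetSum _ fun j _ => ?_
    have h1 : ContinuousOn (fun p : Eucl n × Eucl n => G p.1 i j) (S ×ˢ Metric.sphere 0 1) :=
      ((continuous_apply_apply i j).comp_continuousOn hG).comp continuousOn_fst
        fun p hp => hp.1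
    exact (h1.mul (by fun_prop)).mul (by fun_prop)
  have h1 : ∃ lam : ℝ, 0 < lam ∧ ∀ p ∈ S ×ˢ Metric.sphere (0 : Eucl n) 1,
      lam ≤ bilin (G p.1) p.2 p.2 := by
    rcases (S ×ˢ Metric.sphere (0 : Eucl n) 1).eq_empty_or_nonempty with h | h
    · exact ⟨1, one_pos, by simp [h]⟩
    obtain ⟨p, hp, hmin⟩ := (hS.prod (isCompact_sphere 0 1)).exists_isMinOn h hc
    refine ⟨_, hpos p.1 hp.1 p.2 ?_, fun q hq => hmin hq⟩
    exact ne_zero_of_mem_unit_sphere ⟨p.2, hp.2⟩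
  obtain ⟨lam, hlam, h⟩ := h1
  refine ⟨lam, hlam, fun y hy v => ?_⟩
  rcases eq_or_ne v 0 with rfl | hv
  · simp [bilin]
  have hv' := norm_pos_iff.2 hv
  have h2 := h (y, ‖v‖⁻¹ • v) ⟨hy, by simp [norm_smul, hv'.ne']⟩
  simp only [bilin_smul_left, bilin_smul_right] at h2
  calc lam * ‖v‖ ^ 2 ≤ (‖v‖⁻¹ * (‖v‖⁻¹ * bilin (G y) v v)) * ‖v‖ ^ 2 := by gcongr
    _ = bilin (G y) v v := by field_simp

/-! ### Solutions on geodesic balls and the estimate near one point. -/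

section Param

variable {n : ℕ} {H : Type*} [TopologicalSpace H] (I : ModelWithCorners ℝ (Eucl n) H)
  {M : Type*} [EMetricSpace M] [ChartedSpace H M]
  [RiemannianBundle (fun x : M => TangentSpace I x)]

/-- `f` solves `𝒥(f) = ε f` on the geodesic ball of radius `R` about `x`, which lies in the
interior of the manifold, and `|u f| ≤ T` there. -/
structure IsJangSolution (K : TwoTensor I M) (u f : M → ℝ) (x : M) (R T ε : ℝ) : Prop where
  eball_subset : Metric.eball x (ENNReal.ofReal R) ⊆ I.interior M
  nonneg : 0 ≤ ε
  le_one : ε ≤ 1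
  contMDiffOn : ContMDiffOn I 𝓘(ℝ, ℝ) 3 f (Metric.eball x (ENNReal.ofReal R))
  jang_eq : ∀ y ∈ Metric.eball x (ENNReal.ofReal R), jangOperator I K u f y = ε * f y
  abs_le : ∀ y ∈ Metric.eball x (ENNReal.ofReal R), |u y * f y| ≤ T

variable {I} [IsManifold I ∞ M]

/-- The gradient estimate near a point which has a parametrization where `u - w` is controlled. -/
lemma IsParam.eventually_warpedGradNorm_le {α : ℝ≥0}
    (hg : IsCkHolderLocTensor I 2 α (metricTensor I M)) {K : TwoTensor I M}
    (hK : ∀ x v w, K x v w = K x w v) (hKloc : IsCkHolderLocTensor I 1 α K) {w : M → ℝ}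
    (hw : ContMDiff I 𝓘(ℝ, ℝ) 2 w) {Λ m R T : ℝ} (hm : 0 < m) (hR : 0 < R) (hT : 0 < T)
    {φ : Eucl n → M} {Ω : Set (Eucl n)} (hφ : IsParam I φ Ω) {p : Eucl n} (hp : p ∈ Ω) :
    ∃ C : ℝ, ∀ᶠ x in 𝓝 (φ p), ∀ (u f : M → ℝ) (ε : ℝ), ContMDiff I 𝓘(ℝ, ℝ) 2 u →
      (∀ y ∈ Ω, JetBound 2 Λ (fun z => u (φ z) - w (φ z)) y) → (∀ x, m ≤ u x) →
      IsJangSolution I K u f x R T ε → warpedGradNorm I u f x ≤ C := by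
  have hR2 : 0 < ENNReal.ofReal (R / 2) := ENNReal.ofReal_pos.2 (by positivity)
  have hRR : ENNReal.ofReal (R / 2) + ENNReal.ofReal (R / 2) = ENNReal.ofReal R := by
    rw [← ENNReal.ofReal_add (by positivity) (by positivity), add_halves]
  have h1 : Ω ∩ φ ⁻¹' Metric.eball (φ p) (ENNReal.ofReal (R / 2)) ∈ 𝓝 p :=
    Filter.inter_mem (hφ.isOpen.mem_nhds hp)
      ((hφ.contMDiffAt hp).continuousAt (Metric.eball_mem_nhds _ hR2))
  obtain ⟨δ, hδ, hδs⟩ := Metric.mem_nhds_iff.1 h1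
  -- For every `q` within `r` of `p` the ball of radius `r` about `q` stays in the compact ball of
  -- radius `2 r < δ` about `p`. The latter is mapped within `R / 2` of `φ p`, so the former is
  -- mapped within `R` of `φ q`.
  obtain ⟨r, hr⟩ : ∃ r, r = δ / 3 := ⟨_, rfl⟩
  have hr0 : 0 < r := by rw [hr]; positivity
  have hcb : Metric.closedBall p (2 * r) ⊆ Metric.ball p δ :=
    Metric.closedBall_subset_ball (by linarith)
  have hcΩ : Metric.closedBall p (2 * r) ⊆ Ω := fun y hy => (hδs (hcb hy)).1
  have hcpt : IsCompact (Metric.closedBall p (2 * r)) := isCompact_closedBall _ _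
  have hg2 : ContDiffOn ℝ 2 (tensorComponents I φ univ (metricTensor I M)) Ω := fun y hy =>
    (hφ.contDiffAt_tensorComponents hy hg).contDiffWithinAt
  have hK1 : ContDiffOn ℝ 1 (tensorComponents I φ univ K) Ω := fun y hy =>
    (hφ.contDiffAt_tensorComponents hy hKloc).contDiffWithinAt
  have hw2 : ContDiffOn ℝ 2 (fun z => w (φ z)) Ω := fun y hy => by
    refine ContDiffAt.contDiffWithinAt ?_
    rw [← contMDiffAt_iff_contDiffAt]
    exact hw.contMDiffAt.comp y ((hφ.contMDiffAt hy).of_le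
      (WithTop.coe_le_coe.2 le_top : ((2 : ℕ∞) : WithTop ℕ∞) ≤ ∞))
  obtain ⟨C₁, hC₁⟩ := JetBound.exists_of_isCompact (k := 2) hφ.isOpen hg2 hcpt hcΩ
  obtain ⟨C₂, hC₂⟩ := JetBound.exists_of_isCompact (k := 1) hφ.isOpen hK1 hcpt hcΩ
  obtain ⟨C₃, hC₃⟩ := JetBound.exists_of_isCompact (k := 2) hφ.isOpen hw2 hcpt hcΩ
  obtain ⟨lam, hlam, hlam'⟩ := exists_bilin_lower_bound hcpt (hg2.continuousOn.mono hcΩ)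
    fun y hy v hv => bilin_metric_pos (hφ.injective y (hcΩ hy)) hv
  obtain ⟨Λ', hΛ'⟩ : ∃ Λ', Λ' = max (max C₁ C₂) (max (Λ + C₃) 1) := ⟨_, rfl⟩
  have hΛ0 : 0 < Λ' := by rw [hΛ']; simp
  obtain ⟨C, hC⟩ := exists_warpedGradNorm_bound hg hK hr0 hlam hΛ0 hm hT
  refine ⟨C, hφ.nhds_le_map hp ?_⟩
  rw [Filter.mem_map]
  filter_upwards [Metric.ball_mem_nhds p hr0] with q hq u f ε hu hJ hmu hf
  have hsub : Metric.ball q r ⊆ Metric.closedBall p (2 * r) := fun z hz => by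
    have := dist_triangle z q p
    have h2 := Metric.mem_ball.1 hz
    have h3 := Metric.mem_ball.1 hq
    exact Metric.mem_closedBall.2 (by linarith)
  refine hC φ Ω q 1 ε u f hφ (hsub.trans hcΩ) one_pos le_rfl hf.nonneg hf.le_one hu ?_
  intro y hy
  have hyc := hsub hy
  have hqc := hsub (Metric.mem_ball_self hr0)
  have hyR : φ y ∈ Metric.eball (φ q) (ENNReal.ofReal R) := by
    refine Metric.mem_eball.2 (lt_of_le_of_lt (edist_triangle_right _ _ (φ p)) ?_)
    rw [← hRR]
    exact ENNReal.add_lt_add (hδs (hcb hyc)).2 (hδs (hcb hqc)).2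
  refine ⟨(hC₁ y hyc).mono (by rw [hΛ']; simp), hlam' y hyc,
    (hC₂ y hyc).mono (by rw [hΛ']; simp), ?_, by simpa using hmu (φ y),
    hf.contMDiffOn.contMDiffAt (Metric.isOpen_eball.mem_nhds hyR), hf.jang_eq _ hyR,
    hf.abs_le _ hyR⟩
  have := (hJ y (hcΩ hyc)).add (hC₃ y hyc)
  simp only [sub_add_cancel] at this
  simp only [one_mul]
  exact this.mono (by rw [hΛ']; simp)

omit [RiemannianBundle (fun x : M => TangentSpace I x)] in
lemma isParam_extChartAt_symm (p : M) {Ω : Set (Eucl n)} (hΩ : IsOpen Ω)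
    (h : Ω ⊆ (extChartAt I p).target) : IsParam I (extChartAt I p).symm Ω := by
  have : IsManifold I 1 M := IsManifold.of_le (n := ∞) (by simp)
  refine ⟨hΩ, (contMDiffOn_extChartAt_symm p).mono h, fun y hy => ?_⟩
  have h1 := isInvertible_mfderivWithin_extChartAt_symm (I := I) (h hy)
  have h2 : range I ∈ 𝓝 y := Filter.mem_of_superset (hΩ.mem_nhds hy)
    (h.trans (extChartAt_target_subset_range p))
  rw [mfderivWithin_of_mem_nhds h2] at h1
  exact h1.injective

end Param

/-! ### Möbius addition in the Poincaré ball. -/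

section HypTranslation

variable {n : ℕ} {x y : Eucl n}

/-- The denominator of `hypTranslation`. -/
noncomputable def hypDenom (x y : Eucl n) : ℝ := 1 + 2 * inner ℝ x y + ‖x‖ ^ 2 * ‖y‖ ^ 2

lemma sq_le_hypDenom (x y : Eucl n) : (1 - ‖x‖ * ‖y‖) ^ 2 ≤ hypDenom x y := by
  have := neg_le_of_abs_le (abs_real_inner_le_norm x y)
  unfold hypDenom
  nlinarith only [this]

lemma one_sub_mul_norm_pos (hx : ‖x‖ < 1) (hy : ‖y‖ < 1) : 0 < 1 - ‖x‖ * ‖y‖ := by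
  have := mul_lt_one_of_nonneg_of_lt_one_left (norm_nonneg x) hx hy.le
  linarith

lemma hypDenom_pos (hx : ‖x‖ < 1) (hy : ‖y‖ < 1) : 0 < hypDenom x y :=
  (pow_pos (one_sub_mul_norm_pos hx hy) 2).trans_le (sq_le_hypDenom x y)

lemma hypTranslation_eq (h : hypDenom x y ≠ 0) : hypTranslation x y =
    x + (1 - ‖x‖ ^ 2) • (hypDenom x y)⁻¹ • (y + ‖y‖ ^ 2 • x) := by
  have h1 : x = (hypDenom x y)⁻¹ • hypDenom x y • x := by
    rw [smul_smul, inv_mul_cancel₀ h, one_smul]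
  conv_rhs => rw [smul_comm]; lhs; rw [h1]
  rw [← smul_add]
  unfold hypTranslation
  change (hypDenom x y)⁻¹ • _ = _
  congr 1
  unfold hypDenom
  module

/-- The basic identity of Möbius addition. It controls both the weight `ρ` and the distance from the
origin after a translation. -/
lemma one_sub_norm_hypTranslation_sq (h : hypDenom x y ≠ 0) :
    1 - ‖hypTranslation x y‖ ^ 2 = (1 - ‖x‖ ^ 2) * (1 - ‖y‖ ^ 2) / hypDenom x y := by
  have h1 : ‖hypTranslation x y‖ ^ 2 = ((hypDenom x y)⁻¹) ^ 2 *
      ‖(1 + 2 * inner ℝ x y + ‖y‖ ^ 2) • x + (1 - ‖x‖ ^ 2) • y‖ ^ 2 := by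
    unfold hypTranslation
    rw [norm_smul, mul_pow, Real.norm_eq_abs, sq_abs]
    rfl
  rw [h1, norm_add_sq_real, norm_smul, norm_smul, real_inner_smul_left, real_inner_smul_right,
    mul_pow, mul_pow, Real.norm_eq_abs, Real.norm_eq_abs, sq_abs, sq_abs]
  field_simp
  unfold hypDenom
  ring

lemma hypRho_hypTranslation (h : hypDenom x y ≠ 0) :
    hypRho (hypTranslation x y) = hypRho x * ((1 - ‖y‖ ^ 2) / hypDenom x y) := by
  unfold hypRho
  rw [one_sub_norm_hypTranslation_sq h]
  ring

lemma norm_hypTranslation_lt_one (hx : ‖x‖ < 1) (hy : ‖y‖ < 1) : ‖hypTranslation x y‖ < 1 := by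
  have h1 := hypDenom_pos hx hy
  have h2 : 0 < 1 - ‖hypTranslation x y‖ ^ 2 := by
    rw [one_sub_norm_hypTranslation_sq h1.ne']
    have := pow_lt_one₀ (norm_nonneg x) hx two_ne_zero
    have := pow_lt_one₀ (norm_nonneg y) hy two_ne_zero
    exact div_pos (mul_pos (by linarith) (by linarith)) h1
  exact lt_of_pow_lt_pow_left₀ 2 zero_le_one (by linarith)

/-- Among all `y` of given norm the translate is closest to the origin when `y` points against `x`,
where its norm is the absolute value of `(‖x‖ - ‖y‖) / (1 - ‖x‖ ‖y‖)`. -/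
lemma lt_norm_hypTranslation (hx : ‖x‖ < 1) (hy : ‖y‖ < 1) {t : ℝ}
    (ht : t * (1 - ‖x‖ * ‖y‖) < ‖x‖ - ‖y‖) (ht0 : 0 ≤ t) : t < ‖hypTranslation x y‖ := by
  have h1 := hypDenom_pos hx hy
  have h2 := one_sub_mul_norm_pos hx hy
  have h3 := sq_le_hypDenom x y
  have h4 := one_sub_norm_hypTranslation_sq h1.ne'
  have hx2 := pow_lt_one₀ (norm_nonneg x) hx two_ne_zero
  have hy2 := pow_lt_one₀ (norm_nonneg y) hy two_ne_zero
  have h5 : (1 - ‖x‖ ^ 2) * (1 - ‖y‖ ^ 2) / hypDenom x y ≤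
      (1 - ‖x‖ ^ 2) * (1 - ‖y‖ ^ 2) / (1 - ‖x‖ * ‖y‖) ^ 2 :=
    div_le_div_of_nonneg_left (mul_nonneg (by linarith) (by linarith)) (pow_pos h2 2) h3
  have h6 : (1 - ‖x‖ ^ 2) * (1 - ‖y‖ ^ 2) / (1 - ‖x‖ * ‖y‖) ^ 2 < 1 - t ^ 2 := by
    rw [div_lt_iff₀ (pow_pos h2 2)]
    have h7 := mul_self_lt_mul_self (mul_nonneg ht0 h2.le) ht
    nlinarith only [h7]
  exact lt_of_pow_lt_pow_left₀ 2 (norm_nonneg _) (by linarith)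

lemma hypTranslation_smul_neg_smul {e : Eucl n} (he : ‖e‖ = 1) {s l : ℝ} (h : 1 - s * l ≠ 0) :
    hypTranslation (s • e) (-l • e) = ((s - l) / (1 - s * l)) • e := by
  unfold hypTranslation
  simp only [norm_smul, real_inner_smul_left, real_inner_smul_right, real_inner_self_eq_norm_sq,
    he, Real.norm_eq_abs, mul_one, sq_abs, smul_smul, ← add_smul]
  congr 1
  have : 1 + 2 * (-l * (s * 1 ^ 2)) + s ^ 2 * (-l) ^ 2 = (1 - s * l) ^ 2 := by ring
  rw [this]
  field_simp
  ring

lemma contDiffAt_hypDenom (x y : Eucl n) : ContDiffAt ℝ ∞ (hypDenom x) y := by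
  unfold hypDenom
  have h2 := contDiff_norm_sq ℝ (E := Eucl n) (n := ∞)
  have h3 : ContDiff ℝ ∞ fun z => inner ℝ x z := (innerSL ℝ x).contDiff
  fun_prop

lemma contDiffAt_hypTranslation (h : hypDenom x y ≠ 0) : ContDiffAt ℝ ∞ (hypTranslation x) y := by
  have h1 := (contDiffAt_hypDenom x y).inv h
  have h2 := contDiff_norm_sq ℝ (E := Eucl n) (n := ∞)
  have h3 : ContDiff ℝ ∞ fun z => inner ℝ x z := (innerSL ℝ x).contDiff
  unfold hypTranslation
  exact h1.smul (by fun_prop)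

lemma hasFDerivAt_hypDenom (x y : Eucl n) :
    HasFDerivAt (hypDenom x) ((2 : ℝ) • (innerSL ℝ x + ‖x‖ ^ 2 • innerSL ℝ y)) y := by
  have h1 : HasFDerivAt (fun z : Eucl n => ‖z‖ ^ 2) (2 • innerSL ℝ y) y :=
    (hasStrictFDerivAt_norm_sq y).hasFDerivAt
  have h2 := (((innerSL ℝ x).hasFDerivAt (x := y)).const_mul 2).const_add 1 |>.add
    (h1.const_mul (‖x‖ ^ 2))
  refine h2.congr_fderiv ?_
  ext v
  simp
  ring

/-- The derivative of the hyperbolic translation. -/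
lemma fderiv_hypTranslation (h : hypDenom x y ≠ 0) (v : Eucl n) :
    fderiv ℝ (hypTranslation x) y v = ((1 - ‖x‖ ^ 2) * ((hypDenom x y)⁻¹) ^ 2) •
      (hypDenom x y • (v + (2 * inner ℝ y v) • x) -
        (2 * (inner ℝ x v + ‖x‖ ^ 2 * inner ℝ y v)) • (y + ‖y‖ ^ 2 • x)) := by
  have h1 : HasFDerivAt (fun z : Eucl n => ‖z‖ ^ 2) (2 • innerSL ℝ y) y :=
    (hasStrictFDerivAt_norm_sq y).hasFDerivAt
  have h2 := (hasFDerivAt_id y).add (h1.smul_const x)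
  have h3 := (hasDerivAt_inv h).comp_hasFDerivAt y (hasFDerivAt_hypDenom x y)
  have h4 := ((h3.smul h2).const_smul (1 - ‖x‖ ^ 2)).const_add x
  have h5 : hypTranslation x =ᶠ[𝓝 y] fun z => x + (1 - ‖x‖ ^ 2) •
      ((hypDenom x z)⁻¹ • (z + ‖z‖ ^ 2 • x)) := by
    filter_upwards [(contDiffAt_hypDenom x y).continuousAt.eventually_ne h] with z hz
    exact hypTranslation_eq hz
  have h6 := (h4.congr_of_eventuallyEq h5).fderiv
  rw [h6]
  have h7 : (hypDenom x y)⁻¹ = (hypDenom x y ^ 2)⁻¹ * hypDenom x y := by field_simp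
  simp only [smul_apply, add_apply, Function.comp_apply, ContinuousLinearMap.smulRight_apply,
    innerSL_apply_apply, ContinuousLinearMap.coe_id', id_eq, Pi.add_apply, smul_eq_mul,
    nsmul_eq_mul, Nat.cast_ofNat, inv_pow]
  rw [h7]
  generalize (hypDenom x y ^ 2)⁻¹ = k
  module

/-- Hyperbolic translations are conformal. After squaring, the claim is a polynomial identity in the
norms and inner products of `x`, `y`, `v`. -/
lemma norm_fderiv_hypTranslation (h : 0 < hypDenom x y) (hx : ‖x‖ < 1) (v : Eucl n) :
    ‖fderiv ℝ (hypTranslation x) y v‖ = (1 - ‖x‖ ^ 2) / hypDenom x y * ‖v‖ := by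
  have hx2 := pow_lt_one₀ (norm_nonneg x) hx two_ne_zero
  have h0 : 0 ≤ (1 - ‖x‖ ^ 2) / hypDenom x y := div_nonneg (by linarith) h.le
  have key : ‖hypDenom x y • (v + (2 * inner ℝ y v) • x) -
      (2 * (inner ℝ x v + ‖x‖ ^ 2 * inner ℝ y v)) • (y + ‖y‖ ^ 2 • x)‖ ^ 2 =
      (hypDenom x y * ‖v‖) ^ 2 := by
    simp only [norm_sub_sq_real, norm_add_sq_real, norm_smul, real_inner_smul_left,
      real_inner_smul_right, inner_add_left, inner_add_right, mul_pow, Real.norm_eq_abs, sq_abs,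
      real_inner_self_eq_norm_sq, real_inner_comm x v, real_inner_comm y v, real_inner_comm x y]
    unfold hypDenom
    generalize inner ℝ x v = a
    generalize inner ℝ y v = b
    generalize inner ℝ x y = c
    ring
  rw [fderiv_hypTranslation h.ne', norm_smul, Real.norm_eq_abs,
    (pow_left_inj₀ (norm_nonneg _) (mul_nonneg h.le (norm_nonneg v)) two_ne_zero).1 key,
    abs_of_nonneg (mul_nonneg (by linarith) (by positivity))]
  field_simp

lemma inner_fderiv_hypTranslation (h : 0 < hypDenom x y) (hx : ‖x‖ < 1) (v w : Eucl n) :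
    inner ℝ (fderiv ℝ (hypTranslation x) y v) (fderiv ℝ (hypTranslation x) y w) =
      ((1 - ‖x‖ ^ 2) / hypDenom x y) ^ 2 * inner ℝ v w := by
  have h1 := norm_fderiv_hypTranslation h hx
  have h2 := congrArg (fun t => t ^ 2) (h1 (v + w))
  simp only [mul_pow, map_add, norm_add_sq_real, h1] at h2
  linarith only [h2]

lemma injective_fderiv_hypTranslation (h : 0 < hypDenom x y) (hx : ‖x‖ < 1) :
    Function.Injective (fderiv ℝ (hypTranslation x) y) := by
  refine (injective_iff_map_eq_zero _).2 fun v hv => ?_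
  have hx2 := pow_lt_one₀ (norm_nonneg x) hx two_ne_zero
  have h1 := norm_fderiv_hypTranslation h hx v
  rw [hv, norm_zero] at h1
  have h2 : 0 < (1 - ‖x‖ ^ 2) / hypDenom x y := div_pos (by linarith) h
  exact norm_eq_zero.1 ((mul_eq_zero.1 h1.symm).resolve_left h2.ne')

lemma tanh_half_pos : 0 < Real.tanh (1 / 2) := by
  rw [Real.tanh_eq_sinh_div_cosh]
  exact div_pos (Real.sinh_pos_iff.2 (by norm_num)) (Real.cosh_pos _)

lemma norm_lt_one_of_mem_hypUnitBall (hy : y ∈ hypUnitBall n) : ‖y‖ < 1 :=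
  (mem_ball_zero_iff.1 hy).trans (Real.tanh_lt_one _)

/-- The hyperbolic translations are isometries of the Poincaré ball. -/
lemma tensorComponents_hypMetric (hx : ‖x‖ < 1) (hy : y ∈ hypUnitBall n) :
    tensorComponents 𝓘(ℝ, Eucl n) (hypTranslation x) (hypUnitBall n) (hypMetric n) y =
      fun i j => 4 / (1 - ‖y‖ ^ 2) ^ 2 * inner ℝ (coordVec i) (coordVec j : Eucl n) := by
  have hy1 := norm_lt_one_of_mem_hypUnitBall hy
  have hD := hypDenom_pos hx hy1
  have hx2 := pow_lt_one₀ (norm_nonneg x) hx two_ne_zero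
  have hy2 := pow_lt_one₀ (norm_nonneg y) hy1 two_ne_zero
  rw [tensorComponents_of_mem_nhds (s := hypUnitBall n) (Metric.isOpen_ball.mem_nhds hy)]
  funext i j
  unfold tensorComponents
  rw [mfderivWithin_univ, mfderiv_eq_fderiv]
  change 4 / (1 - ‖hypTranslation x y‖ ^ 2) ^ 2 *
    inner ℝ (fderiv ℝ (hypTranslation x) y (coordVec i))
      (fderiv ℝ (hypTranslation x) y (coordVec j)) = _
  rw [inner_fderiv_hypTranslation hD hx, one_sub_norm_hypTranslation_sq hD.ne']
  have h1 : 1 - ‖x‖ ^ 2 ≠ 0 := by linarith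
  have h2 : 1 - ‖y‖ ^ 2 ≠ 0 := by linarith
  field_simp

lemma tanh_add_half (R : ℝ) : Real.tanh ((R + 1) / 2) =
    (Real.tanh (R / 2) + Real.tanh (1 / 2)) / (1 + Real.tanh (R / 2) * Real.tanh (1 / 2)) := by
  rw [add_div, Real.tanh_eq_sinh_div_cosh, Real.tanh_eq_sinh_div_cosh, Real.tanh_eq_sinh_div_cosh,
    Real.sinh_add, Real.cosh_add]
  have h1 := (Real.cosh_pos (R / 2)).ne'
  have h2 := (Real.cosh_pos (1 / 2)).ne'
  field_simp

lemma tanh_half_nonneg {R : ℝ} (hR : 0 ≤ R) : 0 ≤ Real.tanh (R / 2) := by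
  rw [Real.tanh_eq_sinh_div_cosh]
  exact div_nonneg (Real.sinh_nonneg_iff.2 (by linarith)) (Real.cosh_pos _).le

/-- The triangle inequality for the hyperbolic distance, in the form of the addition formula for
`tanh`. -/
lemma hypTranslation_mem_hypExterior {R : ℝ} (hR : 0 ≤ R)
    (hx0 : Real.tanh ((R + 1) / 2) ≤ ‖x‖) (hx1 : ‖x‖ < 1) (hy : ‖y‖ < Real.tanh (1 / 2)) :
    hypTranslation x y ∈ hypExterior n R := by
  have ht := tanh_half_pos
  have ht1 := Real.tanh_lt_one (1 / 2)
  have hy1 := hy.trans ht1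
  have h0 := tanh_half_nonneg hR
  have h01 := Real.tanh_lt_one (R / 2)
  refine ⟨lt_norm_hypTranslation hx1 hy1 ?_ h0, norm_hypTranslation_lt_one hx1 hy1⟩
  rw [tanh_add_half, div_le_iff₀ (by positivity)] at hx0
  have h2 : 0 < (Real.tanh (1 / 2) - ‖y‖) * (1 - Real.tanh (R / 2) * ‖x‖) := by
    refine mul_pos (by linarith) ?_
    have := mul_lt_one_of_nonneg_of_lt_one_left h0 h01 hx1.le
    linarith
  nlinarith only [hx0, h2]

/-- Every point outside the geodesic ball of radius `R` is in the geodesic unit ball about some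
point outside the geodesic ball of radius `R + 1`, which is not much farther away. -/
lemma exists_hypTranslation_eq {R : ℝ} (hR : 0 ≤ R) {z : Eucl n} (hz : z ∈ hypExterior n R) :
    ∃ x ∈ hypExterior n (R + 1), ∃ y ∈ hypUnitBall n, hypTranslation x y = z ∧
      ‖x‖ ≤ (‖z‖ + Real.tanh (1 / 2)) / (1 + ‖z‖ * Real.tanh (1 / 2)) := by
  obtain ⟨hz0, hz1⟩ := hz
  have ht := tanh_half_pos
  have ht1 := Real.tanh_lt_one (1 / 2)
  have h0 := tanh_half_nonneg hR
  have hzp : 0 < ‖z‖ := h0.trans_lt hz0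
  obtain ⟨τ, hτ⟩ : ∃ τ, τ = Real.tanh (1 / 2) := ⟨_, rfl⟩
  obtain ⟨t, htz⟩ : ∃ t, t = ‖z‖ := ⟨_, rfl⟩
  have hs0 := tanh_add_half R
  have hs1 := Real.tanh_lt_one ((R + 1) / 2)
  obtain ⟨t₀, ht₀⟩ : ∃ t₀, t₀ = Real.tanh (R / 2) := ⟨_, rfl⟩
  rw [← hτ, ← ht₀] at hs0
  rw [← hτ] at ht ht1
  rw [← htz] at hz0 hz1 hzp
  rw [← ht₀] at hz0 h0
  have hb : max ((t₀ + τ) / (1 + t₀ * τ)) t < (t + τ) / (1 + t * τ) := by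
    refine max_lt ?_ ?_
    · rw [div_lt_div_iff₀ (by positivity) (by positivity)]
      have : 0 < (t - t₀) * (1 - τ * τ) := mul_pos (by linarith) (by nlinarith)
      nlinarith only [this]
    · rw [lt_div_iff₀ (by positivity)]
      have : 0 < τ * (1 - t * t) := mul_pos ht (by nlinarith)
      nlinarith only [this]
  have hb1 : (t + τ) / (1 + t * τ) < 1 := by
    rw [div_lt_one (by positivity)]
    have : 0 < (1 - t) * (1 - τ) := mul_pos (by linarith) (by linarith)
    nlinarith only [this]
  -- `x` is placed on the ray through `z` at Euclidean radius `s`, and `y` points back to `z`. The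
  -- radius must exceed both that of the removed ball and `‖z‖`, yet stay within hyperbolic distance
  -- `1` of `z`; `hb` says that such radii exist.
  obtain ⟨s, hs, hs'⟩ := exists_between hb
  have hss := (le_max_left _ _).trans_lt hs
  have hst := (le_max_right _ _).trans_lt hs
  have hs1' := hs'.trans hb1
  have h1st : 0 < 1 - s * t := by nlinarith
  have hl : (s - t) / (1 - s * t) < τ := by
    rw [div_lt_iff₀ h1st]
    rw [lt_div_iff₀ (by positivity)] at hs'
    nlinarith only [hs']
  have hl0 : 0 ≤ (s - t) / (1 - s * t) := div_nonneg (by linarith) h1st.le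
  obtain ⟨l, hlv⟩ : ∃ l, l = (s - t) / (1 - s * t) := ⟨_, rfl⟩
  obtain ⟨e, he⟩ : ∃ e, e = t⁻¹ • z := ⟨_, rfl⟩
  have he1 : ‖e‖ = 1 := by
    rw [he, norm_smul, ← htz, Real.norm_eq_abs, abs_of_pos (by positivity), inv_mul_cancel₀ hzp.ne']
  have hs0' : 0 < s := hzp.trans hst
  refine ⟨s • e, ⟨?_, ?_⟩, -l • e, ?_, ?_, ?_⟩
  · rw [norm_smul, he1, mul_one, Real.norm_eq_abs, abs_of_pos hs0', hs0]
    exact hss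
  · rw [norm_smul, he1, mul_one, Real.norm_eq_abs, abs_of_pos hs0']
    exact hs1'
  · rw [hypUnitBall, mem_ball_zero_iff, norm_smul, he1, mul_one, Real.norm_eq_abs, abs_neg,
      hlv, abs_of_nonneg hl0, ← hτ]
    exact hl
  swap
  · rw [norm_smul, he1, mul_one, Real.norm_eq_abs, abs_of_pos hs0', ← htz, ← hτ]
    exact hs'.le
  have h1sl : (1 - s * l) = (1 - s * s) / (1 - s * t) := by
    rw [hlv]
    field_simp
    ring
  have h1ss : 0 < 1 - s * s := by nlinarith
  rw [hypTranslation_smul_neg_smul he1 (by rw [h1sl]; positivity), h1sl, hlv, he, smul_smul]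
  have : (s - (s - t) / (1 - s * t)) / ((1 - s * s) / (1 - s * t)) = t := by
    have h1 : s - (s - t) / (1 - s * t) = t * (1 - s * s) / (1 - s * t) := by
      field_simp
      ring
    rw [h1, div_div_div_cancel_right₀ h1st.ne', mul_div_assoc, div_self h1ss.ne', mul_one]
  rw [this, mul_inv_cancel₀ hzp.ne', one_smul]

end HypTranslation

/-! ### Parametrizations of the end and decay of the data. -/

section End

variable {n : ℕ} {H : Type*} [TopologicalSpace H] {I : ModelWithCorners ℝ (Eucl n) H}
  {M : Type*} [TopologicalSpace M] [ChartedSpace H M]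

lemma IsParam.comp {φ : Eucl n → M} {Ω Ω' : Set (Eucl n)} (hφ : IsParam I φ Ω)
    {σ : Eucl n → Eucl n} (hΩ' : IsOpen Ω') (hσ : ∀ y ∈ Ω', ContDiffAt ℝ ∞ σ y)
    (hmaps : MapsTo σ Ω' Ω) (hinj : ∀ y ∈ Ω', Function.Injective (fderiv ℝ σ y)) :
    IsParam I (fun y => φ (σ y)) Ω' := by
  refine ⟨hΩ', hφ.contMDiffOn.comp (contMDiffOn_iff_contDiffOn.2 fun y hy =>
    (hσ y hy).contDiffWithinAt) hmaps, fun y hy => ?_⟩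
  have h1 : MDifferentiableAt 𝓘(ℝ, Eucl n) 𝓘(ℝ, Eucl n) σ y :=
    ((hσ y hy).differentiableAt (by simp)).mdifferentiableAt
  have h2 := mfderiv_comp y (hφ.mdifferentiableAt (hmaps hy)) h1
  rw [mfderiv_eq_fderiv] at h2
  change Function.Injective (mfderiv 𝓘(ℝ, Eucl n) I (φ ∘ σ) y)
  rw [h2]
  exact (hφ.injective _ (hmaps hy)).comp (hinj y hy)

namespace ChartAtInfinity

variable (c : ChartAtInfinity I M)

lemma isParam_symm : IsParam I c.Ψ.symm c.Ψ.target := by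
  refine ⟨c.Ψ.open_target, c.contMDiffOn_Ψ_symm, fun y hy => ?_⟩
  have h1 : MDifferentiableAt 𝓘(ℝ, Eucl n) I c.Ψ.symm y :=
    (c.contMDiffOn_Ψ_symm.contMDiffAt (c.Ψ.open_target.mem_nhds hy)).mdifferentiableAt (by simp)
  have h2 : MDifferentiableAt I 𝓘(ℝ, Eucl n) c.Ψ (c.Ψ.symm y) :=
    (c.contMDiffOn_Ψ.contMDiffAt (c.Ψ.open_source.mem_nhds
      (c.Ψ.map_target hy))).mdifferentiableAt (by simp)
  have h3 : c.Ψ ∘ c.Ψ.symm =ᶠ[𝓝 y] id := by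
    filter_upwards [c.Ψ.open_target.mem_nhds hy] with z hz using c.Ψ.right_inv hz
  have h4 := mfderiv_comp y h2 h1
  rw [h3.mfderiv_eq, mfderiv_id] at h4
  intro v w hvw
  have h5 := congrArg (mfderiv I 𝓘(ℝ, Eucl n) c.Ψ (c.Ψ.symm y)) hvw
  have h6 := fun v : Eucl n => DFunLike.congr_fun h4 v
  exact (h6 v).trans (h5.trans (h6 w).symm)

variable {c} {x y : Eucl n}

lemma hypTranslation_mem_target (hx : x ∈ hypExterior n (c.R₀ + 1)) (hy : y ∈ hypUnitBall n) :
    hypTranslation x y ∈ c.Ψ.target := by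
  rw [c.target_eq]
  exact hypTranslation_mem_hypExterior c.R₀_pos.le hx.1.le hx.2 (mem_ball_zero_iff.1 hy)

lemma isParam_param (hx : x ∈ hypExterior n (c.R₀ + 1)) :
    IsParam I (c.param x) (hypUnitBall n) :=
  c.isParam_symm.comp Metric.isOpen_ball
    (fun _ hy => contDiffAt_hypTranslation (hypDenom_pos hx.2 (norm_lt_one_of_mem_hypUnitBall hy)).ne')
    (fun _ hy => hypTranslation_mem_target hx hy)
    (fun _ hy => injective_fderiv_hypTranslation
      (hypDenom_pos hx.2 (norm_lt_one_of_mem_hypUnitBall hy)) hx.2)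

end ChartAtInfinity

/-- The components of the hyperbolic metric of the Poincaré ball. -/
noncomputable def hypComponents (n : ℕ) (y : Eucl n) : Fin n → Fin n → ℝ := fun i j =>
  4 / (1 - ‖y‖ ^ 2) ^ 2 * inner ℝ (coordVec i) (coordVec j : Eucl n)

lemma contDiffAt_hypComponents {y : Eucl n} (hy : ‖y‖ < 1) :
    ContDiffAt ℝ ∞ (hypComponents n) y := by
  have h1 : 1 - ‖y‖ ^ 2 ≠ 0 := by
    have := pow_lt_one₀ (norm_nonneg y) hy two_ne_zero
    linarith
  have h2 : ContDiffAt ℝ ∞ (fun y : Eucl n => (1 - ‖y‖ ^ 2) ^ 2) y := by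
    exact ((contDiff_const.sub (contDiff_norm_sq ℝ)).pow 2).contDiffAt
  refine contDiffAt_pi.2 fun i => contDiffAt_pi.2 fun j => ?_
  exact (contDiffAt_const.div h2 (pow_ne_zero 2 h1)).mul contDiffAt_const

lemma bilin_hypComponents (y v : Eucl n) :
    bilin (hypComponents n y) v v = 4 / (1 - ‖y‖ ^ 2) ^ 2 * ‖v‖ ^ 2 := by
  have h1 : ‖v‖ ^ 2 = ∑ i, ∑ j, v i * (v j * inner ℝ (coordVec i) (coordVec j : Eucl n)) := by
    conv_lhs => rw [← real_inner_self_eq_norm_sq, ← sum_coordVec v]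
    simp only [sum_inner, inner_sum, real_inner_smul_left, real_inner_smul_right]
    exact Finset.sum_congr rfl fun i _ => Finset.sum_congr rfl fun j _ => by
      rw [real_inner_comm]
  rw [h1]
  simp only [bilin, hypComponents, Finset.mul_sum]
  exact Finset.sum_congr rfl fun i _ => Finset.sum_congr rfl fun j _ => by ring

section Decay

/-- Only the `C^k` part of the Hölder norm is used; the weight is divided out and becomes decay of
the jet. -/
lemma JetBound.of_weighted {E V : Type*} [NormedAddCommGroup E] [NormedSpace ℝ E]
    [NormedAddCommGroup V] [NormedSpace ℝ V] {k : ℕ} {α : ℝ≥0} {a : ℝ} (ha : 0 < a)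
    {D : ENNReal} (hD : D < ⊤) {F G : E → V} {s : Set E} {y : E} (hs : s ∈ 𝓝 y)
    (hG : ContDiffAt ℝ k G y) (hFG : F =ᶠ[𝓝 y] G)
    (h : ENNReal.ofReal a * eCkHolderNorm k α s F ≤ D) : JetBound k (D.toReal * a⁻¹) G y := by
  refine JetBound.congr (JetBound.of_eCkNorm_le hs (hG.congr_of_eventuallyEq hFG)
    (mul_nonneg ENNReal.toReal_nonneg (by positivity)) ?_) hFG
  have h1 : eCkNorm k s F ≤ eCkHolderNorm k α s F := le_self_add
  have h2 : ENNReal.ofReal a * eCkNorm k s F ≤ D := (mul_le_mul_right h1 _).trans h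
  rw [ENNReal.ofReal_mul ENNReal.toReal_nonneg, ENNReal.ofReal_toReal hD.ne,
    ENNReal.ofReal_inv_of_pos ha, ← div_eq_mul_inv, ENNReal.le_div_iff_mul_le
    (Or.inl (ENNReal.ofReal_pos.2 ha).ne') (Or.inl ENNReal.ofReal_ne_top), mul_comm]
  exact h2

lemma hypRho_pos {x : Eucl n} (hx : ‖x‖ < 1) : 0 < hypRho x := by
  have := pow_lt_one₀ (norm_nonneg x) hx two_ne_zero
  unfold hypRho
  linarith

variable [IsManifold I ∞ M] [RiemannianBundle (fun x : M => TangentSpace I x)]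
  {α : ℝ≥0} {τ : ℝ} {K : TwoTensor I M} {c : ChartAtInfinity I M}

namespace IsAsympAntiDeSitter

lemma exists_jetBound_metric (h : IsAsympAntiDeSitter 2 α τ K c) :
    ∃ C : ℝ, 0 < C ∧ ∀ x ∈ hypExterior n (c.R₀ + 1), ∀ y ∈ hypUnitBall n,
      JetBound 2 (C * hypRho x ^ τ) (fun z =>
        tensorComponents I (c.param x) univ (metricTensor I M) z - hypComponents n z) y := by
  refine ⟨(c.metricDeviation 2 α τ (metricTensor I M)).toReal + 1,
    add_pos_of_nonneg_of_pos ENNReal.toReal_nonneg one_pos, fun x hx y hy => ?_⟩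
  have hρ := hypRho_pos hx.2
  have hy1 := norm_lt_one_of_mem_hypUnitBall hy
  have ho : hypUnitBall n ∈ 𝓝 y := Metric.isOpen_ball.mem_nhds hy
  have h1 : ContDiffAt ℝ ((2 : ℕ) : WithTop ℕ∞) (fun z =>
      tensorComponents I (c.param x) univ (metricTensor I M) z - hypComponents n z) y :=
    ((ChartAtInfinity.isParam_param hx).contDiffAt_tensorComponents hy h.metric_loc).sub
      ((contDiffAt_hypComponents hy1).of_le (WithTop.coe_le_coe.2 le_top))
  have h2 : (fun z => tensorComponents I (c.param x) (hypUnitBall n) (metricTensor I M) z -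
        tensorComponents 𝓘(ℝ, Eucl n) (hypTranslation x) (hypUnitBall n) (hypMetric n) z) =ᶠ[𝓝 y]
      fun z => tensorComponents I (c.param x) univ (metricTensor I M) z - hypComponents n z := by
    filter_upwards [ho] with z hz
    rw [tensorComponents_of_mem_nhds (s := hypUnitBall n) (Metric.isOpen_ball.mem_nhds hz),
      tensorComponents_hypMetric hx.2 hz]
    rfl
  refine (JetBound.of_weighted (a := hypRho x ^ (-τ)) (by positivity) h.metric_decay ho h1 h2
    (le_iSup₂ (f := fun x (_ : x ∈ hypExterior n (c.R₀ + 1)) => ENNReal.ofReal (hypRho x ^ (-τ)) *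
      eCkHolderNorm 2 α (hypUnitBall n) (fun y =>
      tensorComponents I (c.param x) (hypUnitBall n) (metricTensor I M) y -
        tensorComponents 𝓘(ℝ, Eucl n) (hypTranslation x) (hypUnitBall n) (hypMetric n) y))
      x hx)).mono ?_
  rw [Real.rpow_neg hρ.le, inv_inv]
  gcongr
  linarith

lemma exists_jetBound_K (h : IsAsympAntiDeSitter 2 α τ K c) :
    ∃ C : ℝ, 0 < C ∧ ∀ x ∈ hypExterior n (c.R₀ + 1), ∀ y ∈ hypUnitBall n,
      JetBound 1 (C * hypRho x ^ τ) (tensorComponents I (c.param x) univ K) y := by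
  refine ⟨(c.tensorNorm 1 α τ K).toReal + 1,
    add_pos_of_nonneg_of_pos ENNReal.toReal_nonneg one_pos, fun x hx y hy => ?_⟩
  have hρ := hypRho_pos hx.2
  have ho : hypUnitBall n ∈ 𝓝 y := Metric.isOpen_ball.mem_nhds hy
  have h1 := (ChartAtInfinity.isParam_param hx).contDiffAt_tensorComponents hy h.K_loc
  have h2 : tensorComponents I (c.param x) (hypUnitBall n) K =ᶠ[𝓝 y]
      tensorComponents I (c.param x) univ K := by
    filter_upwards [ho] with z hz
    exact tensorComponents_of_mem_nhds (Metric.isOpen_ball.mem_nhds hz)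
  refine (JetBound.of_weighted (a := hypRho x ^ (-τ)) (by positivity) h.K_decay ho h1 h2
    (le_iSup₂ (f := fun x (_ : x ∈ hypExterior n (c.R₀ + 1)) => ENNReal.ofReal (hypRho x ^ (-τ)) *
      eCkHolderNorm 1 α (hypUnitBall n) (tensorComponents I (c.param x) (hypUnitBall n) K))
      x hx)).mono ?_
  rw [Real.rpow_neg hρ.le, inv_inv]
  gcongr
  linarith

end IsAsympAntiDeSitter

end Decay

end End

/-! ### Uniform comparison of the metric and the distance with the Euclidean ones in the end. -/

section EndGeometry

variable {n : ℕ} {H : Type*} [TopologicalSpace H] {I : ModelWithCorners ℝ (Eucl n) H}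

section

variable {M : Type*} [TopologicalSpace M] [ChartedSpace H M] [IsManifold I ∞ M]
  [RiemannianBundle (fun x : M => TangentSpace I x)]
  {α : ℝ≥0} {τ : ℝ} {K : TwoTensor I M} {c : ChartAtInfinity I M}

lemma hypRho_le_half (x : Eucl n) : hypRho x ≤ 1 / 2 := by
  unfold hypRho
  linarith [sq_nonneg ‖x‖]

namespace IsAsympAntiDeSitter

lemma exists_abs_bilin_sub_le (h : IsAsympAntiDeSitter 2 α τ K c) :
    ∃ C : ℝ, 0 < C ∧ ∀ x ∈ hypExterior n (c.R₀ + 1), ∀ y ∈ hypUnitBall n, ∀ v,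
      |bilin (tensorComponents I (c.param x) univ (metricTensor I M) y) v v -
        4 / (1 - ‖y‖ ^ 2) ^ 2 * ‖v‖ ^ 2| ≤ C * hypRho x ^ τ * ‖v‖ ^ 2 := by
  obtain ⟨C, hC, hJ⟩ := h.exists_jetBound_metric
  refine ⟨n ^ 2 * C + 1, by positivity, fun x hx y hy v => ?_⟩
  have hρ := hypRho_pos hx.2
  rw [← bilin_hypComponents, ← bilin_sub]
  refine (LocalCoords.abs_bilin_le_of_le (hJ x hx y hy).norm_le v v).trans ?_
  have : 0 ≤ hypRho x ^ τ * ‖v‖ ^ 2 := by positivity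
  nlinarith only [this]

lemma exists_bilin_metric_le (h : IsAsympAntiDeSitter 2 α τ K c) (hτ : 0 < τ) :
    ∃ C : ℝ, 0 < C ∧ ∀ x ∈ hypExterior n (c.R₀ + 1), ∀ y ∈ hypUnitBall n, ∀ v,
      bilin (tensorComponents I (c.param x) univ (metricTensor I M) y) v v ≤
        C ^ 2 * ‖v‖ ^ 2 := by
  obtain ⟨C, hC, hb⟩ := h.exists_abs_bilin_sub_le
  obtain ⟨t, ht⟩ : ∃ t, t = Real.tanh (1 / 2) := ⟨_, rfl⟩
  have ht0 : 0 < t := ht ▸ tanh_half_pos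
  have ht1 : t < 1 := ht ▸ Real.tanh_lt_one _
  have ht2 : 0 < 1 - t ^ 2 := by nlinarith
  refine ⟨C + 4 / (1 - t ^ 2) ^ 2 + 1, by positivity, fun x hx y hy v => ?_⟩
  have h1 := (abs_le.1 (hb x hx y hy v)).2
  have hρ := hypRho_pos hx.2
  have h2 : hypRho x ^ τ ≤ 1 :=
    Real.rpow_le_one hρ.le ((hypRho_le_half x).trans (by norm_num)) hτ.le
  have hyt : ‖y‖ < t := ht ▸ mem_ball_zero_iff.1 hy
  have h3 : 4 / (1 - ‖y‖ ^ 2) ^ 2 ≤ 4 / (1 - t ^ 2) ^ 2 := by gcongr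
  obtain ⟨E, hE⟩ : ∃ E, E = 4 / (1 - t ^ 2) ^ 2 := ⟨_, rfl⟩
  have hE0 : 0 < E := by rw [hE]; positivity
  rw [← hE] at h3 ⊢
  have h4 : C * hypRho x ^ τ * ‖v‖ ^ 2 ≤ C * ‖v‖ ^ 2 := by
    have : 0 ≤ C * ‖v‖ ^ 2 * (1 - hypRho x ^ τ) := mul_nonneg (by positivity) (by linarith)
    linarith
  have h5 := mul_le_mul_of_nonneg_right h3 (sq_nonneg ‖v‖)
  have h6 : 0 ≤ ((C + E + 1) ^ 2 - (C + E)) * ‖v‖ ^ 2 :=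
    mul_nonneg (by nlinarith) (sq_nonneg _)
  linarith

/-- The hyperbolic metric is at least `4 ‖v‖²` in these coordinates, and the error `C ρ^τ` is below
`2` once `ρ` is small. Unlike the upper bound, this is claimed only far out. -/
lemma exists_le_bilin_metric (h : IsAsympAntiDeSitter 2 α τ K c) (hτ : 0 < τ) :
    ∃ δ : ℝ, 0 < δ ∧ ∀ x ∈ hypExterior n (c.R₀ + 1), hypRho x < δ → ∀ y ∈ hypUnitBall n, ∀ v,
      2 * ‖v‖ ^ 2 ≤ bilin (tensorComponents I (c.param x) univ (metricTensor I M) y) v v := by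
  obtain ⟨C, hC, hb⟩ := h.exists_abs_bilin_sub_le
  refine ⟨(2 / C) ^ τ⁻¹, by positivity, fun x hx hxδ y hy v => ?_⟩
  have h1 := (abs_le.1 (hb x hx y hy v)).1
  have hρ := hypRho_pos hx.2
  have h2 := Real.rpow_lt_rpow hρ.le hxδ hτ
  rw [Real.rpow_inv_rpow (by positivity) hτ.ne', lt_div_iff₀ hC] at h2
  have hy1 := norm_lt_one_of_mem_hypUnitBall hy
  have hy2 := pow_lt_one₀ (norm_nonneg y) hy1 two_ne_zero
  have h3 : 4 ≤ 4 / (1 - ‖y‖ ^ 2) ^ 2 := by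
    rw [le_div_iff₀ (pow_pos (by linarith) 2)]
    have : (1 - ‖y‖ ^ 2) ^ 2 ≤ 1 := pow_le_one₀ (by linarith) (by linarith [sq_nonneg ‖y‖])
    linarith
  have h4 := mul_le_mul_of_nonneg_right h3 (sq_nonneg ‖v‖)
  have h5 := mul_le_mul_of_nonneg_right h2.le (sq_nonneg ‖v‖)
  linarith

end IsAsympAntiDeSitter

end

variable {M : Type*} [EMetricSpace M] [ChartedSpace H M] [IsManifold I ∞ M]
  [RiemannianBundle (fun x : M => TangentSpace I x)]
  [IsRiemannianManifold I M]

omit [IsManifold I ∞ M] in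
-- The Riemannian distance is at most the length of the image of the straight segment.
lemma IsParam.edist_le {φ : Eucl n → M} {Ω : Set (Eucl n)} (hφ : IsParam I φ Ω)
    (hΩ : Convex ℝ Ω) {C : ℝ} (hC : 0 ≤ C) (h : ∀ y ∈ Ω, ∀ v,
      bilin (tensorComponents I φ univ (metricTensor I M) y) v v ≤ C ^ 2 * ‖v‖ ^ 2)
    {y y' : Eucl n} (hy : y ∈ Ω) (hy' : y' ∈ Ω) :
    edist (φ y) (φ y') ≤ ENNReal.ofReal (C * ‖y' - y‖) := by
  obtain ⟨l, hl⟩ : ∃ l : ℝ → Eucl n, l = fun t => y + t • (y' - y) := ⟨_, rfl⟩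
  have hld : ∀ t, HasDerivAt l (y' - y) t := fun t => by
    rw [hl]
    simpa using ((hasDerivAt_id t).smul_const (y' - y)).const_add y
  have hlΩ : MapsTo l (Icc 0 1) Ω := fun t ht => by
    rw [hl]
    exact hΩ.add_smul_sub_mem hy hy' ht
  have hls : ContMDiff 𝓘(ℝ, ℝ) 𝓘(ℝ, Eucl n) ∞ l := by
    rw [contMDiff_iff_contDiff, hl]
    fun_prop
  have hγ : ContMDiffOn 𝓘(ℝ, ℝ) I 1 (φ ∘ l) (Icc 0 1) :=
    (hφ.contMDiffOn.of_le (by simp)).comp (hls.contMDiffOn.of_le (by simp)) hlΩ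
  rw [IsRiemannianManifold.out (I := I) (φ y) (φ y')]
  refine (Manifold.riemannianEDist_le_pathELength hγ (by simp [hl]) (by simp [hl])
    zero_le_one).trans ?_
  rw [Manifold.pathELength_eq_lintegral_mfderiv_Ioo]
  have key : ∀ t ∈ Ioo (0 : ℝ) 1, ‖mfderiv 𝓘(ℝ, ℝ) I (φ ∘ l) t 1‖ₑ ≤
      ENNReal.ofReal (C * ‖y' - y‖) := by
    intro t ht
    have htΩ := hlΩ (Ioo_subset_Icc_self ht)
    have h1 : mfderiv 𝓘(ℝ, ℝ) I (φ ∘ l) t 1 =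
        (mfderiv 𝓘(ℝ, Eucl n) I φ (l t) (y' - y) : TangentSpace I (φ (l t))) := by
      rw [mfderiv_comp t (hφ.mdifferentiableAt htΩ) (hld t).differentiableAt.mdifferentiableAt,
        mfderiv_eq_fderiv, (hld t).hasFDerivAt.fderiv]
      change mfderiv 𝓘(ℝ, Eucl n) I φ (l t) ((1 : ℝ) • (y' - y)) = _
      rw [one_smul]
    have h2 := h (l t) htΩ (y' - y)
    rw [bilin_metric_self, ← mul_pow] at h2
    have h3 := (pow_le_pow_iff_left₀ (norm_nonneg _) (by positivity) two_ne_zero).1 h2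
    rw [← ofReal_norm]
    refine ENNReal.ofReal_le_ofReal ?_
    rw [h1]
    exact h3
  refine (MeasureTheory.setLIntegral_mono' measurableSet_Ioo key).trans ?_
  simp

end EndGeometry

/-! ### Compactness of the part of the end at bounded distance. -/

section Compactness

variable {n : ℕ} {H : Type*} [TopologicalSpace H] {I : ModelWithCorners ℝ (Eucl n) H}
  {M : Type*} [EMetricSpace M] [ChartedSpace H M]

lemma continuousOn_hypTranslation_uncurry :
    ContinuousOn (fun p : Eucl n × Eucl n => hypTranslation p.1 p.2)
      {p | ‖p.1‖ < 1 ∧ ‖p.2‖ < 1} := by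
  have h1 : Continuous fun p : Eucl n × Eucl n => hypDenom p.1 p.2 := by
    unfold hypDenom
    fun_prop
  unfold hypTranslation
  refine ContinuousOn.smul (h1.continuousOn.inv₀ fun p hp => (hypDenom_pos hp.1 hp.2).ne') ?_
  fun_prop

/-- The compact set of the points `σ_x(y)` with `|x| ∈ [s₀, s₁]` and `|y| ≤ b`. -/
lemma ChartAtInfinity.isCompact_image_param (c : ChartAtInfinity I M) {s b : ℝ} (hs : s < 1)
    (hb : b < Real.tanh (1 / 2)) :
    IsCompact ((fun p : Eucl n × Eucl n => c.param p.1 p.2) ''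
      ((Metric.closedBall 0 s ∩ {x | Real.tanh ((c.R₀ + 1) / 2) ≤ ‖x‖}) ×ˢ
        Metric.closedBall 0 b)) := by
  have h1 : IsCompact ((Metric.closedBall 0 s ∩ {x : Eucl n | Real.tanh ((c.R₀ + 1) / 2) ≤ ‖x‖}) ×ˢ
        Metric.closedBall (0 : Eucl n) b) :=
    ((isCompact_closedBall _ _).inter_right (isClosed_le continuous_const continuous_norm)).prod
      (isCompact_closedBall _ _)
  refine h1.image_of_continuousOn ?_
  refine c.Ψ.symm.continuousOn.comp (continuousOn_hypTranslation_uncurry.mono ?_) ?_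
  · rintro p ⟨⟨hp1, -⟩, hp2⟩
    exact ⟨(mem_closedBall_zero_iff.1 hp1).trans_lt hs,
      ((mem_closedBall_zero_iff.1 hp2).trans_lt hb).trans (Real.tanh_lt_one _)⟩
  · rintro p ⟨⟨hp1, hp0⟩, hp2⟩
    change hypTranslation p.1 p.2 ∈ c.Ψ.target
    rw [c.target_eq]
    exact hypTranslation_mem_hypExterior c.R₀_pos.le hp0
      ((mem_closedBall_zero_iff.1 hp1).trans_lt hs) ((mem_closedBall_zero_iff.1 hp2).trans_lt hb)

variable [IsManifold I ∞ M] [RiemannianBundle (fun x : M => TangentSpace I x)]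
  [IsRiemannianManifold I M] {α : ℝ≥0} {τ : ℝ} {K : TwoTensor I M} {c : ChartAtInfinity I M}

lemma IsAsympAntiDeSitter.exists_edist_param_le (h : IsAsympAntiDeSitter 2 α τ K c) (hτ : 0 < τ) :
    ∃ C : ℝ, 0 < C ∧ ∀ x ∈ hypExterior n (c.R₀ + 1), ∀ y ∈ hypUnitBall n, ∀ y' ∈ hypUnitBall n,
      edist (c.param x y) (c.param x y') ≤ ENNReal.ofReal (C * ‖y' - y‖) := by
  obtain ⟨C, hC, hb⟩ := h.exists_bilin_metric_le hτ
  exact ⟨C, hC, fun x hx y hy y' hy' => (ChartAtInfinity.isParam_param hx).edist_le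
    (convex_ball _ _) hC.le (hb x hx) hy hy'⟩

/-- The points at bounded distance in the end form a relatively compact set. -/
lemma IsAsympAntiDeSitter.isCompact_closure_annulus [CompleteSpace M]
    (h : IsAsympAntiDeSitter 2 α τ K c) (hτ : 0 < τ) {t : ℝ} (ht0 : 0 ≤ t) (ht1 : t < 1) :
    IsCompact (closure (c.Ψ.symm '' {z | z ∈ hypExterior n c.R₀ ∧ ‖z‖ ≤ t})) := by
  obtain ⟨C, hC, hU⟩ := h.exists_edist_param_le hτ
  -- Completeness reduces compactness to total boundedness. The closure matters because the inner
  -- edge of the end lies outside the chart.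
  refine (TotallyBounded.closure ?_).isCompact_of_isClosed isClosed_closure
  refine EMetric.totallyBounded_iff.2 fun ε hε => ?_
  obtain ⟨δ, hδ0, hδ⟩ := ENNReal.lt_iff_exists_nnreal_btwn.1 (ENNReal.half_pos hε.ne')
  have hδ0' : (0 : ℝ) < δ := by exact_mod_cast hδ0
  -- Shrinking `y` by the factor `1 - η` moves the point by at most `C η ≤ δ < ε / 2` and puts it in
  -- a compact image, for which a finite net of size `ε / 2` exists.
  obtain ⟨η, hη⟩ : ∃ η : ℝ, η = min (1 / 2) (δ / C) := ⟨_, rfl⟩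
  have hη0 : 0 < η := by rw [hη]; positivity
  have hη1 : η ≤ 1 / 2 := by rw [hη]; exact min_le_left _ _
  have hηC : C * η ≤ δ := by
    rw [← le_div_iff₀' hC, hη]
    exact min_le_right _ _
  have hτ0 := tanh_half_pos
  have hτ1 := Real.tanh_lt_one (1 / 2)
  obtain ⟨b, hb⟩ : ∃ b, b = Real.tanh (1 / 2) := ⟨_, rfl⟩
  rw [← hb] at hτ0 hτ1
  have hs : (t + b) / (1 + t * b) < 1 := by
    rw [div_lt_one (by positivity)]
    have : 0 < (1 - t) * (1 - b) := mul_pos (by linarith) (by linarith)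
    nlinarith only [this]
  have hbη : (1 - η) * b < Real.tanh (1 / 2) := by rw [← hb]; nlinarith
  obtain ⟨S, hSf, hS⟩ := EMetric.totallyBounded_iff.1
    (c.isCompact_image_param hs hbη).totallyBounded (ε / 2) (ENNReal.half_pos hε.ne')
  refine ⟨S, hSf, ?_⟩
  rintro _ ⟨z, ⟨hz, hzt⟩, rfl⟩
  obtain ⟨x, hx, y, hy, hxy, hxn⟩ := exists_hypTranslation_eq c.R₀_pos.le hz
  rw [← hb] at hxn
  have hyb : ‖y‖ < b := hb ▸ mem_ball_zero_iff.1 hy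
  have hxs : ‖x‖ ≤ (t + b) / (1 + t * b) := by
    refine hxn.trans ?_
    rw [div_le_div_iff₀ (by positivity) (by positivity)]
    have : 0 ≤ (t - ‖z‖) * (1 - b * b) := mul_nonneg (by linarith) (by nlinarith)
    nlinarith only [this]
  have hyη : ‖(1 - η) • y‖ ≤ (1 - η) * b := by
    rw [norm_smul, Real.norm_eq_abs, abs_of_pos (by linarith)]
    gcongr
    linarith
  have hy' : (1 - η) • y ∈ hypUnitBall n := mem_ball_zero_iff.2 (hyη.trans_lt hbη)
  have h1 : c.param x ((1 - η) • y) ∈ (fun p : Eucl n × Eucl n => c.param p.1 p.2) ''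
      ((Metric.closedBall 0 ((t + b) / (1 + t * b)) ∩ {x | Real.tanh ((c.R₀ + 1) / 2) ≤ ‖x‖}) ×ˢ
        Metric.closedBall 0 ((1 - η) * b)) :=
    ⟨(x, (1 - η) • y), ⟨⟨mem_closedBall_zero_iff.2 hxs, hx.1.le⟩,
      mem_closedBall_zero_iff.2 hyη⟩, rfl⟩
  obtain ⟨p, hp, hp'⟩ := mem_iUnion₂.1 (hS h1)
  refine mem_iUnion₂.2 ⟨p, hp, ?_⟩
  have h2 := hU x hx y hy _ hy'
  have h3 : ‖(1 - η) • y - y‖ ≤ η := by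
    rw [sub_smul, one_smul, sub_sub_cancel_left, norm_neg, norm_smul, Real.norm_eq_abs,
      abs_of_pos hη0]
    nlinarith [norm_nonneg y]
  have h4 : ENNReal.ofReal (C * ‖(1 - η) • y - y‖) < ε / 2 := by
    refine lt_of_le_of_lt ?_ hδ
    rw [← ENNReal.ofReal_coe_nnreal]
    exact ENNReal.ofReal_le_ofReal ((mul_le_mul_of_nonneg_left h3 hC.le).trans hηC)
  have h5 : c.param x y = c.Ψ.symm z := by rw [← hxy]; rfl
  rw [h5] at h2
  refine Metric.mem_eball.2 ((edist_triangle _ (c.param x ((1 - η) • y)) _).trans_lt ?_)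
  rw [← ENNReal.add_halves ε]
  exact ENNReal.add_lt_add (h2.trans_lt h4) hp'

end Compactness

/-! ### The gradient estimate near infinity. -/

section EndEstimate

variable {n : ℕ}

lemma hypTranslation_zero (x : Eucl n) : hypTranslation x 0 = x := by
  simp [hypTranslation]

/-- Uniform bounds for the quotient of the functions `ρ` at `x` and at the points near `x`. -/
lemma exists_jetBound_hypDenom_div {b : ℝ} (hb : b < 1) :
    ∃ C : ℝ, ∀ x : Eucl n, ‖x‖ ≤ 1 → ∀ y ∈ Metric.closedBall (0 : Eucl n) b,
      JetBound 2 C (fun z => hypDenom x z * (1 - ‖z‖ ^ 2)⁻¹) y := by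
  have hN := contDiff_norm_sq ℝ (E := Eucl n) (n := 2)
  have hne : ∀ z ∈ Metric.ball (0 : Eucl n) 1, 1 - ‖z‖ ^ 2 ≠ 0 := fun z hz => by
    have := pow_lt_one₀ (norm_nonneg z) (mem_ball_zero_iff.1 hz) two_ne_zero
    linarith
  have hinv : ContDiffOn ℝ 2 (fun z : Eucl n => (1 - ‖z‖ ^ 2)⁻¹) (Metric.ball 0 1) :=
    (contDiff_const.sub hN).contDiffOn.inv hne
  have hsub : Metric.closedBall (0 : Eucl n) b ⊆ Metric.ball 0 1 :=
    Metric.closedBall_subset_ball hb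
  have hcpt := isCompact_closedBall (0 : Eucl n) b
  obtain ⟨C₁, h₁⟩ := JetBound.exists_of_isCompact (k := 2) Metric.isOpen_ball hinv hcpt hsub
  obtain ⟨C₂, h₂⟩ := JetBound.exists_of_isCompact (k := 2) Metric.isOpen_ball
    (hN.contDiffOn.mul hinv) hcpt hsub
  obtain ⟨C₃, h₃⟩ := JetBound.exists_of_isCompact (k := 2) Metric.isOpen_ball
    (hinv.smul contDiff_id.contDiffOn) hcpt hsub
  -- The function is `1 / (1 - |z|²) + |x|² |z|² / (1 - |z|²) + 2 ⟨x, z / (1 - |z|²)⟩`. The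
  -- dependence on `x` sits in the bounded coefficients `|x|²` and `2 x`, hence the uniformity.
  refine ⟨C₁ + 2 ^ 2 * 1 * C₂ + 2 * C₃, fun x hx y hy => ?_⟩
  have k1 : JetBound 2 1 (fun _ : Eucl n => ‖x‖ ^ 2) y := by
    refine (JetBound.const (‖x‖ ^ 2) 2 y).mono ?_
    rw [Real.norm_eq_abs, abs_of_nonneg (by positivity)]
    exact pow_le_one₀ (norm_nonneg x) hx
  have k2 := (h₁ y hy).add (k1.mul (h₂ y hy))
  have k3 : JetBound 2 (2 * C₃) _ y := ((h₃ y hy).clm_comp ((2 : ℝ) • innerSL ℝ x)).mono (by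
    rw [norm_smul, innerSL_apply_norm, Real.norm_eq_abs, abs_two]
    have := (h₃ y hy).nonneg
    nlinarith)
  refine (k2.add k3).congr (Filter.Eventually.of_forall fun z => ?_)
  simp only [smul_apply, innerSL_apply_apply, real_inner_smul_right, smul_eq_mul, hypDenom, id_eq,
    Pi.smul_apply']
  ring

section Decay

variable {H : Type*} [TopologicalSpace H] {I : ModelWithCorners ℝ (Eucl n) H}
  {M : Type*} [EMetricSpace M] [ChartedSpace H M]

namespace ChartAtInfinity.CoreCover

variable {c : ChartAtInfinity I M} (B : c.CoreCover) {v : M → ℝ} {C : ENNReal}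

lemma eCkNorm_param_le {k : ℕ} (h : B.eNorm k v ≤ C) {x : Eucl n}
    (hx : x ∈ hypExterior n (c.R₀ + 1)) : eCkNorm k (hypUnitBall n) (v ∘ c.param x) ≤ C := by
  refine le_trans ?_ (le_self_add.trans h)
  exact le_iSup₂ (f := fun x (_ : x ∈ hypExterior n (c.R₀ + 1)) =>
    eCkNorm k (hypUnitBall n) (v ∘ c.param x)) x hx

lemma eCkNorm_chart_le {k : ℕ} (h : B.eNorm k v ≤ C) {p : M} (hp : p ∈ B.centers) :
    eCkNorm k (Metric.ball (extChartAt I p p) (B.radius p) ∩ range I)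
      (v ∘ (extChartAt I p).symm) ≤ C :=
  le_trans (Finset.single_le_sum (f := fun p =>
    eCkNorm k (Metric.ball (extChartAt I p p) (B.radius p) ∩ range I)
      (v ∘ (extChartAt I p).symm)) (fun _ _ => zero_le) hp) (le_add_self.trans h)

end ChartAtInfinity.CoreCover

variable [RiemannianBundle (fun x : M => TangentSpace I x)]

/-- The bound `C` for the gradient at `x` of the solutions of the Jang equation near `x`. -/
def HasJangBound {c : ChartAtInfinity I M} (B : c.CoreCover) (K : TwoTensor I M) (ρ : M → ℝ)
    (Λ m R T C : ℝ) (x : M) : Prop :=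
  ∀ (u f : M → ℝ) (ε : ℝ), ContMDiff I 𝓘(ℝ, ℝ) 2 u →
    B.eNorm 2 (fun x => u x - (ρ x)⁻¹) ≤ ENNReal.ofReal Λ → (∀ x, m ≤ u x) →
    IsJangSolution I K u f x R T ε → warpedGradNorm I u f x ≤ C

lemma HasJangBound.mono {c : ChartAtInfinity I M} {B : c.CoreCover} {K : TwoTensor I M}
    {ρ : M → ℝ} {Λ m R T C C' : ℝ} {x : M} (h : HasJangBound B K ρ Λ m R T C x) (hC : C ≤ C') :
    HasJangBound B K ρ Λ m R T C' x :=
  fun u f ε hu hN hm hf => (h u f ε hu hN hm hf).trans hC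

variable [IsManifold I ∞ M]

omit [RiemannianBundle (fun x : M => TangentSpace I x)] [IsManifold I ∞ M] in
lemma IsParam.jetBound_of_eCkNorm_le {φ : Eucl n → M} {Ω s : Set (Eucl n)} (hφ : IsParam I φ Ω)
    (hΩ : Ω ⊆ s) {v : M → ℝ} (hv : ContMDiff I 𝓘(ℝ, ℝ) 2 v) {Λ : ℝ} (hΛ : 0 ≤ Λ)
    (h : eCkNorm 2 s (v ∘ φ) ≤ ENNReal.ofReal Λ) {y : Eucl n} (hy : y ∈ Ω) :
    JetBound 2 Λ (fun z => v (φ z)) y := by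
  refine JetBound.of_eCkNorm_le (Filter.mem_of_superset (hφ.isOpen.mem_nhds hy) hΩ) ?_ hΛ h
  change ContDiffAt ℝ 2 (fun z => v (φ z)) y
  rw [← contMDiffAt_iff_contDiffAt]
  exact hv.contMDiffAt.comp y ((hφ.contMDiffAt hy).of_le
    (WithTop.coe_le_coe.2 le_top : ((2 : ℕ∞) : WithTop ℕ∞) ≤ ∞))

omit [RiemannianBundle (fun x : M => TangentSpace I x)] [IsManifold I ∞ M] in
lemma ChartAtInfinity.IsRho.contMDiff_inv {c : ChartAtInfinity I M} {ρ : M → ℝ}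
    (hρ : c.IsRho ρ) : ContMDiff I 𝓘(ℝ, ℝ) 2 fun x => (ρ x)⁻¹ := fun x => by
  have h1 : ContDiffAt ℝ 2 (fun t : ℝ => t⁻¹) (ρ x) := contDiffAt_inv ℝ (hρ.pos x).ne'
  exact h1.contMDiffAt.comp x (hρ.contMDiff x)

variable [IsRiemannianManifold I M] {α : ℝ≥0} {τ : ℝ} {K : TwoTensor I M}
  {c : ChartAtInfinity I M}

/-- The gradient estimate near infinity. -/
theorem IsAsympAntiDeSitter.exists_hasJangBound_end (h : IsAsympAntiDeSitter 2 α τ K c)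
    (hτ : 0 < τ) {ρ : M → ℝ} (hρ : c.IsRho ρ) (B : c.CoreCover) (Λ m : ℝ) {R T : ℝ}
    (hR : 0 < R) (hT : 0 < T) :
    ∃ δ : ℝ, 0 < δ ∧ ∀ r₀ : ℝ, 0 < r₀ → ∃ r C : ℝ, 0 < r ∧ r ≤ r₀ ∧ r ≤ Real.tanh (1 / 2) ∧
      ∀ x ∈ hypExterior n (c.R₀ + 1), hypRho x < δ →
        (∀ y ∈ Metric.ball 0 r, ρ (c.param x y) = hypRho (c.Ψ (c.param x y))) →
        HasJangBound B K ρ Λ m R T C (c.Ψ.symm x) := by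
  obtain ⟨δ₁, hδ₁, hlow⟩ := h.exists_le_bilin_metric hτ
  obtain ⟨Cd, hCd, hdist⟩ := h.exists_edist_param_le hτ
  obtain ⟨C₁, hC₁, hg⟩ := h.exists_jetBound_metric
  obtain ⟨C₂, hC₂, hK⟩ := h.exists_jetBound_K
  obtain ⟨L, hL⟩ : ∃ L, L = max Λ 0 := ⟨_, rfl⟩
  have hL0 : 0 ≤ L := hL ▸ le_max_right _ _
  obtain ⟨b, hb⟩ : ∃ b, b = Real.tanh (1 / 2) / 2 := ⟨_, rfl⟩
  have hb0 : 0 < b := by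
    have := tanh_half_pos
    rw [hb]
    positivity
  have hb1 : b < 1 / 2 := by
    have := Real.tanh_lt_one (1 / 2)
    rw [hb]
    linarith
  have hbt : b ≤ Real.tanh (1 / 2) := by linarith
  obtain ⟨C₃, hC₃⟩ := exists_jetBound_hypDenom_div (n := n) (b := b) (by linarith)
  obtain ⟨C₄, hC₄⟩ := JetBound.exists_of_isCompact (k := 2) (F := hypComponents n)
    (Metric.isOpen_ball (x := (0 : Eucl n)) (ε := 1)) (fun y hy =>
      ((contDiffAt_hypComponents (mem_ball_zero_iff.1 hy)).of_le
        (WithTop.coe_le_coe.2 le_top)).contDiffWithinAt)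
    (isCompact_closedBall 0 b) (Metric.closedBall_subset_ball (by linarith))
  -- `δ₁` secures the lower bound of the metric; the second entry gives `ρ(x) L < 1 / 8`, for the
  -- lower bound of the rescaled `u`. `δ` does not involve `r₀`, since `r₀` is later chosen
  -- depending on `δ`.
  refine ⟨min δ₁ (1 / (8 * (L + 1))), by positivity, fun r₀ hr₀ => ?_⟩
  obtain ⟨r, hr⟩ : ∃ r, r = min (min r₀ b) (R / Cd) := ⟨_, rfl⟩
  have hr0 : 0 < r := by rw [hr]; positivity
  have hrb : r ≤ b := by rw [hr]; exact (min_le_left _ _).trans (min_le_right _ _)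
  have hrR : Cd * r ≤ R := by
    rw [← le_div_iff₀' hCd, hr]
    exact min_le_right _ _
  obtain ⟨Q, hQ⟩ : ∃ Q, Q = max (max (C₁ + C₄) C₂) (max (2 ^ 2 * 1 * L + C₃) 1) := ⟨_, rfl⟩
  have hQ0 : 0 < Q := by rw [hQ]; simp
  obtain ⟨C, hC⟩ := exists_warpedGradNorm_bound h.metric_loc h.K_symm hr0 two_pos hQ0
    (by norm_num : (0 : ℝ) < 1 / 8) hT
  refine ⟨r, C, hr0, by rw [hr]; exact (min_le_left _ _).trans (min_le_left _ _),
    hrb.trans hbt, ?_⟩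
  intro x hx hxδ hρx u f ε hu hN hmu hf
  have hs0 := hypRho_pos hx.2
  have hs1 := hypRho_le_half x
  have hsτ : hypRho x ^ τ ≤ 1 := Real.rpow_le_one hs0.le (by linarith) hτ.le
  have hx0 : c.param x 0 = c.Ψ.symm x := by
    unfold ChartAtInfinity.param
    rw [hypTranslation_zero]
  have hsub : Metric.ball (0 : Eucl n) r ⊆ hypUnitBall n := Metric.ball_subset_ball (hrb.trans hbt)
  have hsubc : Metric.ball (0 : Eucl n) r ⊆ Metric.closedBall 0 b :=
    (Metric.ball_subset_ball hrb).trans Metric.ball_subset_closedBall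
  have hφ := ChartAtInfinity.isParam_param (c := c) hx
  have hN' : B.eNorm 2 (fun x => u x - (ρ x)⁻¹) ≤ ENNReal.ofReal L :=
    hN.trans (ENNReal.ofReal_le_ofReal (hL ▸ le_max_left _ _))
  rw [← hx0]
  -- The scale `ρ(x)` compensates the growth of `u` like `ρ⁻¹`.
  refine hC (c.param x) (hypUnitBall n) 0 (hypRho x) ε u f hφ hsub hs0 (by linarith) hf.nonneg
    hf.le_one hu fun y hy => ?_
  have hyU := hsub hy
  have hyc := hsubc hy
  have hyn : ‖y‖ < r := mem_ball_zero_iff.1 hy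
  have hyR : c.param x y ∈ Metric.eball (c.Ψ.symm x) (ENNReal.ofReal R) := by
    rw [← hx0]
    refine Metric.mem_eball.2 (lt_of_le_of_lt (hdist x hx y hyU 0
      (mem_ball_zero_iff.2 (by rw [norm_zero]; exact tanh_half_pos))) ?_)
    rw [zero_sub, norm_neg]
    refine (ENNReal.ofReal_lt_ofReal_iff hR).2 (lt_of_lt_of_le ?_ hrR)
    gcongr
  have hv := hφ.jetBound_of_eCkNorm_le subset_rfl (hu.sub hρ.contMDiff_inv) hL0
    (B.eCkNorm_param_le hN' hx) hyU
  have hv' : JetBound 2 (2 ^ 2 * 1 * L) (fun z => hypRho x *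
      (u (c.param x z) - (ρ (c.param x z))⁻¹)) y :=
    JetBound.mul ((JetBound.const (hypRho x) 2 y).mono
      (by rw [Real.norm_eq_abs, abs_of_pos hs0]; linarith)) hv
  have hρ' : ∀ z ∈ Metric.ball (0 : Eucl n) r,
      hypRho x * (ρ (c.param x z))⁻¹ = hypDenom x z * (1 - ‖z‖ ^ 2)⁻¹ := by
    intro z hz
    have hz1 := norm_lt_one_of_mem_hypUnitBall (hsub hz)
    have hD := hypDenom_pos hx.2 hz1
    have hz2 := pow_lt_one₀ (norm_nonneg z) hz1 two_ne_zero
    have hz3 : 1 - ‖z‖ ^ 2 ≠ 0 := by linarith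
    rw [hρx z hz]
    have : c.Ψ (c.param x z) = hypTranslation x z :=
      c.Ψ.right_inv (ChartAtInfinity.hypTranslation_mem_target hx (hsub hz))
    rw [this, hypRho_hypTranslation hD.ne']
    field_simp
  have hu2 : JetBound 2 (2 ^ 2 * 1 * L + C₃) (fun z => hypRho x * u (c.param x z)) y := by
    refine (hv'.add (hC₃ x hx.2.le y hyc)).congr ?_
    filter_upwards [Metric.isOpen_ball.mem_nhds hy] with z hz
    rw [← hρ' z hz]
    ring
  refine ⟨?_, hlow x hx (hxδ.trans_le (min_le_left _ _)) y hyU, ?_, hu2.mono (by rw [hQ]; simp),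
    ?_, hf.contMDiffOn.contMDiffAt (Metric.isOpen_eball.mem_nhds hyR), hf.jang_eq _ hyR,
    hf.abs_le _ hyR⟩
  · have := (hg x hx y hyU).add (hC₄ y hyc)
    simp only [sub_add_cancel] at this
    refine this.mono (le_trans ?_ (hQ ▸ (le_max_left _ _).trans (le_max_left _ _)))
    have := mul_le_mul_of_nonneg_left hsτ hC₁.le
    linarith
  · refine (hK x hx y hyU).mono (le_trans ?_ (hQ ▸ (le_max_right _ _).trans (le_max_left _ _)))
    have := mul_le_mul_of_nonneg_left hsτ hC₂.le
    linarith
  · have h1 := (abs_le.1 hv.norm_le).1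
    have h2 := hρ' y hy
    have hy1 := norm_lt_one_of_mem_hypUnitBall hyU
    have hy2 := pow_lt_one₀ (norm_nonneg y) hy1 two_ne_zero
    -- As `‖x‖ < 1` and `‖y‖ < 1 / 2`. Thus the main part of `ρ(x) u` is at least `1 / 4`, and the
    -- deviation of `u` from `ρ⁻¹` costs less than `1 / 8`.
    have h3 : 1 / 4 ≤ hypDenom x y := by
      refine le_trans ?_ (sq_le_hypDenom x y)
      have : ‖x‖ * ‖y‖ ≤ 1 * (1 / 2) := mul_le_mul hx.2.le (by linarith) (norm_nonneg y) zero_le_one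
      nlinarith
    have h4 : hypDenom x y ≤ hypDenom x y * (1 - ‖y‖ ^ 2)⁻¹ := by
      refine le_mul_of_one_le_right (by linarith) ((one_le_inv₀ (by linarith)).2 ?_)
      linarith [sq_nonneg ‖y‖]
    have h5 : hypRho x * (8 * (L + 1)) < 1 := by
      rw [← lt_div_iff₀ (by positivity)]
      exact hxδ.trans_le (min_le_right _ _)
    have h6 := mul_le_mul_of_nonneg_left h1 hs0.le
    simp only [mul_sub] at h6
    nlinarith only [h2, h3, h4, h5, h6, hs0]

end Decay

end EndEstimate

/-! ### The estimate near compact sets and the global bound. -/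

section Main

variable {n : ℕ} {H : Type*} [TopologicalSpace H] {I : ModelWithCorners ℝ (Eucl n) H}
  {M : Type*} [EMetricSpace M] [ChartedSpace H M] [IsManifold I ∞ M]
  [RiemannianBundle (fun x : M => TangentSpace I x)]
  {α : ℝ≥0} {τ : ℝ} {K : TwoTensor I M} {c : ChartAtInfinity I M}

omit [RiemannianBundle (fun x : M => TangentSpace I x)] in
-- The coordinate ball is cut down to the interior of the model so that it becomes open. An interior
-- point survives because being interior does not depend on the chart.
lemma ChartAtInfinity.CoreCover.exists_isParam (B : c.CoreCover) {p : M}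
    (hp : I.IsInteriorPoint p) (hpc : p ∈ c.core) :
    ∃ q ∈ B.centers, ∃ Ω, IsParam I (extChartAt I q).symm Ω ∧
      Ω ⊆ Metric.ball (extChartAt I q q) (B.radius q) ∩ range I ∧
      ∃ y ∈ Ω, (extChartAt I q).symm y = p := by
  obtain ⟨q, hq, hpq, hpb⟩ := mem_iUnion₂.1 (B.core_subset hpc)
  refine ⟨q, hq, Metric.ball (extChartAt I q q) (B.radius q) ∩ interior (range I),
    isParam_extChartAt_symm q (Metric.isOpen_ball.inter isOpen_interior) ?_,
    inter_subset_inter_right _ interior_subset, extChartAt I q p, ⟨hpb, ?_⟩,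
    (extChartAt I q).left_inv hpq⟩
  · exact (inter_subset_inter Metric.ball_subset_closedBall interior_subset).trans
      (B.closedBall_subset q hq)
  · have h1 := (I.isInteriorPoint_iff_of_mem_atlas (M := M) (n := ∞) (by simp)
      (chart_mem_atlas H q) (by simpa using hpq)).1 hp
    exact interior_mono (extChartAt_target_subset_range q) h1

omit [IsManifold I ∞ M] [RiemannianBundle (fun x : M => TangentSpace I x)] in
lemma ChartAtInfinity.exists_isParam_of_notMem_core (c : ChartAtInfinity I M) {p : M}
    (hp : p ∉ c.core) :
    ∃ x ∈ hypExterior n (c.R₀ + 1), ∃ y ∈ hypUnitBall n, c.param x y = p := by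
  have h1 : p ∈ c.Ψ.source := by
    rw [c.source_eq]
    exact hp
  have h2 := c.Ψ.map_source h1
  rw [c.target_eq] at h2
  obtain ⟨x, hx, y, hy, hxy, -⟩ := exists_hypTranslation_eq c.R₀_pos.le h2
  refine ⟨x, hx, y, hy, ?_⟩
  unfold ChartAtInfinity.param
  rw [hxy]
  exact c.Ψ.left_inv h1

/-- The gradient estimate near a given point. -/
theorem IsAsympAntiDeSitter.exists_eventually_hasJangBound (h : IsAsympAntiDeSitter 2 α τ K c)
    {ρ : M → ℝ} (hρ : c.IsRho ρ) (B : c.CoreCover) (Λ : ℝ) {m R T : ℝ} (hm : 0 < m)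
    (hR : 0 < R) (hT : 0 < T) (p : M) :
    ∃ C, ∀ᶠ x in 𝓝 p, HasJangBound B K ρ Λ m R T C x := by
  by_cases hp : I.IsInteriorPoint p
  swap
  -- For `x` within `R` of a boundary point the ball of radius `R` about `x` is not contained in the
  -- interior, so there is nothing to estimate.
  · refine ⟨0, ?_⟩
    filter_upwards [Metric.eball_mem_nhds p (ENNReal.ofReal_pos.2 hR)] with x hx u f ε _ _ _ hf
    exact absurd (hf.eball_subset (Metric.mem_eball_comm.1 hx)) hp
  -- `Λ` may be negative here, whereas `ENNReal.ofReal Λ` is not affected by passing to `L`.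
  obtain ⟨L, hL⟩ : ∃ L, L = max Λ 0 := ⟨_, rfl⟩
  have hL0 : 0 ≤ L := hL ▸ le_max_right _ _
  have hΛL : ENNReal.ofReal Λ ≤ ENNReal.ofReal L := ENNReal.ofReal_le_ofReal (hL ▸ le_max_left _ _)
  by_cases hpc : p ∈ c.core
  · obtain ⟨q, hq, Ω, hφ, hΩ, y, hy, rfl⟩ := B.exists_isParam hp hpc
    obtain ⟨C, hC⟩ := hφ.eventually_warpedGradNorm_le h.metric_loc h.K_symm h.K_loc
      hρ.contMDiff_inv (Λ := L) hm hR hT hy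
    refine ⟨C, hC.mono fun x hx u f ε hu hN hmu hf => hx u f ε hu (fun z hz => ?_) hmu hf⟩
    exact hφ.jetBound_of_eCkNorm_le hΩ (hu.sub hρ.contMDiff_inv) hL0
      (B.eCkNorm_chart_le (hN.trans hΛL) hq) hz
  · obtain ⟨x', hx', y, hy, rfl⟩ := c.exists_isParam_of_notMem_core hpc
    have hφ := ChartAtInfinity.isParam_param (c := c) hx'
    obtain ⟨C, hC⟩ := hφ.eventually_warpedGradNorm_le h.metric_loc h.K_symm h.K_loc
      hρ.contMDiff_inv (Λ := L) hm hR hT hy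
    refine ⟨C, hC.mono fun x hx u f ε hu hN hmu hf => hx u f ε hu (fun z hz => ?_) hmu hf⟩
    exact hφ.jetBound_of_eCkNorm_le subset_rfl (hu.sub hρ.contMDiff_inv) hL0
      (B.eCkNorm_param_le (hN.trans hΛL) hx') hz

/-- The gradient estimate near a compact set. -/
theorem IsAsympAntiDeSitter.exists_hasJangBound_of_isCompact (h : IsAsympAntiDeSitter 2 α τ K c)
    {ρ : M → ℝ} (hρ : c.IsRho ρ) (B : c.CoreCover) (Λ : ℝ) {m R T : ℝ} (hm : 0 < m)
    (hR : 0 < R) (hT : 0 < T) {Q : Set M} (hQ : IsCompact Q) :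
    ∃ C, ∃ W, IsOpen W ∧ Q ⊆ W ∧ ∀ x ∈ W, HasJangBound B K ρ Λ m R T C x := by
  refine hQ.induction_on (p := fun Q => ∃ C, ∃ W, IsOpen W ∧ Q ⊆ W ∧
    ∀ x ∈ W, HasJangBound B K ρ Λ m R T C x) ⟨0, ∅, isOpen_empty, subset_rfl, by simp⟩ ?_ ?_ ?_
  · rintro s t hst ⟨C, W, hW, htW, hC⟩
    exact ⟨C, W, hW, hst.trans htW, hC⟩
  · rintro s t ⟨C, W, hW, hsW, hC⟩ ⟨C', W', hW', htW', hC'⟩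
    refine ⟨max C C', W ∪ W', hW.union hW', union_subset_union hsW htW', ?_⟩
    rintro x (hx | hx)
    · exact (hC x hx).mono (le_max_left _ _)
    · exact (hC' x hx).mono (le_max_right _ _)
  · intro p _
    obtain ⟨C, hC⟩ := h.exists_eventually_hasJangBound hρ B Λ hm hR hT p
    obtain ⟨W, hW, hWo, hpW⟩ := eventually_nhds_iff.1 hC
    exact ⟨W, mem_nhdsWithin_of_mem_nhds (hWo.mem_nhds hpW), C, W, hWo, subset_rfl, hW⟩

variable [CompleteSpace M] [IsRiemannianManifold I M]

/-- Far out in the end the rescaled estimate holds with one constant. The remaining points lie in a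
compact set, formed by the set where `ρ` may differ from its model and a relatively compact annulus.
-/
theorem IsAsympAntiDeSitter.exists_forall_hasJangBound (h : IsAsympAntiDeSitter 2 α τ K c)
    (hτ : 0 < τ) {ρ : M → ℝ} (hρ : c.IsRho ρ) (B : c.CoreCover) (Λ : ℝ) {m R T : ℝ} (hm : 0 < m)
    (hR : 0 < R) (hT : 0 < T) : ∃ C, 0 < C ∧ ∀ x, HasJangBound B K ρ Λ m R T C x := by
  obtain ⟨δ, hδ, hend⟩ := h.exists_hasJangBound_end hτ hρ B Λ m hR hT
  obtain ⟨Cd, hCd, hdist⟩ := h.exists_edist_param_le hτ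
  obtain ⟨S, hS, hcS, hρS⟩ := hρ.eq_hypRho
  -- `‖z‖ > t` means that `ρ(z) < δ` and that `z` is a centre of one of the unit balls in the norms.
  obtain ⟨t, ht⟩ : ∃ t, t = max √(1 - 2 * δ) (Real.tanh ((c.R₀ + 1) / 2)) := ⟨_, rfl⟩
  have ht0 : 0 ≤ t := ht ▸ (Real.sqrt_nonneg _).trans (le_max_left _ _)
  have ht1 : t < 1 := by
    rw [ht]
    refine max_lt ?_ (Real.tanh_lt_one _)
    rw [Real.sqrt_lt' one_pos]
    linarith
  obtain ⟨C₁, W, hW, hQW, hC₁⟩ := h.exists_hasJangBound_of_isCompact hρ B Λ hm hR hT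
    (hS.union (h.isCompact_closure_annulus hτ ht0 ht1))
  obtain ⟨r₁, hr₁, hthick⟩ := hS.exists_thickening_subset_open hW
    (subset_union_left.trans hQW)
  -- A coordinate ball of this size has diameter controlled through `Cd`: if it met `S`, its centre
  -- would lie in the `r₁`-neighbourhood of `S` and so in `W`. For centres outside `W` the function
  -- `ρ` is therefore the model function on the whole ball.
  obtain ⟨r, C₂, hr0, hr, hrt, hC₂⟩ := hend (r₁ / Cd) (by positivity)
  refine ⟨max (max C₁ C₂) 1, by positivity, fun x => ?_⟩
  by_cases hxW : x ∈ W
  · exact (hC₁ x hxW).mono ((le_max_left _ _).trans (le_max_left _ _))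
  refine HasJangBound.mono ?_ ((le_max_right C₁ C₂).trans (le_max_left _ 1))
  have hxs : x ∈ c.Ψ.source := by
    rw [c.source_eq]
    exact fun hx => hxW (hQW (Or.inl (hcS hx)))
  have hz := c.Ψ.map_source hxs
  rw [c.target_eq] at hz
  have hzx : c.Ψ.symm (c.Ψ x) = x := c.Ψ.left_inv hxs
  have hzt : t < ‖c.Ψ x‖ := by
    by_contra! hzt
    exact hxW (hQW (Or.inr (subset_closure ⟨c.Ψ x, ⟨hz, hzt⟩, hzx⟩)))
  have hzE : c.Ψ x ∈ hypExterior n (c.R₀ + 1) :=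
    ⟨lt_of_le_of_lt (ht ▸ le_max_right _ _) hzt, hz.2⟩
  have hzδ : hypRho (c.Ψ x) < δ := by
    have h1 : √(1 - 2 * δ) < ‖c.Ψ x‖ := lt_of_le_of_lt (ht ▸ le_max_left _ _) hzt
    rw [Real.sqrt_lt' (ht0.trans_lt hzt)] at h1
    unfold hypRho
    linarith
  have := hC₂ (c.Ψ x) hzE hzδ fun y hy => hρS _ fun hyS => hxW (hthick ?_)
  · rwa [hzx] at this
  have hy0 : (0 : Eucl n) ∈ hypUnitBall n :=
    mem_ball_zero_iff.2 (by rw [norm_zero]; exact tanh_half_pos)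
  have h1 := hdist (c.Ψ x) hzE 0 hy0 y (Metric.ball_subset_ball hrt hy)
  have h2 : c.param (c.Ψ x) 0 = x := by
    unfold ChartAtInfinity.param
    rw [hypTranslation_zero, hzx]
  rw [h2, sub_zero] at h1
  refine (Metric.infEDist_le_edist_of_mem hyS).trans_lt (h1.trans_lt ?_)
  refine (ENNReal.ofReal_lt_ofReal_iff hr₁).2 ?_
  have h3 : ‖y‖ < r₁ / Cd := (mem_ball_zero_iff.1 hy).trans_le hr
  rwa [lt_div_iff₀' hCd] at h3

end Main

theorem mainTheorem8 {n : ℕ} {H : Type*} [TopologicalSpace H]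
    (I : ModelWithCorners ℝ (Eucl n) H)
    {M : Type*} [EMetricSpace M] [CompleteSpace M] [ChartedSpace H M] [IsManifold I ∞ M]
    [RiemannianBundle (fun x : M => TangentSpace I x)]
    [IsContMDiffRiemannianBundle I 2 (Eucl n) (fun x : M => TangentSpace I x)]
    [IsRiemannianManifold I M]
    (α : ℝ≥0) (hα₀ : 0 < α) (hα₁ : α < 1) (τ : ℝ) (hτ : 0 < τ)
    (K : TwoTensor I M) (c : ChartAtInfinity I M) (hgK : IsAsympAntiDeSitter 2 α τ K c)
    (ρ : M → ℝ) (hρ : c.IsRho ρ) (B : c.CoreCover)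
    (Λ m R T : ℝ) (hm : 0 < m) (hR : 0 < R) (hT : 0 < T) :
    ∃ C : ℝ, 0 < C ∧ ∀ u : M → ℝ, ContMDiff I 𝓘(ℝ, ℝ) 2 u →
      B.eNorm 2 (fun x => u x - (ρ x)⁻¹) ≤ ENNReal.ofReal Λ → (∀ x, m ≤ u x) →
      ∀ (x₀ : M) (ε : ℝ) (f : M → ℝ), Metric.eball x₀ (ENNReal.ofReal R) ⊆ I.interior M →
        0 ≤ ε → ε < 1 →
        ContMDiffOn I 𝓘(ℝ, ℝ) 3 f (Metric.eball x₀ (ENNReal.ofReal R)) →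
        (∀ x ∈ Metric.eball x₀ (ENNReal.ofReal R), jangOperator I K u f x = ε * f x) →
        (∀ x ∈ Metric.eball x₀ (ENNReal.ofReal R), |u x * f x| ≤ T) →
        warpedGradNorm I u f x₀ ≤ C := by
  obtain ⟨C, hC0, hC⟩ := hgK.exists_forall_hasJangBound hτ hρ B Λ hm hR hT
  exact ⟨C, hC0, fun u hu hN hmu x₀ ε f hint hε0 hε1 hf hjang hT =>
    hC x₀ u f ε hu hN hmu ⟨hint, hε0, hε1.le, hf, hjang, hT⟩⟩
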